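/- **Model.** A limit order book starts empty. Orders arrive one at a time, at times increasing to infinity. The orders are i.i.d.: each is a bid or an ask with probability $1/2$, and its price has density $f_b$ for a bid and $f_a$ for an ask, with distribution functions $F_b,F_a$. Let $\beta_t$ be the highest bid in the book ($-\infty$ if there is none) and $\alpha_t$ the lowest ask ($+\infty$ if there is none). An ask arriving at a price below the current highest bid removes that bid and leaves; a bid arriving at a price above the current lowest ask removes that ask and leaves; every other order joins the book and stays until it is removed in this way. Let $$\kappa_b=\inf\{x:\ \mathbb P(\beta_t<x \text{ for arbitrarily large } t)=1\},\qquad \kappa_a=\sup\{x:\ \mathbb P(\alpha_t>x \text{ for arbitrarily large } t)=1\}.$$ We call the thresholds finite if they are real and lie inside the price range: $F_b(\kappa_b)>0$ and $F_a(\kappa_a)<1$. Assume that the distributions with densities $f_b$ and $f_a$ are mutually absolutely continuous. **Equation.** Let $I=\{x: F_a(x)>0,\ F_b(x)<1\}$. For $c\in I$ consider on $I$ the problem $$\Bigl(-\frac{1-F_b(x)}{f_a(x)}\bigl(F_a(x)\varpi^b(x)\bigr)'\Bigr)'=\varpi^b(x)f_b(x),\qquad \varpi^b(c)=\frac1{F_a(c)},\quad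 \frac{d}{dx}\varpi^b(x)\Big|_{x=c}=-\frac{f_a(c)}{F_a(c)^2}.$$ For general densities it is understood in the Carathéodory sense: $F_a\varpi^b$ and $q=-\frac{1-F_b}{f_a}(F_a\varpi^b)'$ are locally absolutely continuous on $I$, $(F_a\varpi^b)'=-\frac{f_a}{1-F_b}q$ and $q'=\varpi^bf_b$ almost everywhere on $I$, $\varpi^b(c)=1/F_a(c)$ and $q(c)=0$. **Theorem.** 1. For every $c\in I$ the problem has a solution, and it is unique on $I$. If $f_a,f_b$ are continuous and positive on $I$, the solutions are exactly the classical (pointwise) solutions. 2. Suppose that $\kappa_b,\kappa_a$ are finite. Then $\kappa_b<\kappa_a$, $\kappa_b\in I$, $F_b(\kappa_b)=1-F_a(\kappa_a)$, and the solution with $c=\kappa_b$ satisfies $\varpi^b(x)\to0$ as $x\uparrow\kappa_a$. Conversely, if $c\in I$ and $d\in\mathbb R$ satisfy $F_b(c)=1-F_a(d)$ and the solution started at $c$ tends to $0$ as $x\uparrow d$, then $F_b(c)=F_b(\kappa_b)$ and $F_a(d)=F_a(\kappa_a)$. In particular $(c,d)=(\kappa_b,\kappa_a)$ if $F_b$ is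 strictly increasing on $I$. 3. The thresholds are finite if there exist $x<y$ with $F_b(x)=1-F_a(y)$, $F_b(y)=1-F_a(x)$ and $F_b(y)>1-2F_b(x)(1-F_b(x))$. 4. Let $f_b=f_a=\mathbf 1_{[0,1]}$. The equation $we^w=e^{-1}$ has a unique real solution $w$. With $\kappa=\frac{w}{w+1}$ one has $0.217<\kappa<0.218$, the thresholds are finite, $\kappa_b=\kappa$ and $\kappa_a=1-\kappa$, and the solution with $c=\kappa$ is $$\varpi^b(x)=(1-\kappa)\Bigl(\frac1x+\log\frac{1-x}{x}\Bigr),\qquad x\in(\kappa,1-\kappa).$$ -/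

import Mathlib

open MeasureTheory ProbabilityTheory Filter Set
open scoped Topology

namespace LimitOrderBook

noncomputable section

/-! ### Price densities -/

/-- `f` is a probability density on the line. -/
structure IsPriceDensity (f : ℝ → ℝ) : Prop where
  measurable : Measurable f
  nonneg : ∀ x, 0 ≤ f x
  integrable : Integrable f
  integral_eq_one : ∫ x, f x = 1

/-- The price distribution with density `f`. -/
def priceLaw (f : ℝ → ℝ) : Measure ℝ :=
  volume.withDensity (fun x => ENNReal.ofReal (f x))

/-- The cumulative distribution function `F(x) = ∫_{-∞}^x f`. -/
def priceCDF (f : ℝ → ℝ) (x : ℝ) : ℝ := ∫ t in Iic x, f t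

/-- The density of the uniform distribution on `[0,1]`. -/
def unif : ℝ → ℝ := (Icc (0 : ℝ) 1).indicator (fun _ => 1)

/-! ### The limit order book -/

/-- An arriving order: `Sum.inl q` is a bid at price `q`, `Sum.inr p` is an ask at price `p`. -/
abbrev Arrival : Type := ℝ ⊕ ℝ

/-- The state of the book: the bids and the asks that are present, with multiplicity. -/
structure Book where
  bids : Multiset ℝ
  asks : Multiset ℝ

/-- The highest bid `β`; it is `-∞` if there are no bids. -/
def Book.bestBid (L : Book) : EReal := (L.bids.map (fun x : ℝ => (x : EReal))).sup

/-- The lowest ask `α`; it is `+∞` if there are no asks. -/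
def Book.bestAsk (L : Book) : EReal := (L.asks.map (fun x : ℝ => (x : EReal))).inf

open Classical in
/-- The effect of one arriving order. A bid above the lowest ask removes that ask, an ask below the
highest bid removes that bid; any other order joins the book. -/
def Book.arrive (L : Book) : Arrival → Book
  | Sum.inl q =>
      if L.bestAsk < (q : EReal) then ⟨L.bids, L.asks.erase L.bestAsk.toReal⟩
      else ⟨q ::ₘ L.bids, L.asks⟩
  | Sum.inr p =>
      if (p : EReal) < L.bestBid then ⟨L.bids.erase L.bestBid.toReal, L.asks⟩
      else ⟨L.bids, p ::ₘ L.asks⟩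

/-- The book after the first `n` of the given orders, starting from the empty book. -/
def bookAfter (o : ℕ → Arrival) : ℕ → Book
  | 0 => ⟨0, 0⟩
  | n + 1 => (bookAfter o n).arrive (o n)

/-- The book at time `t`, when the `n`-th order `o n` arrives at time `τ n`. -/
def bookAt (τ : ℕ → ℝ) (o : ℕ → Arrival) (t : ℝ) : Book :=
  bookAfter o {n : ℕ | τ n ≤ t}.ncard

variable {Ω : Type*} [MeasurableSpace Ω]

/-- The order arrivals: orders `o 0, o 1, …` arrive at times `τ 0 < τ 1 < …` that tend to infinity
almost surely. The orders are independent; each one is a bid or an ask with probability `1/2`, and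
the price has density `fb` for a bid and `fa` for an ask. (The law of the arrival times is
otherwise arbitrary.) -/
structure IsOrderFlow (μ : Measure Ω) (fb fa : ℝ → ℝ) (τ : ℕ → Ω → ℝ) (o : ℕ → Ω → Arrival) :
    Prop where
  measurable_time : ∀ n, Measurable (τ n)
  time_pos : ∀ᵐ ω ∂μ, ∀ n, 0 < τ n ω
  time_strictMono : ∀ᵐ ω ∂μ, StrictMono (fun n => τ n ω)
  time_tendsto : ∀ᵐ ω ∂μ, Tendsto (fun n => τ n ω) atTop atTop
  measurable_order : ∀ n, Measurable (o n)
  indep : iIndepFun o μ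
  law : ∀ n, μ.map (o n) =
    (2 : ENNReal)⁻¹ • (priceLaw fb).map Sum.inl + (2 : ENNReal)⁻¹ • (priceLaw fa).map Sum.inr

/-- The bid threshold `κ_b`: the infimum of all prices `x` such that, almost surely, `β_t < x` for
arbitrarily large times `t`. -/
def bidThreshold (μ : Measure Ω) (τ : ℕ → Ω → ℝ) (o : ℕ → Ω → Arrival) : EReal :=
  sInf ((fun x : ℝ => (x : EReal)) '' {x : ℝ | ∀ᵐ ω ∂μ, ∃ᶠ t in atTop,
    (bookAt (fun n => τ n ω) (fun n => o n ω) t).bestBid < (x : EReal)})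

/-- The ask threshold `κ_a`: the supremum of all prices `x` such that, almost surely, `α_t > x` for
arbitrarily large times `t`. -/
def askThreshold (μ : Measure Ω) (τ : ℕ → Ω → ℝ) (o : ℕ → Ω → Arrival) : EReal :=
  sSup ((fun x : ℝ => (x : EReal)) '' {x : ℝ | ∀ᵐ ω ∂μ, ∃ᶠ t in atTop,
    (x : EReal) < (bookAt (fun n => τ n ω) (fun n => o n ω) t).bestAsk})

/-- `κb` and `κa` are the threshold values of the book, and both are finite: they are real numbers,
and they do not sit at the ends of the price range (`F_b(κ_b) > 0` and `F_a(κ_a) < 1`). -/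
structure IsFiniteThresholds (μ : Measure Ω) (fb fa : ℝ → ℝ) (τ : ℕ → Ω → ℝ) (o : ℕ → Ω → Arrival)
    (κb κa : ℝ) : Prop where
  bid_eq : bidThreshold μ τ o = (κb : EReal)
  ask_eq : askThreshold μ τ o = (κa : EReal)
  bid_pos : 0 < priceCDF fb κb
  ask_lt_one : priceCDF fa κa < 1

/-! ### The differential equation -/

/-- The interval on which the equation `(-((1 - F_b) / f_a) (F_a ϖ)')' = ϖ f_b` is considered. -/
def priceRange (fb fa : ℝ → ℝ) : Set ℝ := {x | 0 < priceCDF fa x ∧ priceCDF fb x < 1}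

/-- `ϖ` solves `(-((1 - F_b) / f_a) (F_a ϖ)')' = ϖ f_b` with `ϖ(c) = 1 / F_a(c)` and
`ϖ'(c) = -f_a(c) / F_a(c)²`, for densities that are merely measurable (Carathéodory solutions).
The equation is read as the first order system for `F_a ϖ` and
`q = -((1 - F_b) / f_a) (F_a ϖ)'`, both locally absolutely continuous; the condition on the
derivative says `(F_a ϖ)' = 0` at `c`, and becomes `q(c) = 0`. -/
def IsSolution (fb fa : ℝ → ℝ) (c : ℝ) (ϖ : ℝ → ℝ) : Prop :=
  ∃ q : ℝ → ℝ,
    (∀ x ∈ priceRange fb fa, ∀ y ∈ priceRange fb fa,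
      AbsolutelyContinuousOnInterval (fun t => priceCDF fa t * ϖ t) x y ∧
      AbsolutelyContinuousOnInterval q x y) ∧
    (∀ᵐ x, x ∈ priceRange fb fa →
      HasDerivAt (fun t => priceCDF fa t * ϖ t) (-(fa x / (1 - priceCDF fb x)) * q x) x) ∧
    (∀ᵐ x, x ∈ priceRange fb fa → HasDerivAt q (ϖ x * fb x) x) ∧
    ϖ c = 1 / priceCDF fa c ∧
    q c = 0

/-- `ϖ` solves the same initial value problem in the pointwise sense. -/
structure IsClassicalSolution (fb fa : ℝ → ℝ) (c : ℝ) (ϖ : ℝ → ℝ) : Prop where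
  differentiable : ∀ x ∈ priceRange fb fa, DifferentiableAt ℝ ϖ x
  ode : ∀ x ∈ priceRange fb fa,
    HasDerivAt (fun t => -((1 - priceCDF fb t) / fa t) * deriv (fun s => priceCDF fa s * ϖ s) t) (ϖ x * fb x) x
  value : ϖ c = 1 / priceCDF fa c
  slope : HasDerivAt ϖ (-(fa c / priceCDF fa c ^ 2)) c

/-- The property that singles out the thresholds: `F_b(c) = 1 - F_a(d)`, and the solution of the
initial value problem at `c` vanishes as `x ↑ d`. -/
def IsVanishingPair (fb fa : ℝ → ℝ) (c d : ℝ) : Prop :=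
  c ∈ priceRange fb fa ∧ priceCDF fb c = 1 - priceCDF fa d ∧
    ∃ ϖ : ℝ → ℝ, IsSolution fb fa c ϖ ∧ Tendsto ϖ (𝓝[<] d) (𝓝 0)

end

end LimitOrderBook

open LimitOrderBook

/-!
Give every bid at price `x` in the book a weight `w_b(x)` and every ask a weight `w_a(x)`. The
expected change of the total weight caused by the next order depends only on the best prices
(`Book.gain`, `integral_gain`). The differential equation is the condition that this drift does not
depend on the best prices. In the unknowns `u = F_a ϖ` and `q` the equation is the linear system
`u' = -f_a q / (1 - F_b)`, `q' = f_b u / F_a`. With the weights `u / F_a` for bids and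
`q / (1 - F_b)` for asks between two levels `x < y`, the drift is `-(q(x) + u(y)) / 2` as long as
the best prices stay between `x` and `y` (`SolvesAt.integral_gain_eq`).

The initial value problem. The coefficients of the system are locally integrable, so Picard
iteration gives a solution (`exists_solvesSystem`), and the Wronskian gives uniqueness
(`SolvesSystem.eqOn`). For continuous densities almost everywhere derivatives become derivatives.

Recurrence. Ignoring one order changes the number of bids at or above a level `x` by at most one at
all later times (`Book.abs_bidCount_bookAfter_succ_sub_le`). Hence it is a tail event that this
number tends to infinity, and either the highest bid is eventually at least `x`, or infinitely often
there is no bid at or above `x` (`IsOrderFlow.bidEscapes_or_bidRecurrent`). Reflecting the price axis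
gives the same for asks.

Finite thresholds. Counting orders with the law of large numbers gives `F_b(κ_b) = 1 - F_a(κ_a)`:
infinitely often essentially all bids are below `κ_b`, while the asks above `κ_a` stay in the book,
and the numbers of bids and asks agree up to `o(n)`. At such times few orders lie between the
thresholds, so the drift of the weights from the equation must vanish (`IsOrderFlow.abs_drift_le`).
With `c = κ_b`, where `q(c) = 0`, this says `u(κ_a) = 0`
(`IsFiniteThresholds.lt_and_isVanishingPair`). If there were two pairs with this property at
different levels, one would be nested in the other, and the Wronskian of the two solutions would
have different signs at the ends of the inner interval (`IsVanishingPair.not_cdf_lt`).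

The sufficient condition. It provides step weights, with values `1`, `w`, `0` for bids and `0`, `w`,
`1` for asks, whose drift is bounded below by a positive constant for every book in which no bid
exceeds an ask (`bidDrift_weights`). So the number of orders in the book grows linearly. This is
impossible if all bids above a very low level disappear infinitely often
(`IsOrderFlow.exists_pos_le_cdf`).

Uniform arrivals. There is an explicit solution of the system, which has the initial values at `κ`
and vanishes at `1 - κ` if `log ((1 - κ) / κ) = 1 / (1 - κ)` (`solvesAt_unif`). For `κ = w / (w + 1)`
this is the equation `w eʷ = e⁻¹`.
-/

namespace LimitOrderBook

/-! ### Locally absolutely continuous functions -/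

lemma _root_.AbsolutelyContinuousOnInterval.congr {f g : ℝ → ℝ} {a b : ℝ}
    (hf : AbsolutelyContinuousOnInterval f a b) (h : ∀ z ∈ uIcc a b, f z = g z) :
    AbsolutelyContinuousOnInterval g a b := by
  rw [absolutelyContinuousOnInterval_iff] at hf ⊢
  intro ε hε
  obtain ⟨δ, hδ, H⟩ := hf ε hε
  refine ⟨δ, hδ, fun E hE hlt => ?_⟩
  rw [Finset.sum_congr rfl fun i hi => by
    rw [← h _ (hE.1 i hi).1, ← h _ (hE.1 i hi).2]]
  exact H E hE hlt

/-- `f` is locally absolutely continuous on `s`, with derivative `f'` almost everywhere on `s`. -/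
def IsPrimitiveOn (s : Set ℝ) (f f' : ℝ → ℝ) : Prop :=
  (∀ x ∈ s, ∀ y ∈ s, AbsolutelyContinuousOnInterval f x y) ∧
    ∀ᵐ x, x ∈ s → HasDerivAt f (f' x) x

namespace IsPrimitiveOn

variable {s : Set ℝ} {f f' g g' : ℝ → ℝ}

lemma congr_deriv (hf : IsPrimitiveOn s f f') (h : ∀ x ∈ s, f' x = g' x) :
    IsPrimitiveOn s f g' :=
  ⟨hf.1, by filter_upwards [hf.2] with x hx hxs using h x hxs ▸ hx hxs⟩

lemma const (s : Set ℝ) (a : ℝ) : IsPrimitiveOn s (fun _ => a) (fun _ => 0) :=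
  ⟨fun _ _ _ _ =>
    ((LipschitzWith.const a).lipschitzOnWith (K := 0)).absolutelyContinuousOnInterval,
    ae_of_all _ fun x _ => hasDerivAt_const x a⟩

lemma add (hf : IsPrimitiveOn s f f') (hg : IsPrimitiveOn s g g') :
    IsPrimitiveOn s (fun x => f x + g x) (fun x => f' x + g' x) :=
  ⟨fun x hx y hy => (hf.1 x hx y hy).add (hg.1 x hx y hy), by
    filter_upwards [hf.2, hg.2] with x h1 h2 hx using (h1 hx).add (h2 hx)⟩

lemma sub (hf : IsPrimitiveOn s f f') (hg : IsPrimitiveOn s g g') :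
    IsPrimitiveOn s (fun x => f x - g x) (fun x => f' x - g' x) :=
  ⟨fun x hx y hy => (hf.1 x hx y hy).sub (hg.1 x hx y hy), by
    filter_upwards [hf.2, hg.2] with x h1 h2 hx using (h1 hx).sub (h2 hx)⟩

lemma mul (hf : IsPrimitiveOn s f f') (hg : IsPrimitiveOn s g g') :
    IsPrimitiveOn s (fun x => f x * g x) (fun x => f' x * g x + f x * g' x) :=
  ⟨fun x hx y hy => (hf.1 x hx y hy).mul (hg.1 x hx y hy), by
    filter_upwards [hf.2, hg.2] with x h1 h2 hx using (h1 hx).mul (h2 hx)⟩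

lemma ae_deriv_eq (hf : IsPrimitiveOn s f f') (hs : s.OrdConnected) {x y : ℝ} (hx : x ∈ s)
    (hy : y ∈ s) : ∀ᵐ t, t ∈ uIoc x y → deriv f t = f' t := by
  filter_upwards [hf.2] with t ht h
  exact (ht (hs.uIcc_subset hx hy (uIoc_subset_uIcc h))).deriv

lemma intervalIntegrable (hf : IsPrimitiveOn s f f') (hs : s.OrdConnected) {x y : ℝ}
    (hx : x ∈ s) (hy : y ∈ s) : IntervalIntegrable f' volume x y := by
  refine (hf.1 x hx y hy).intervalIntegrable_deriv.congr_ae ?_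
  rw [Filter.EventuallyEq, ae_restrict_iff' measurableSet_uIoc]
  exact hf.ae_deriv_eq hs hx hy

lemma integral_eq_sub (hf : IsPrimitiveOn s f f') (hs : s.OrdConnected) {x y : ℝ}
    (hx : x ∈ s) (hy : y ∈ s) : ∫ t in x..y, f' t = f y - f x := by
  rw [← (hf.1 x hx y hy).integral_deriv_eq_sub]
  refine intervalIntegral.integral_congr_ae ?_
  filter_upwards [hf.ae_deriv_eq hs hx hy] with t ht h using (ht h).symm

lemma eq_of_deriv_eq_zero (hf : IsPrimitiveOn s f f') (hs : s.OrdConnected)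
    (h0 : ∀ x ∈ s, f' x = 0) {x y : ℝ} (hx : x ∈ s) (hy : y ∈ s) : f x = f y := by
  have h := hf.integral_eq_sub hs hx hy
  rw [intervalIntegral.integral_congr (g := fun _ => 0)
    fun t ht => h0 t (hs.uIcc_subset hx hy ht)] at h
  simp at h
  linarith

lemma continuousOn (hf : IsPrimitiveOn s f f') (ho : IsOpen s) :
    ContinuousOn f s := by
  intro x hx
  obtain ⟨ε, hε, hb⟩ := Metric.isOpen_iff.1 ho x hx
  rw [Real.ball_eq_Ioo] at hb
  have h1 : x - ε / 2 ∈ s := hb ⟨by linarith, by linarith⟩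
  have h2 : x + ε / 2 ∈ s := hb ⟨by linarith, by linarith⟩
  have h3 := (hf.1 _ h1 _ h2).continuousOn
  rw [uIcc_of_le (by linarith)] at h3
  exact (h3.continuousAt (Icc_mem_nhds (by linarith) (by linarith))).continuousWithinAt

/-- An open interval is exhausted by countably many compact ones. -/
lemma exists_seq_Icc (ho : IsOpen s) {c : ℝ} (hc : c ∈ s) :
    ∃ a b : ℕ → ℝ, (∀ n, a n ∈ s ∧ b n ∈ s ∧ a n ≤ c ∧ c ≤ b n) ∧
      ∀ x ∈ s, ∃ n, a n ≤ x ∧ x ≤ b n := by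
  let D : Set (ℚ × ℚ) := {p | (p.1 : ℝ) ∈ s ∧ (p.2 : ℝ) ∈ s ∧ (p.1 : ℝ) ≤ c ∧ c ≤ p.2}
  have hD : ∀ x ∈ s, ∃ p ∈ D, (p.1 : ℝ) ≤ x ∧ x ≤ p.2 := by
    intro x hx
    have hmin : min x c ∈ s := by rcases min_choice x c with h | h <;> rw [h] <;> assumption
    have hmax : max x c ∈ s := by rcases max_choice x c with h | h <;> rw [h] <;> assumption
    obtain ⟨ε, hε, hb⟩ := Metric.isOpen_iff.1 ho _ hmin
    obtain ⟨δ, hδ, hb'⟩ := Metric.isOpen_iff.1 ho _ hmax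
    rw [Real.ball_eq_Ioo] at hb hb'
    obtain ⟨p, hp1, hp2⟩ := exists_rat_btwn (show min x c - ε < min x c by linarith)
    obtain ⟨r, hr1, hr2⟩ := exists_rat_btwn (show max x c < max x c + δ by linarith)
    refine ⟨(p, r), ⟨hb ⟨hp1, by linarith⟩, hb' ⟨by linarith, hr2⟩, ?_, ?_⟩, ?_, ?_⟩
    · exact hp2.le.trans (min_le_right _ _)
    · exact (le_max_right _ _).trans hr1.le
    · exact hp2.le.trans (min_le_left _ _)
    · exact (le_max_left _ _).trans hr1.le
  obtain ⟨p0, hp0, -⟩ := hD c hc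
  obtain ⟨e, he⟩ := (Set.to_countable D).exists_eq_range ⟨p0, hp0⟩
  refine ⟨fun n => (e n).1, fun n => (e n).2, fun n => ?_, fun x hx => ?_⟩
  · have : e n ∈ D := he ▸ mem_range_self n
    exact this
  · obtain ⟨p, hp, h⟩ := hD x hx
    rw [he] at hp
    obtain ⟨n, rfl⟩ := hp
    exact ⟨n, h⟩

/-- The indefinite integral of a locally integrable function is a primitive of it. -/
lemma of_eqOn_integral (hs : s.OrdConnected) (ho : IsOpen s) {c a : ℝ} (hc : c ∈ s)
    (hi : ∀ x ∈ s, IntervalIntegrable f' volume c x)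
    (h : ∀ x ∈ s, f x = a + ∫ t in c..x, f' t) : IsPrimitiveOn s f f' := by
  constructor
  · intro x hx y hy
    have h1 : IntervalIntegrable f' volume x y := (hi x hx).symm.trans (hi y hy)
    have h2 := h1.absolutelyContinuousOnInterval_intervalIntegral (c := x) left_mem_uIcc
    have h3 : AbsolutelyContinuousOnInterval (fun z => f x + ∫ t in x..z, f' t) x y :=
      (((LipschitzWith.const (f x)).lipschitzOnWith (K := 0)
        (s := uIcc x y)).absolutelyContinuousOnInterval).add h2
    refine AbsolutelyContinuousOnInterval.congr h3 fun z hz => ?_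
    have hz' := hs.uIcc_subset hx hy hz
    rw [h x hx, h z hz', add_assoc, intervalIntegral.integral_add_adjacent_intervals (hi x hx)
      ((hi x hx).symm.trans (hi z hz'))]
  · obtain ⟨l, r, hlr, hcov⟩ := exists_seq_Icc ho hc
    have key : ∀ n, ∀ᵐ x, x ∈ uIcc (l n) (r n) → ∀ c ∈ uIcc (l n) (r n),
        HasDerivAt (fun x => ∫ t in c..x, f' t) (f' x) x := fun n =>
      ((hi _ (hlr n).1).symm.trans (hi _ (hlr n).2.1)).ae_hasDerivAt_integral
    filter_upwards [ae_all_iff.2 key] with x hx hxs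
    obtain ⟨n, hn⟩ := hcov x hxs
    have hle : l n ≤ r n := hn.1.trans hn.2
    have hd := hx n (by rw [uIcc_of_le hle]; exact hn) c
      (by rw [uIcc_of_le hle]; exact (hlr n).2.2)
    refine (hd.const_add a).congr_of_eventuallyEq ?_
    filter_upwards [ho.mem_nhds hxs] with z hz using h z hz

lemma congr (hf : IsPrimitiveOn s f f') (hs : s.OrdConnected) (ho : IsOpen s)
    (h : ∀ x ∈ s, g x = f x) : IsPrimitiveOn s g f' := by
  refine ⟨fun x hx y hy => (hf.1 x hx y hy).congr fun z hz =>
    (h z (hs.uIcc_subset hx hy hz)).symm, ?_⟩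
  filter_upwards [hf.2] with x hx hxs
  refine (hx hxs).congr_of_eventuallyEq ?_
  filter_upwards [ho.mem_nhds hxs] with z hz using h z hz

/-- If the almost everywhere derivative is continuous, it is the derivative everywhere. -/
lemma hasDerivAt (hf : IsPrimitiveOn s f f') (hs : s.OrdConnected) (ho : IsOpen s)
    (hc : ContinuousOn f' s) {x : ℝ} (hx : x ∈ s) : HasDerivAt f (f' x) x := by
  have h : HasDerivAt (fun z => f x + ∫ t in x..z, f' t) (f' x) x := by
    refine HasDerivAt.const_add _ (intervalIntegral.integral_hasDerivAt_right (by simp) ?_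
      (hc.continuousAt (ho.mem_nhds hx)))
    exact hc.stronglyMeasurableAtFilter ho x hx
  refine h.congr_of_eventuallyEq ?_
  filter_upwards [ho.mem_nhds hx] with z hz
  rw [hf.integral_eq_sub hs hx hz]; ring

lemma of_hasDerivAt (hs : s.OrdConnected) (hc : ContinuousOn f' s)
    (h : ∀ x ∈ s, HasDerivAt f (f' x) x) : IsPrimitiveOn s f f' := by
  refine ⟨fun x hx y hy => ?_, ae_of_all _ h⟩
  have hsub := hs.uIcc_subset hx hy
  obtain ⟨C, hC⟩ := isCompact_uIcc.exists_bound_of_continuousOn (hc.mono hsub)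
  have : LipschitzOnWith C.toNNReal f (uIcc x y) :=
    (convex_uIcc x y).lipschitzOnWith_of_nnnorm_hasDerivWithin_le
      (fun z hz => (h z (hsub hz)).hasDerivWithinAt) fun z hz => by
        rw [← NNReal.coe_le_coe, coe_nnnorm]
        exact (hC z hz).trans (Real.le_coe_toNNReal C)
  exact this.absolutelyContinuousOnInterval

end IsPrimitiveOn

/-! ### Planar linear systems with locally integrable coefficients -/

lemma IsPrimitiveOn.pow {s : Set ℝ} {f f' : ℝ → ℝ} (hf : IsPrimitiveOn s f f') (n : ℕ) :
    IsPrimitiveOn s (fun x => f x ^ (n + 1)) (fun x => (n + 1) * (f' x * f x ^ n)) := by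
  induction n with
  | zero => simpa using hf
  | succ n ih =>
    have h := ih.mul hf
    simp only [← pow_succ] at h
    exact h.congr_deriv fun x _ => by push_cast; ring

/-- The Picard iteration gains a factor `K(x) / (n + 1)`, where `K = ∫_c^x k` and `k` dominates the
coefficient. -/
lemma abs_integral_mul_le_of_abs_le {s : Set ℝ} (hs : s.OrdConnected) (ho : IsOpen s) {c : ℝ}
    (hc : c ∈ s) {γ k φ : ℝ → ℝ} (hk : ∀ x ∈ s, IntervalIntegrable k volume c x)
    (hγ : ∀ x ∈ s, IntervalIntegrable γ volume c x) (hle : ∀ x, |γ x| ≤ k x)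
    (hφ : ContinuousOn φ s) {M : ℝ} (hM : 0 ≤ M) {n : ℕ}
    (hb : ∀ x ∈ s, |φ x| ≤ M * (|∫ t in c..x, k t| ^ n / n.factorial)) :
    IsPrimitiveOn s (fun x => ∫ t in c..x, γ t * φ t) (fun x => γ x * φ x) ∧
    ∀ x ∈ s, |∫ t in c..x, γ t * φ t| ≤
      M * (|∫ t in c..x, k t| ^ (n + 1) / (n + 1).factorial) := by
  have hk0 : ∀ x, 0 ≤ k x := fun x => (abs_nonneg _).trans (hle x)
  have hsub : ∀ x ∈ s, uIcc c x ⊆ s := fun x hx => hs.uIcc_subset hc hx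
  constructor
  · refine IsPrimitiveOn.of_eqOn_integral hs ho (a := 0) hc (fun x hx => ?_) fun x _ => by simp
    exact (hγ x hx).mul_continuousOn (hφ.mono (hsub x hx))
  · intro x hx
    set K : ℝ → ℝ := fun x => ∫ t in c..x, k t with hKdef
    have hK : IsPrimitiveOn s K k :=
      IsPrimitiveOn.of_eqOn_integral hs ho (a := 0) hc hk fun x _ => by simp [hKdef]
    have hKn := (hK.pow n).integral_eq_sub hs hc hx
    have hKc : K c = 0 := by simp [hKdef]
    -- the sign of `K` is constant between `c` and `x`
    obtain ⟨σ, hσ, hσK⟩ : ∃ σ : ℝ, |σ| = 1 ∧ ∀ t ∈ uIcc c x, |K t| = σ * K t := by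
      rcases le_total c x with h | h
      · refine ⟨1, by simp, fun t ht => ?_⟩
        rw [uIcc_of_le h] at ht
        rw [one_mul, abs_of_nonneg]
        exact intervalIntegral.integral_nonneg ht.1 fun u _ => hk0 u
      · refine ⟨-1, by simp, fun t ht => ?_⟩
        rw [uIcc_of_ge h] at ht
        rw [neg_one_mul, abs_of_nonpos]
        rw [hKdef]
        simp only
        rw [intervalIntegral.integral_symm, neg_nonpos]
        exact intervalIntegral.integral_nonneg ht.2 fun u _ => hk0 u
    have hint : IntervalIntegrable (fun t => k t * K t ^ n) volume c x :=
      (hk x hx).mul_continuousOn (((hK.continuousOn ho).pow n).mono (hsub x hx))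
    have h1 : ∫ t in c..x, k t * K t ^ n = K x ^ (n + 1) / (n + 1) := by
      rw [intervalIntegral.integral_const_mul, hKc] at hKn
      rw [eq_div_iff (by positivity), mul_comm, hKn]
      simp
    have h2 : ‖∫ t in c..x, γ t * φ t‖ ≤
        |∫ t in c..x, (M * σ ^ n / n.factorial) * (k t * K t ^ n)| := by
      refine intervalIntegral.norm_integral_le_abs_of_norm_le ?_ (hint.const_mul _)
      rw [ae_restrict_iff' measurableSet_uIoc]
      refine ae_of_all _ fun t ht => ?_
      have ht' := uIoc_subset_uIcc ht
      have h3 := hb t (hsub x hx ht')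
      change _ ≤ M * (|K t| ^ n / _) at h3
      rw [hσK t ht', mul_pow] at h3
      rw [norm_mul]
      calc ‖γ t‖ * ‖φ t‖ ≤ k t * (M * (σ ^ n * K t ^ n / n.factorial)) :=
            mul_le_mul (hle t) h3 (norm_nonneg _) (hk0 t)
        _ = _ := by ring
    refine h2.trans (le_of_eq ?_)
    rw [intervalIntegral.integral_const_mul, h1, abs_mul, abs_div, abs_div, abs_mul, abs_pow,
      abs_pow, hσ, one_pow, abs_of_nonneg hM, Nat.factorial_succ]
    have : |(n : ℝ) + 1| = n + 1 := abs_of_nonneg (by positivity)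
    rw [this, Nat.abs_cast]
    push_cast
    field_simp
    rfl

/-- `(u, q)` solves the linear system `u' = -g q`, `q' = h u` on `s`. -/
def SolvesSystem (s : Set ℝ) (g h u q : ℝ → ℝ) : Prop :=
  IsPrimitiveOn s u (fun x => -g x * q x) ∧ IsPrimitiveOn s q (fun x => h x * u x)

/-- Picard iterates of the system `u' = -g q`, `q' = h u`. -/
noncomputable def picard (g h : ℝ → ℝ) (c a b : ℝ) : ℕ → (ℝ → ℝ) × (ℝ → ℝ)
  | 0 => (fun _ => a, fun _ => b)
  | n + 1 => (fun x => ∫ t in c..x, -g t * (picard g h c a b n).2 t,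
      fun x => ∫ t in c..x, h t * (picard g h c a b n).1 t)

/-- Under the Picard bounds a series may be integrated term by term against the coefficient. -/
lemma hasSum_integral_of_picard_bound {s : Set ℝ} (hs : s.OrdConnected) {c : ℝ} (hc : c ∈ s)
    {γ k : ℝ → ℝ} (hk0 : ∀ x, 0 ≤ k x) (hk : ∀ x ∈ s, IntervalIntegrable k volume c x)
    (hγ : ∀ x ∈ s, IntervalIntegrable γ volume c x) {φ : ℕ → ℝ → ℝ}
    (hφ : ∀ n, ContinuousOn (φ n) s) {M : ℝ} (hM : 0 ≤ M)
    (hb : ∀ n, ∀ x ∈ s, |φ n x| ≤ M * (|∫ t in c..x, k t| ^ n / n.factorial)) {x : ℝ}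
    (hx : x ∈ s) :
    HasSum (fun n => ∫ t in c..x, γ t * φ n t) (∫ t in c..x, γ t * ∑' n, φ n t) := by
  have hsub := hs.uIcc_subset hc hx
  set A := |∫ t in c..x, k t|
  have hsum : Summable fun n : ℕ => A ^ n / n.factorial := Real.summable_pow_div_factorial A
  have hbA : ∀ n, ∀ t ∈ uIcc c x, |φ n t| ≤ M * (A ^ n / n.factorial) := by
    intro n t ht
    refine (hb n t (hsub ht)).trans ?_
    gcongr
    refine intervalIntegral.abs_integral_mono_interval (uIoc_subset_uIoc_of_uIcc_subset_uIcc
      (uIcc_subset_uIcc left_mem_uIcc ht)) (ae_of_all _ hk0) (hk x hx)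
  refine intervalIntegral.hasSum_integral_of_dominated_convergence
    (fun n t => |γ t| * (M * (A ^ n / n.factorial))) (fun n => ?_) (fun n => ?_) ?_ ?_ ?_
  · exact ((hγ x hx).mul_continuousOn ((hφ n).mono hsub)).def'.1
  · refine ae_of_all _ fun t ht => ?_
    rw [norm_mul]
    exact mul_le_mul_of_nonneg_left (hbA n t (uIoc_subset_uIcc ht)) (abs_nonneg _)
  · exact ae_of_all _ fun t _ => (hsum.mul_left M).mul_left _
  · simp_rw [tsum_mul_left]
    exact (hγ x hx).abs.mul_const _
  · refine ae_of_all _ fun t ht => HasSum.mul_left _ (Summable.hasSum ?_)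
    exact Summable.of_abs (Summable.of_nonneg_of_le (fun n => abs_nonneg _)
      (fun n => hbA n t (uIoc_subset_uIcc ht)) (hsum.mul_left M))

/-- The linear system has a solution with given initial values: the Picard series converges locally
uniformly as soon as the coefficients are locally integrable. -/
theorem exists_solvesSystem {s : Set ℝ} (hs : s.OrdConnected) (ho : IsOpen s) {c : ℝ}
    (hc : c ∈ s) {g h : ℝ → ℝ} (hg : ∀ x ∈ s, IntervalIntegrable g volume c x)
    (hh : ∀ x ∈ s, IntervalIntegrable h volume c x) (a b : ℝ) :
    ∃ u q : ℝ → ℝ, SolvesSystem s g h u q ∧ u c = a ∧ q c = b := by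
  set k : ℝ → ℝ := fun x => |g x| + |h x| with hkdef
  have hk0 : ∀ x, 0 ≤ k x := fun x => by positivity
  have hk : ∀ x ∈ s, IntervalIntegrable k volume c x := fun x hx =>
    (hg x hx).abs.add (hh x hx).abs
  set M := |a| + |b|
  have hM : 0 ≤ M := by positivity
  set p := picard g h c a b with hp
  have hgk : ∀ x, |(-g x)| ≤ k x := fun x => by simp [hkdef]
  have hhk : ∀ x, |h x| ≤ k x := fun x => by simp [hkdef]
  have hg' : ∀ x ∈ s, IntervalIntegrable (fun x => -g x) volume c x := fun x hx => (hg x hx).neg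
  have main : ∀ n, (ContinuousOn (p n).1 s ∧ ContinuousOn (p n).2 s) ∧
      (∀ x ∈ s, |(p n).1 x| ≤ M * (|∫ t in c..x, k t| ^ n / n.factorial)) ∧
      (∀ x ∈ s, |(p n).2 x| ≤ M * (|∫ t in c..x, k t| ^ n / n.factorial)) := by
    intro n
    induction n with
    | zero => simp [hp, picard, M, continuousOn_const]
    | succ n ih =>
      obtain ⟨⟨c1, c2⟩, b1, b2⟩ := ih
      have h1 := abs_integral_mul_le_of_abs_le hs ho hc hk hg' hgk c2 hM b2
      have h2 := abs_integral_mul_le_of_abs_le hs ho hc hk hh hhk c1 hM b1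
      exact ⟨⟨h1.1.continuousOn ho, h2.1.continuousOn ho⟩, h1.2, h2.2⟩
  have hsum1 : ∀ x ∈ s, Summable fun n => (p n).1 x := fun x hx =>
    Summable.of_abs (Summable.of_nonneg_of_le (fun n => abs_nonneg _)
      (fun n => (main n).2.1 x hx) ((Real.summable_pow_div_factorial _).mul_left M))
  have hsum2 : ∀ x ∈ s, Summable fun n => (p n).2 x := fun x hx =>
    Summable.of_abs (Summable.of_nonneg_of_le (fun n => abs_nonneg _)
      (fun n => (main n).2.2 x hx) ((Real.summable_pow_div_factorial _).mul_left M))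
  set u : ℝ → ℝ := fun x => ∑' n, (p n).1 x
  set q : ℝ → ℝ := fun x => ∑' n, (p n).2 x
  have hu : ∀ x ∈ s, u x = a + ∫ t in c..x, -g t * q t := by
    intro x hx
    have h1 := (hasSum_integral_of_picard_bound hs hc hk0 hk hg' (fun n => (main n).1.2) hM
      (fun n => (main n).2.2) hx).tsum_eq
    rw [← h1]
    exact (hsum1 x hx).tsum_eq_zero_add
  have hq : ∀ x ∈ s, q x = b + ∫ t in c..x, h t * u t := by
    intro x hx
    have h1 := (hasSum_integral_of_picard_bound hs hc hk0 hk hh (fun n => (main n).1.1) hM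
      (fun n => (main n).2.1) hx).tsum_eq
    rw [← h1]
    exact (hsum2 x hx).tsum_eq_zero_add
  -- the sums are locally uniform limits, hence continuous
  have hcont : ∀ φ : ℕ → ℝ → ℝ, (∀ n, ContinuousOn (φ n) s) →
      (∀ n, ∀ x ∈ s, |φ n x| ≤ M * (|∫ t in c..x, k t| ^ n / n.factorial)) →
      ContinuousOn (fun x => ∑' n, φ n x) s := by
    intro φ hφ hb x hx
    have hKc : ContinuousOn (fun x => ∫ t in c..x, k t) s :=
      (IsPrimitiveOn.of_eqOn_integral hs ho (a := 0) hc hk fun x _ => by simp).continuousOn ho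
    have hKx := (hKc.continuousAt (ho.mem_nhds hx)).abs
    obtain ⟨t, hts, htn⟩ : ∃ t ⊆ s, t ∈ 𝓝 x ∧
        ∀ y ∈ t, |∫ z in c..y, k z| ≤ |∫ z in c..x, k z| + 1 :=
      ⟨s ∩ {y | |∫ z in c..y, k z| < |∫ z in c..x, k z| + 1}, inter_subset_left,
        inter_mem (ho.mem_nhds hx) (hKx.eventually_lt continuousAt_const (by simp)),
        fun y hy => hy.2.le⟩
    refine (ContinuousOn.continuousAt (s := t) ?_ htn.1).continuousWithinAt
    refine continuousOn_tsum (fun n => (hφ n).mono hts)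
      ((Real.summable_pow_div_factorial (|∫ z in c..x, k z| + 1)).mul_left M) fun n y hy => ?_
    refine (hb n y (hts hy)).trans ?_
    gcongr
    exact htn.2 y hy
  have hcu : ContinuousOn u s := hcont _ (fun n => (main n).1.1) fun n => (main n).2.1
  have hcq : ContinuousOn q s := hcont _ (fun n => (main n).1.2) fun n => (main n).2.2
  refine ⟨u, q, ⟨?_, ?_⟩, ?_, ?_⟩
  · exact IsPrimitiveOn.of_eqOn_integral hs ho hc
      (fun x hx => (hg' x hx).mul_continuousOn (hcq.mono (hs.uIcc_subset hc hx))) hu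
  · exact IsPrimitiveOn.of_eqOn_integral hs ho hc
      (fun x hx => (hh x hx).mul_continuousOn (hcu.mono (hs.uIcc_subset hc hx))) hq
  · simpa using hu c hc
  · simpa using hq c hc

/-- The Wronskian of two solutions is constant. -/
lemma SolvesSystem.wronskian_eq {s : Set ℝ} (hs : s.OrdConnected) {g h u q u' q' : ℝ → ℝ}
    (h1 : SolvesSystem s g h u q) (h2 : SolvesSystem s g h u' q') {x y : ℝ} (hx : x ∈ s)
    (hy : y ∈ s) : u x * q' x - q x * u' x = u y * q' y - q y * u' y :=
  ((h1.1.mul h2.2).sub (h1.2.mul h2.1)).eq_of_deriv_eq_zero hs (fun x _ => by ring) hx hy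

theorem SolvesSystem.eqOn {s : Set ℝ} (hs : s.OrdConnected) (ho : IsOpen s) {c : ℝ}
    (hc : c ∈ s) {g h : ℝ → ℝ} (hg : ∀ x ∈ s, IntervalIntegrable g volume c x)
    (hh : ∀ x ∈ s, IntervalIntegrable h volume c x) {u q u' q' : ℝ → ℝ}
    (h1 : SolvesSystem s g h u q) (h2 : SolvesSystem s g h u' q') (hu : u c = u' c)
    (hq : q c = q' c) {x : ℝ} (hx : x ∈ s) : u x = u' x ∧ q x = q' x := by
  obtain ⟨u₁, q₁, hs₁, hu₁, hq₁⟩ := exists_solvesSystem hs ho hc hg hh 1 0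
  obtain ⟨u₂, q₂, hs₂, hu₂, hq₂⟩ := exists_solvesSystem hs ho hc hg hh 0 1
  -- the difference has vanishing Wronskian with each member of a fundamental system
  have e0 := hs₁.wronskian_eq hs hs₂ hx hc
  have e1 := h1.wronskian_eq hs hs₁ hx hc
  have e2 := h1.wronskian_eq hs hs₂ hx hc
  have e3 := h2.wronskian_eq hs hs₁ hx hc
  have e4 := h2.wronskian_eq hs hs₂ hx hc
  rw [hu₁, hq₁, hu₂, hq₂] at e0
  rw [hu, hq, ← e3] at e1
  rw [hu, hq, ← e4] at e2
  constructor
  · linear_combination (-(u x - u' x)) * e0 + u₁ x * e2 - u₂ x * e1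
  · linear_combination (-(q x - q' x)) * e0 + q₁ x * e2 - q₂ x * e1

/-! ### Price distributions -/

namespace IsPriceDensity

variable {f : ℝ → ℝ}

lemma cdf_sub (hf : IsPriceDensity f) (x y : ℝ) :
    priceCDF f y - priceCDF f x = ∫ t in x..y, f t :=
  intervalIntegral.integral_Iic_sub_Iic hf.integrable.integrableOn hf.integrable.integrableOn

lemma cdf_eq (hf : IsPriceDensity f) (x y : ℝ) :
    priceCDF f y = priceCDF f x + ∫ t in x..y, f t := by rw [← hf.cdf_sub]; ring

lemma monotone_cdf (hf : IsPriceDensity f) : Monotone (priceCDF f) := fun x y hxy => by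
  have h : 0 ≤ ∫ t in x..y, f t := intervalIntegral.integral_nonneg hxy fun u _ => hf.nonneg u
  linarith [hf.cdf_eq x y]

lemma isPrimitiveOn_cdf (hf : IsPriceDensity f) {s : Set ℝ} (hs : s.OrdConnected)
    (ho : IsOpen s) : IsPrimitiveOn s (priceCDF f) f := by
  rcases s.eq_empty_or_nonempty with rfl | ⟨c, hc⟩
  · exact ⟨by simp, by simp⟩
  · exact IsPrimitiveOn.of_eqOn_integral hs ho hc
      (fun x _ => hf.integrable.intervalIntegrable) fun x _ => hf.cdf_eq c x

lemma continuous_cdf (hf : IsPriceDensity f) : Continuous (priceCDF f) :=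
  continuousOn_univ.1 ((hf.isPrimitiveOn_cdf ordConnected_univ isOpen_univ).continuousOn
    isOpen_univ)

lemma cdf_nonneg (hf : IsPriceDensity f) (x : ℝ) : 0 ≤ priceCDF f x :=
  integral_nonneg hf.nonneg

lemma cdf_add_integral_Ioi (hf : IsPriceDensity f) (x : ℝ) :
    priceCDF f x + ∫ t in Ioi x, f t = 1 := by
  rw [← hf.integral_eq_one]
  exact intervalIntegral.integral_Iic_add_Ioi hf.integrable.integrableOn
    hf.integrable.integrableOn

lemma integral_Ioi (hf : IsPriceDensity f) (x : ℝ) :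
    ∫ t in Ioi x, f t = 1 - priceCDF f x := by linarith [hf.cdf_add_integral_Ioi x]

lemma cdf_le_one (hf : IsPriceDensity f) (x : ℝ) : priceCDF f x ≤ 1 := by
  have : 0 ≤ ∫ t in Ioi x, f t := integral_nonneg hf.nonneg
  linarith [hf.cdf_add_integral_Ioi x]

lemma tendsto_cdf_atTop (hf : IsPriceDensity f) : Tendsto (priceCDF f) atTop (𝓝 1) := by
  have h := intervalIntegral_tendsto_integral_Ioi 0
    (hf.integrable.integrableOn (s := Ioi (0 : ℝ))) tendsto_id
  have h2 := h.const_add (priceCDF f 0)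
  rw [hf.cdf_add_integral_Ioi] at h2
  exact h2.congr fun x => (hf.cdf_eq 0 x).symm

lemma tendsto_cdf_atBot (hf : IsPriceDensity f) : Tendsto (priceCDF f) atBot (𝓝 0) := by
  have h := intervalIntegral_tendsto_integral_Iic 0
    (hf.integrable.integrableOn (s := Iic (0 : ℝ))) tendsto_id
  have h2 := h.const_sub (priceCDF f 0)
  have h0 : priceCDF f 0 - ∫ x in Iic 0, f x = 0 := sub_self _
  rw [h0] at h2
  refine h2.congr fun x => ?_
  rw [id, ← hf.cdf_sub]; ring

lemma exists_cdf_eq (hf : IsPriceDensity f) {r : ℝ} (h0 : 0 < r) (h1 : r < 1) :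
    ∃ x, priceCDF f x = r := by
  obtain ⟨a, ha⟩ := (hf.tendsto_cdf_atBot.eventually_lt_const h0).exists
  obtain ⟨b, hb⟩ := (hf.tendsto_cdf_atTop.eventually_const_lt h1).exists
  exact mem_range_of_exists_le_of_exists_ge hf.continuous_cdf ⟨a, ha.le⟩ ⟨b, hb.le⟩

lemma isProbabilityMeasure (hf : IsPriceDensity f) : IsProbabilityMeasure (priceLaw f) := by
  constructor
  rw [priceLaw, withDensity_apply _ MeasurableSet.univ, Measure.restrict_univ,
    ← ofReal_integral_eq_lintegral_ofReal hf.integrable (ae_of_all _ hf.nonneg),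
    hf.integral_eq_one, ENNReal.ofReal_one]

lemma integral_priceLaw (hf : IsPriceDensity f) (φ : ℝ → ℝ) :
    ∫ x, φ x ∂(priceLaw f) = ∫ x, f x * φ x := by
  rw [priceLaw, integral_withDensity_eq_integral_toReal_smul
    (hf.measurable.ennreal_ofReal) (ae_of_all _ fun x => ENNReal.ofReal_lt_top)]
  simp [ENNReal.toReal_ofReal (hf.nonneg _)]

lemma priceLaw_apply (hf : IsPriceDensity f) {s : Set ℝ} (hs : MeasurableSet s) :
    priceLaw f s = ENNReal.ofReal (∫ t in s, f t) := by
  rw [priceLaw, withDensity_apply _ hs,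
    ← ofReal_integral_eq_lintegral_ofReal hf.integrable.integrableOn (ae_of_all _ hf.nonneg)]

lemma priceLaw_eq_zero_iff (hf : IsPriceDensity f) {s : Set ℝ} (hs : MeasurableSet s) :
    priceLaw f s = 0 ↔ ∫ t in s, f t = 0 := by
  rw [hf.priceLaw_apply hs, ENNReal.ofReal_eq_zero]
  exact ⟨fun h => le_antisymm h (integral_nonneg hf.nonneg), fun h => h.le⟩

end IsPriceDensity

section AbsolutelyContinuous

variable {f g : ℝ → ℝ} (hf : IsPriceDensity f) (hg : IsPriceDensity g)
  (hfg : priceLaw f ≪ priceLaw g)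

include hf hg hfg

lemma cdf_eq_zero_of_ac {x : ℝ} (h : priceCDF g x = 0) : priceCDF f x = 0 :=
  (hf.priceLaw_eq_zero_iff measurableSet_Iic).1
    (hfg ((hg.priceLaw_eq_zero_iff measurableSet_Iic).2 h))

lemma cdf_eq_one_of_ac {x : ℝ} (h : priceCDF g x = 1) : priceCDF f x = 1 := by
  have h1 : ∫ t in Ioi x, g t = 0 := by rw [hg.integral_Ioi, h, sub_self]
  have h2 := (hf.priceLaw_eq_zero_iff measurableSet_Ioi).1
    (hfg ((hg.priceLaw_eq_zero_iff measurableSet_Ioi).2 h1))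
  rw [hf.integral_Ioi] at h2
  linarith

lemma cdf_eq_of_ac {x y : ℝ} (h : priceCDF g x = priceCDF g y) :
    priceCDF f x = priceCDF f y := by
  wlog hxy : x ≤ y generalizing x y
  · exact (this h.symm (le_of_not_ge hxy)).symm
  have h1 : ∫ t in Ioc x y, g t = 0 := by
    rw [← intervalIntegral.integral_of_le hxy, ← hg.cdf_sub, h, sub_self]
  have h2 := (hf.priceLaw_eq_zero_iff measurableSet_Ioc).1
    (hfg ((hg.priceLaw_eq_zero_iff measurableSet_Ioc).2 h1))
  rw [← intervalIntegral.integral_of_le hxy, ← hf.cdf_sub] at h2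
  linarith

lemma cdf_pos_of_ac {x : ℝ} (h : 0 < priceCDF f x) : 0 < priceCDF g x :=
  (hg.cdf_nonneg x).lt_of_ne fun h0 => h.ne' (cdf_eq_zero_of_ac hf hg hfg h0.symm)

lemma cdf_lt_one_of_ac {x : ℝ} (h : priceCDF f x < 1) : priceCDF g x < 1 :=
  (hg.cdf_le_one x).lt_of_ne fun h0 => h.ne (cdf_eq_one_of_ac hf hg hfg h0)

end AbsolutelyContinuous

/-! ### The differential equation as a linear system -/

/-- In the unknowns `u = F_a ϖ` and `q` the problem is a linear system. -/
lemma isSolution_iff {fb fa : ℝ → ℝ} {c : ℝ} {ϖ : ℝ → ℝ} (hc : c ∈ priceRange fb fa) :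
    IsSolution fb fa c ϖ ↔ ∃ q : ℝ → ℝ,
      SolvesSystem (priceRange fb fa) (fun t => fa t / (1 - priceCDF fb t))
        (fun t => fb t / priceCDF fa t) (fun t => priceCDF fa t * ϖ t) q ∧
      priceCDF fa c * ϖ c = 1 ∧ q c = 0 := by
  have e : (ϖ c = 1 / priceCDF fa c) ↔ priceCDF fa c * ϖ c = 1 := by
    rw [eq_div_iff hc.1.ne', mul_comm]
  have e2 : ∀ q : ℝ → ℝ, (∀ᵐ x, x ∈ priceRange fb fa → HasDerivAt q (ϖ x * fb x) x) ↔
      ∀ᵐ x, x ∈ priceRange fb fa →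
        HasDerivAt q (fb x / priceCDF fa x * (priceCDF fa x * ϖ x)) x := fun q => by
    refine eventually_congr (ae_of_all _ fun x => forall_congr' fun hx => ?_)
    have := hx.1.ne'
    rw [show fb x / priceCDF fa x * (priceCDF fa x * ϖ x) = ϖ x * fb x by field_simp]
  unfold IsSolution SolvesSystem IsPrimitiveOn
  refine exists_congr fun q => ?_
  rw [e, e2]
  constructor
  · rintro ⟨h1, h2, h3, h4, h5⟩
    exact ⟨⟨⟨fun x hx y hy => (h1 x hx y hy).1, h2⟩, fun x hx y hy => (h1 x hx y hy).2, h3⟩,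
      h4, h5⟩
  · rintro ⟨⟨⟨h1, h2⟩, h3, h4⟩, h5, h6⟩
    exact ⟨fun x hx y hy => ⟨h1 x hx y hy, h3 x hx y hy⟩, h2, h4, h5, h6⟩

section ODE

variable {fb fa : ℝ → ℝ} (hfb : IsPriceDensity fb) (hfa : IsPriceDensity fa)
include hfb hfa

lemma isOpen_priceRange : IsOpen (priceRange fb fa) :=
  (isOpen_lt continuous_const hfa.continuous_cdf).inter
    (isOpen_lt hfb.continuous_cdf continuous_const)

lemma ordConnected_priceRange : (priceRange fb fa).OrdConnected :=
  ⟨fun _ hx _ hy _ hz => ⟨hx.1.trans_le (hfa.monotone_cdf hz.1),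
    (hfb.monotone_cdf hz.2).trans_lt hy.2⟩⟩

lemma intervalIntegrable_ask_coeff {c x : ℝ} (hc : c ∈ priceRange fb fa)
    (hx : x ∈ priceRange fb fa) :
    IntervalIntegrable (fun t => fa t / (1 - priceCDF fb t)) volume c x := by
  simp_rw [div_eq_mul_inv]
  refine hfa.integrable.intervalIntegrable.mul_continuousOn (ContinuousOn.inv₀
    (continuous_const.sub hfb.continuous_cdf).continuousOn fun t ht => ?_)
  exact (sub_pos.2 ((ordConnected_priceRange hfb hfa).uIcc_subset hc hx ht).2).ne'

lemma intervalIntegrable_bid_coeff {c x : ℝ} (hc : c ∈ priceRange fb fa)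
    (hx : x ∈ priceRange fb fa) :
    IntervalIntegrable (fun t => fb t / priceCDF fa t) volume c x := by
  simp_rw [div_eq_mul_inv]
  refine hfb.integrable.intervalIntegrable.mul_continuousOn (ContinuousOn.inv₀
    hfa.continuous_cdf.continuousOn fun t ht => ?_)
  exact ((ordConnected_priceRange hfb hfa).uIcc_subset hc hx ht).1.ne'

theorem exists_isSolution_unique {c : ℝ} (hc : c ∈ priceRange fb fa) :
    ∃ ϖ : ℝ → ℝ, IsSolution fb fa c ϖ ∧
      ∀ ϖ' : ℝ → ℝ, IsSolution fb fa c ϖ' → EqOn ϖ' ϖ (priceRange fb fa) := by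
  have hs := ordConnected_priceRange hfb hfa
  have ho := isOpen_priceRange hfb hfa
  obtain ⟨u, q, hsol, hu, hq⟩ := exists_solvesSystem hs ho hc
    (fun x hx => intervalIntegrable_ask_coeff hfb hfa hc hx)
    (fun x hx => intervalIntegrable_bid_coeff hfb hfa hc hx) 1 0
  have key : ∀ x ∈ priceRange fb fa, priceCDF fa x * (u x / priceCDF fa x) = u x :=
    fun x hx => mul_div_cancel₀ _ hx.1.ne'
  refine ⟨fun x => u x / priceCDF fa x, (isSolution_iff hc).2 ⟨q, ⟨?_, ?_⟩, ?_, hq⟩, ?_⟩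
  · exact hsol.1.congr hs ho key
  · exact hsol.2.congr_deriv fun x hx => by simp only [key x hx]
  · rw [key c hc, hu]
  · intro ϖ' h' x hx
    obtain ⟨q', hsol', hu', hq'⟩ := (isSolution_iff hc).1 h'
    have h := (hsol'.eqOn hs ho hc (fun x hx => intervalIntegrable_ask_coeff hfb hfa hc hx)
      (fun x hx => intervalIntegrable_bid_coeff hfb hfa hc hx) hsol (hu'.trans hu.symm)
      (hq'.trans hq.symm) hx).1
    simp only at h ⊢
    rw [← h, mul_div_cancel_left₀ _ hx.1.ne']

theorem isSolution_iff_isClassicalSolution (hcb : ContinuousOn fb (priceRange fb fa))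
    (hca : ContinuousOn fa (priceRange fb fa))
    (hpos : ∀ x ∈ priceRange fb fa, 0 < fb x ∧ 0 < fa x) {c : ℝ}
    (hc : c ∈ priceRange fb fa) (ϖ : ℝ → ℝ) :
    IsSolution fb fa c ϖ ↔ IsClassicalSolution fb fa c ϖ := by
  have hs := ordConnected_priceRange hfb hfa
  have ho := isOpen_priceRange hfb hfa
  have hFa : ∀ x ∈ priceRange fb fa, HasDerivAt (priceCDF fa) (fa x) x := fun x hx =>
    (hfa.isPrimitiveOn_cdf hs ho).hasDerivAt hs ho hca hx
  have hFac : ContinuousOn (priceCDF fa) (priceRange fb fa) := hfa.continuous_cdf.continuousOn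
  have hFbc : ContinuousOn (fun x => 1 - priceCDF fb x) (priceRange fb fa) :=
    (continuous_const.sub hfb.continuous_cdf).continuousOn
  have h1b : ∀ x ∈ priceRange fb fa, 1 - priceCDF fb x ≠ 0 := fun x hx => (sub_pos.2 hx.2).ne'
  rw [isSolution_iff hc]
  constructor
  · rintro ⟨q, ⟨hu, hq⟩, huc, hqc⟩
    have hqcont := hq.continuousOn ho
    have hucont := hu.continuousOn ho
    have hu' : ∀ x ∈ priceRange fb fa, HasDerivAt (fun t => priceCDF fa t * ϖ t)
        (-(fa x / (1 - priceCDF fb x)) * q x) x := fun x hx =>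
      hu.hasDerivAt hs ho ((hca.div hFbc h1b).neg.mul hqcont) hx
    have hq' : ∀ x ∈ priceRange fb fa, HasDerivAt q
        (fb x / priceCDF fa x * (priceCDF fa x * ϖ x)) x := fun x hx =>
      hq.hasDerivAt hs ho ((hcb.div hFac fun x hx => hx.1.ne').mul hucont) hx
    have hϖ : ∀ x ∈ priceRange fb fa, HasDerivAt ϖ
        ((-(fa x / (1 - priceCDF fb x)) * q x * priceCDF fa x -
          (priceCDF fa x * ϖ x) * fa x) / priceCDF fa x ^ 2) x := fun x hx => by
      refine ((hu' x hx).fun_div (hFa x hx) hx.1.ne').congr_of_eventuallyEq ?_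
      filter_upwards [ho.mem_nhds hx] with z hz
      rw [mul_div_cancel_left₀ _ hz.1.ne']
    refine ⟨fun x hx => (hϖ x hx).differentiableAt, fun x hx => ?_, ?_, ?_⟩
    · have h := hq' x hx
      rw [show fb x / priceCDF fa x * (priceCDF fa x * ϖ x) = ϖ x * fb x by
        have := hx.1.ne'
        field_simp] at h
      refine h.congr_of_eventuallyEq ?_
      filter_upwards [ho.mem_nhds hx] with z hz
      rw [(hu' z hz).deriv]
      have h1 := (hpos z hz).2.ne'
      have h2 := h1b z hz
      field_simp
    · rw [eq_div_iff hc.1.ne', mul_comm, huc]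
    · have h := hϖ c hc
      rw [hqc, huc] at h
      convert! h using 1
      ring
  · intro hcl
    set u : ℝ → ℝ := fun t => priceCDF fa t * ϖ t with hudef
    set q : ℝ → ℝ := fun t => -((1 - priceCDF fb t) / fa t) * deriv u t with hqdef
    have hu : ∀ x ∈ priceRange fb fa, HasDerivAt u (-(fa x / (1 - priceCDF fb x)) * q x) x := by
      intro x hx
      have hd : DifferentiableAt ℝ u x :=
        (hFa x hx).differentiableAt.mul (hcl.differentiable x hx)
      convert! hd.hasDerivAt using 1
      have h1 := (hpos x hx).2.ne'
      have h2 := h1b x hx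
      rw [hqdef]
      field_simp
    have hq : ∀ x ∈ priceRange fb fa, HasDerivAt q (fb x / priceCDF fa x * u x) x := by
      intro x hx
      convert! hcl.ode x hx using 1
      have := hx.1.ne'
      rw [hudef]
      field_simp
    have hucont : ContinuousOn u (priceRange fb fa) := fun x hx =>
      (hu x hx).continuousAt.continuousWithinAt
    have hqcont : ContinuousOn q (priceRange fb fa) := fun x hx =>
      (hq x hx).continuousAt.continuousWithinAt
    have huc : u c = 1 := by
      rw [hudef]
      simp only
      rw [hcl.value, mul_one_div_cancel hc.1.ne']
    refine ⟨q, ⟨?_, ?_⟩, huc, ?_⟩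
    · exact IsPrimitiveOn.of_hasDerivAt hs ((hca.div hFbc h1b).neg.mul hqcont) hu
    · exact IsPrimitiveOn.of_hasDerivAt hs ((hcb.div hFac fun x hx => hx.1.ne').mul hucont) hq
    · have h : deriv u c = 0 := by
        rw [((hFa c hc).fun_mul hcl.slope).deriv, hcl.value]
        have := hc.1.ne'
        field_simp
        ring
      rw [hqdef]
      simp only
      rw [h, mul_zero]

end ODE

/-! ### Uniqueness of vanishing pairs -/

/-- The system solved by `u = F_a ϖ` and `q`, with the initial values `u(c) = 1` and `q(c) = 0`.
Dividing by `F_a` turns `u` into a solution of the problem in `IsSolution`. -/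
structure SolvesAt (fb fa : ℝ → ℝ) (c : ℝ) (u q : ℝ → ℝ) : Prop where
  mem : c ∈ priceRange fb fa
  system : SolvesSystem (priceRange fb fa) (fun t => fa t / (1 - priceCDF fb t))
    (fun t => fb t / priceCDF fa t) u q
  u_eq : u c = 1
  q_eq : q c = 0

namespace SolvesAt

variable {fb fa : ℝ → ℝ} {c d : ℝ} {u q : ℝ → ℝ} (h : SolvesAt fb fa c u q)
  (hfb : IsPriceDensity fb) (hfa : IsPriceDensity fa)
include h hfb hfa

lemma continuousOn_u : ContinuousOn u (priceRange fb fa) :=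
  h.system.1.continuousOn (isOpen_priceRange hfb hfa)

/-- `u (1 - F_b) + q F_a` is a first integral. -/
lemma invariant {x : ℝ} (hx : x ∈ priceRange fb fa) :
    u x * (1 - priceCDF fb x) + q x * priceCDF fa x = 1 - priceCDF fb c := by
  have hs := ordConnected_priceRange hfb hfa
  have ho := isOpen_priceRange hfb hfa
  have hFb := (IsPrimitiveOn.const (priceRange fb fa) 1).sub (hfb.isPrimitiveOn_cdf hs ho)
  have hFa := hfa.isPrimitiveOn_cdf hs ho
  have := ((h.system.1.mul hFb).add (h.system.2.mul hFa)).eq_of_deriv_eq_zero hs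
    (fun t ht => ?_) hx h.mem
  · rw [this, h.u_eq, h.q_eq]; ring
  · have h1 := ht.1.ne'
    have h2 := (sub_pos.2 ht.2).ne'
    field_simp
    ring

/-- By the first integral, `u` and `q` are never both nonpositive. -/
lemma q_pos_of_u_nonpos {x : ℝ} (hx : x ∈ priceRange fb fa) (hu : u x ≤ 0) :
    1 - priceCDF fb c ≤ q x ∧ 0 < q x := by
  have hi := h.invariant hfb hfa hx
  have h1 := sub_pos.2 hx.2
  have h2 := sub_pos.2 h.mem.2
  have h3 := mul_nonpos_of_nonpos_of_nonneg hu h1.le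
  have h4 : 0 < q x := by
    by_contra hq
    have := mul_nonpos_of_nonpos_of_nonneg (not_lt.1 hq) hx.1.le
    linarith
  exact ⟨by nlinarith [hfa.cdf_le_one x], h4⟩

lemma q_le_q_of_u_nonneg {x y : ℝ} (hx : x ∈ priceRange fb fa) (hy : y ∈ priceRange fb fa)
    (hxy : x ≤ y) (hu : ∀ t ∈ Ioc x y, 0 ≤ u t) : q x ≤ q y := by
  have hs := ordConnected_priceRange hfb hfa
  rw [← sub_nonneg, ← h.system.2.integral_eq_sub hs hx hy, intervalIntegral.integral_of_le hxy]
  refine setIntegral_nonneg measurableSet_Ioc fun t ht => ?_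
  exact mul_nonneg (div_nonneg (hfb.nonneg t) (hfa.cdf_nonneg t)) (hu t ht)

lemma exists_last_nonpos {x y : ℝ} (hx : x ∈ priceRange fb fa) (hy : y ∈ priceRange fb fa)
    (hxy : x ≤ y) (hu : u x ≤ 0) : ∃ z ∈ Icc x y, u z ≤ 0 ∧ ∀ t ∈ Ioc z y, 0 < u t := by
  have hs := ordConnected_priceRange hfb hfa
  have hc : ContinuousOn u (Icc x y) := (h.continuousOn_u hfb hfa).mono (hs.out hx hy)
  have hcl : IsCompact (Icc x y ∩ u ⁻¹' Iic 0) :=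
    isCompact_Icc.of_isClosed_subset (hc.preimage_isClosed_of_isClosed isClosed_Icc isClosed_Iic)
      inter_subset_left
  obtain ⟨z, hz, hmax⟩ := hcl.exists_isGreatest ⟨x, left_mem_Icc.2 hxy, hu⟩
  refine ⟨z, hz.1, hz.2, fun t ht => ?_⟩
  by_contra hcon
  exact ht.1.not_ge (hmax ⟨⟨hz.1.1.trans ht.1.le, ht.2⟩, not_lt.1 hcon⟩)

lemma u_pos_of_le {x : ℝ} (hx : x ∈ priceRange fb fa) (hxc : x ≤ c) : 0 < u x := by
  by_contra hu
  obtain ⟨z, hz, hz0, hpos⟩ := h.exists_last_nonpos hfb hfa hx h.mem hxc (not_lt.1 hu)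
  have hzI := (ordConnected_priceRange hfb hfa).out hx h.mem hz
  have h1 := (h.q_pos_of_u_nonpos hfb hfa hzI hz0).2
  have h2 := h.q_le_q_of_u_nonneg hfb hfa hzI h.mem hz.2 fun t ht => (hpos t ht).le
  rw [h.q_eq] at h2
  linarith

/-- The function `u` does not return to positive values: where `u ≤ 0` one has `q > 0`, and `q`
increases while `u ≥ 0`. -/
lemma u_nonpos_of_le {x y : ℝ} (hx : x ∈ priceRange fb fa) (hy : y ∈ priceRange fb fa)
    (hxy : x ≤ y) (hu : u x ≤ 0) : u y ≤ 0 := by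
  have hs := ordConnected_priceRange hfb hfa
  obtain ⟨z, hz, hz0, hpos⟩ := h.exists_last_nonpos hfb hfa hx hy hxy hu
  have hzI := hs.out hx hy hz
  have h1 := (h.q_pos_of_u_nonpos hfb hfa hzI hz0).2
  have h2 := h.system.1.integral_eq_sub hs hzI hy
  have h3 : ∫ t in z..y, -(fa t / (1 - priceCDF fb t)) * q t ≤ 0 := by
    rw [intervalIntegral.integral_of_le hz.2]
    refine setIntegral_nonpos measurableSet_Ioc fun t ht => ?_
    have htI := hs.out hzI hy (Ioc_subset_Icc_self ht)
    have h4 := h.q_le_q_of_u_nonneg hfb hfa hzI htI ht.1.le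
      fun r hr => (hpos r ⟨hr.1, hr.2.trans ht.2⟩).le
    rw [neg_mul, neg_nonpos]
    exact mul_nonneg (div_nonneg (hfa.nonneg t) (sub_pos.2 htI.2).le) (h1.le.trans h4)
  linarith

/-- To the right of a point where `u ≤ 0`, the function `u` decreases at least at the rate
`(1 - F_b(c)) F_a`. Hence `u` has essentially one zero. -/
lemma u_pos_of_cdf_lt (hd : d ∈ priceRange fb fa) (hud : u d = 0) {z : ℝ}
    (hz : z ∈ priceRange fb fa) (hzd : priceCDF fa z < priceCDF fa d) : 0 < u z := by
  have hs := ordConnected_priceRange hfb hfa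
  have hle : z ≤ d := le_of_lt (hfa.monotone_cdf.reflect_lt hzd)
  by_contra hu
  have hu := not_lt.1 hu
  have h1 := h.system.1.integral_eq_sub hs hz hd
  have h2 : ∫ t in z..d, -(fa t / (1 - priceCDF fb t)) * q t ≤
      ∫ t in z..d, -(1 - priceCDF fb c) * fa t := by
    refine intervalIntegral.integral_mono_on hle (h.system.1.intervalIntegrable hs hz hd)
      (hfa.integrable.intervalIntegrable.const_mul _) fun t ht => ?_
    have htI := hs.out hz hd ht
    have h3 := (h.q_pos_of_u_nonpos hfb hfa htI (h.u_nonpos_of_le hfb hfa hz htI ht.1 hu)).1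
    have h4 := sub_pos.2 htI.2
    have h5 : fa t ≤ fa t / (1 - priceCDF fb t) := by
      rw [le_div_iff₀ h4]
      nlinarith [hfa.nonneg t, hfb.cdf_nonneg t]
    have h6 := mul_le_mul h5 h3 (sub_pos.2 h.mem.2).le ((hfa.nonneg t).trans h5)
    linarith
  rw [intervalIntegral.integral_const_mul, ← hfa.cdf_sub, h1, hud] at h2
  nlinarith [h.mem.2]

end SolvesAt

section

variable {fb fa : ℝ → ℝ} (hfb : IsPriceDensity fb) (hfa : IsPriceDensity fa)

lemma SolvesAt.isSolution {c : ℝ} {u q : ℝ → ℝ} (h : SolvesAt fb fa c u q)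
    (hfb : IsPriceDensity fb) (hfa : IsPriceDensity fa) :
    IsSolution fb fa c (fun x => u x / priceCDF fa x) := by
  have key : ∀ x ∈ priceRange fb fa, priceCDF fa x * (u x / priceCDF fa x) = u x :=
    fun x hx => mul_div_cancel₀ _ hx.1.ne'
  refine (isSolution_iff h.mem).2 ⟨q, ⟨?_, ?_⟩, ?_, h.q_eq⟩
  · exact h.system.1.congr (ordConnected_priceRange hfb hfa) (isOpen_priceRange hfb hfa) key
  · exact h.system.2.congr_deriv fun x hx => by simp only [key x hx]
  · rw [key c h.mem, h.u_eq]

lemma IsSolution.exists_solvesAt {c : ℝ} {ϖ : ℝ → ℝ} (h : IsSolution fb fa c ϖ)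
    (hc : c ∈ priceRange fb fa) :
    ∃ q, SolvesAt fb fa c (fun x => priceCDF fa x * ϖ x) q := by
  obtain ⟨q, h1, h2, h3⟩ := (isSolution_iff hc).1 h
  exact ⟨q, hc, h1, h2, h3⟩

include hfb hfa

lemma exists_solvesAt {c : ℝ} (hc : c ∈ priceRange fb fa) : ∃ u q, SolvesAt fb fa c u q := by
  obtain ⟨u, q, h1, h2, h3⟩ := exists_solvesSystem (ordConnected_priceRange hfb hfa)
    (isOpen_priceRange hfb hfa) hc (fun x hx => intervalIntegrable_ask_coeff hfb hfa hc hx)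
    (fun x hx => intervalIntegrable_bid_coeff hfb hfa hc hx) 1 0
  exact ⟨u, q, hc, h1, h2, h3⟩

variable (hab : priceLaw fa ≪ priceLaw fb)
include hab

/-- The upper member of a vanishing pair automatically lies in the price range, where the limit in
the definition is a value. -/
lemma IsVanishingPair.exists_solvesAt {c d : ℝ} (h : IsVanishingPair fb fa c d) :
    ∃ u q, SolvesAt fb fa c u q ∧ d ∈ priceRange fb fa ∧ u d = 0 := by
  obtain ⟨hc, hcd, ϖ, hϖ, hlim⟩ := h
  obtain ⟨q, hq⟩ := hϖ.exists_solvesAt hc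
  have hbc : 0 < priceCDF fb c := cdf_pos_of_ac hfa hfb hab hc.1
  have hd : d ∈ priceRange fb fa :=
    ⟨by linarith [hc.2], cdf_lt_one_of_ac hfa hfb hab (by linarith)⟩
  refine ⟨_, q, hq, hd, ?_⟩
  have h1 : Tendsto (fun x => priceCDF fa x * ϖ x) (𝓝[<] d) (𝓝 (priceCDF fa d * 0)) :=
    (hfa.continuous_cdf.continuousAt.tendsto.mono_left nhdsWithin_le_nhds).mul hlim
  rw [mul_zero] at h1
  refine tendsto_nhds_unique (Tendsto.mono_left ?_ nhdsWithin_le_nhds) h1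
  exact (hq.continuousOn_u hfb hfa).continuousAt ((isOpen_priceRange hfb hfa).mem_nhds hd)

/-- Two vanishing pairs cannot be strictly nested: the constant value of the Wronskian of the two
solutions would be nonpositive at the inner left end and positive at the inner right end. -/
lemma IsVanishingPair.not_cdf_lt {c d c' d' : ℝ} (h : IsVanishingPair fb fa c d)
    (h' : IsVanishingPair fb fa c' d') : ¬ priceCDF fb c < priceCDF fb c' := by
  intro hlt
  have hs := ordConnected_priceRange hfb hfa
  obtain ⟨u, q, hsol, hd, hud⟩ := h.exists_solvesAt hfb hfa hab
  obtain ⟨u', q', hsol', hd', hud'⟩ := h'.exists_solvesAt hfb hfa hab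
  have hcc : c ≤ c' := le_of_lt (hfb.monotone_cdf.reflect_lt hlt)
  have hcd' : c' ≤ d' := by
    by_contra hcon
    exact (hsol'.u_pos_of_le hfb hfa hd' (not_le.1 hcon).le).ne' hud'
  have hFd : priceCDF fa d' < priceCDF fa d := by linarith [h.2.1, h'.2.1]
  have hpos : ∀ t ∈ priceRange fb fa, t ≤ d' → 0 < u t := fun t ht htd =>
    hsol.u_pos_of_cdf_lt hfb hfa hd hud ht ((hfa.monotone_cdf htd).trans_lt hFd)
  have hq : 0 ≤ q c' := by
    rw [← hsol.q_eq]
    exact hsol.q_le_q_of_u_nonneg hfb hfa hsol.mem hsol'.mem hcc fun t ht =>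
      (hpos t (hs.out hsol.mem hsol'.mem (Ioc_subset_Icc_self ht)) (ht.2.trans hcd')).le
  have hq' := (hsol'.q_pos_of_u_nonpos hfb hfa hd' hud'.le).2
  have hW := hsol.system.wronskian_eq hs hsol'.system hsol'.mem hd'
  rw [hsol'.u_eq, hsol'.q_eq, hud'] at hW
  nlinarith [mul_pos (hpos d' hd' le_rfl) hq']

/-- Two vanishing pairs have the same levels, since `F_b(c) = 1 - F_a(d)` forces pairs with different
levels to be strictly nested. -/
theorem IsVanishingPair.cdf_eq {c d c' d' : ℝ} (h : IsVanishingPair fb fa c d)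
    (h' : IsVanishingPair fb fa c' d') :
    priceCDF fb c = priceCDF fb c' ∧ priceCDF fa d = priceCDF fa d' := by
  have h1 : priceCDF fb c = priceCDF fb c' := le_antisymm
    (not_lt.1 (h'.not_cdf_lt hfb hfa hab h)) (not_lt.1 (h.not_cdf_lt hfb hfa hab h'))
  exact ⟨h1, by linarith [h.2.1, h'.2.1]⟩

theorem IsVanishingPair.eq_of_strictMonoOn (hba : priceLaw fb ≪ priceLaw fa) {c d c' d' : ℝ}
    (h : IsVanishingPair fb fa c d)
    (h' : IsVanishingPair fb fa c' d') (hm : StrictMonoOn (priceCDF fb) (priceRange fb fa)) :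
    c = c' ∧ d = d' := by
  obtain ⟨h1, h2⟩ := h.cdf_eq hfb hfa hab h'
  obtain ⟨-, -, -, hd, -⟩ := h.exists_solvesAt hfb hfa hab
  obtain ⟨-, -, -, hd', -⟩ := h'.exists_solvesAt hfb hfa hab
  exact ⟨hm.injOn h.1 h'.1 h1, hm.injOn hd hd' (cdf_eq_of_ac hfb hfa hba h2)⟩

end

/-! ### The dynamics of the book -/

namespace Book

lemma bestBid_lt_iff {L : Book} {x : ℝ} : L.bestBid < (x : EReal) ↔ ∀ b ∈ L.bids, b < x := by
  unfold bestBid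
  induction L.bids using Multiset.induction with
  | empty => simp
  | cons a m ih => simp [ih]

lemma bestBid_le_iff {L : Book} {x : EReal} : L.bestBid ≤ x ↔ ∀ b ∈ L.bids, (b : EReal) ≤ x := by
  simp [bestBid]

lemma le_bestAsk_iff {L : Book} {x : EReal} : x ≤ L.bestAsk ↔ ∀ a ∈ L.asks, x ≤ (a : EReal) := by
  simp [bestAsk]

lemma bestBid_eq_bot_or_mem (L : Book) :
    L.bestBid = ⊥ ∨ ∃ b ∈ L.bids, L.bestBid = (b : EReal) := by
  unfold bestBid
  induction L.bids using Multiset.induction with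
  | empty => simp
  | cons a m ih =>
    right
    rw [Multiset.map_cons, Multiset.sup_cons]
    rcases ih with h | ⟨b, hb, h⟩
    · exact ⟨a, by simp, by simp [h]⟩
    · rw [h]
      rcases le_total a b with hab | hab
      · exact ⟨b, by simp [hb], sup_eq_right.2 (by exact_mod_cast hab)⟩
      · exact ⟨a, by simp, sup_eq_left.2 (by exact_mod_cast hab)⟩

/-- The book seen in a mirror that reverses the price axis: bids at `x` become asks at `-x` and
vice versa. -/
def mirror (L : Book) : Book := ⟨L.asks.map Neg.neg, L.bids.map Neg.neg⟩

lemma bestBid_mirror (L : Book) : L.mirror.bestBid = -L.bestAsk := by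
  simp only [bestBid, bestAsk, mirror, Multiset.map_map]
  induction L.asks using Multiset.induction with
  | empty => simp
  | cons a m ih =>
    simp only [Multiset.map_cons, Multiset.sup_cons, Multiset.inf_cons, ih]
    rw [Function.comp_apply, EReal.coe_neg]
    exact (EReal.neg_strictAnti.antitone.map_min).symm

lemma mirror_mirror (L : Book) : L.mirror.mirror = L := by
  simp [mirror, Multiset.map_map]

lemma bestAsk_mirror (L : Book) : L.mirror.bestAsk = -L.bestBid := by
  rw [← neg_neg L.mirror.bestAsk, ← bestBid_mirror, mirror_mirror]

lemma bestAsk_eq_top_or_mem (L : Book) :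
    L.bestAsk = ⊤ ∨ ∃ a ∈ L.asks, L.bestAsk = (a : EReal) := by
  rcases L.mirror.bestBid_eq_bot_or_mem with h | ⟨b, hb, h⟩
  · left
    rwa [bestBid_mirror, EReal.neg_eq_bot_iff] at h
  · right
    obtain ⟨a, ha, rfl⟩ := Multiset.mem_map.1 hb
    refine ⟨a, ha, ?_⟩
    rw [bestBid_mirror, EReal.coe_neg] at h
    exact neg_injective h

/-- The mirror image of an arriving order. -/
def _root_.LimitOrderBook.mirrorArrival : Arrival → Arrival :=
  Sum.elim (fun q => Sum.inr (-q)) (fun p => Sum.inl (-p))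

lemma arrive_mirror (L : Book) (o : Arrival) :
    L.mirror.arrive (mirrorArrival o) = (L.arrive o).mirror := by
  rcases o with q | p
  · have h : ((-q : ℝ) : EReal) < L.mirror.bestBid ↔ L.bestAsk < (q : EReal) := by
      rw [bestBid_mirror, EReal.coe_neg, EReal.neg_lt_neg_iff]
    simp only [mirrorArrival, Sum.elim_inl, arrive, h]
    split_ifs
    · rw [bestBid_mirror, EReal.toReal_neg_eq]
      simp [mirror, Multiset.map_erase _ neg_injective]
    · simp [mirror]
  · have h : L.mirror.bestAsk < ((-p : ℝ) : EReal) ↔ (p : EReal) < L.bestBid := by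
      rw [bestAsk_mirror, EReal.coe_neg, EReal.neg_lt_neg_iff]
    simp only [mirrorArrival, Sum.elim_inr, arrive, h]
    split_ifs
    · rw [bestAsk_mirror, EReal.toReal_neg_eq]
      simp [mirror, Multiset.map_erase _ neg_injective]
    · simp [mirror]

lemma bookAfter_mirror (o : ℕ → Arrival) (n : ℕ) :
    bookAfter (fun i => mirrorArrival (o i)) n = (bookAfter o n).mirror := by
  induction n with
  | zero => simp [bookAfter, mirror]
  | succ n ih => rw [bookAfter, bookAfter, ih, arrive_mirror]

lemma bestBid_le_bestAsk_bookAfter (o : ℕ → Arrival) (n : ℕ) :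
    (bookAfter o n).bestBid ≤ (bookAfter o n).bestAsk := by
  suffices h : ∀ b ∈ (bookAfter o n).bids, ∀ a ∈ (bookAfter o n).asks, b ≤ a by
    rw [bestBid_le_iff]
    intro b hb
    rw [le_bestAsk_iff]
    intro a ha
    exact_mod_cast h b hb a ha
  induction n with
  | zero => simp [bookAfter]
  | succ n ih =>
    rw [bookAfter]
    set L := bookAfter o n
    rcases o n with q | p
    · by_cases hq : L.bestAsk < (q : EReal)
      · simp only [arrive, hq, if_true]
        exact fun b hb a ha => ih b hb a (Multiset.mem_of_mem_erase ha)
      · simp only [arrive, hq, if_false]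
        intro b hb a ha
        rcases Multiset.mem_cons.1 hb with rfl | hb
        · exact_mod_cast le_bestAsk_iff.1 (not_lt.1 hq) a ha
        · exact ih b hb a ha
    · by_cases hp : (p : EReal) < L.bestBid
      · simp only [arrive, hp, if_true]
        exact fun b hb a ha => ih b (Multiset.mem_of_mem_erase hb) a ha
      · simp only [arrive, hp, if_false]
        intro b hb a ha
        rcases Multiset.mem_cons.1 ha with rfl | ha
        · exact_mod_cast bestBid_le_iff.1 (not_lt.1 hp) b hb
        · exact ih b hb a ha

/-- The value of the book when a bid at `x` is worth `wb x` and an ask at `x` is worth `wa x`. -/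
noncomputable def value (wb wa : ℝ → ℝ) (L : Book) : ℝ :=
  (L.bids.map wb).sum + (L.asks.map wa).sum

open Classical in
/-- The change of the value of the book caused by an arriving order. It depends on the book only
through its best prices. The value `toReal` of an infinite best price is never used, because the
strict inequality in front of it fails. -/
noncomputable def gain (wb wa : ℝ → ℝ) (L : Book) : Arrival → ℝ
  | Sum.inl q => if L.bestAsk < (q : EReal) then -wa L.bestAsk.toReal else wb q
  | Sum.inr p => if (p : EReal) < L.bestBid then -wb L.bestBid.toReal else wa p

lemma value_arrive (wb wa : ℝ → ℝ) (L : Book) (o : Arrival) :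
    (L.arrive o).value wb wa = L.value wb wa + L.gain wb wa o := by
  rcases o with q | p
  · by_cases hq : L.bestAsk < (q : EReal)
    · simp only [arrive, gain, hq, if_true, value]
      obtain h | ⟨a, ha, h⟩ := L.bestAsk_eq_top_or_mem
      · simp [h] at hq
      · rw [h, EReal.toReal_coe, ← Multiset.sum_map_erase (f := wa) ha]
        ring
    · simp only [arrive, gain, hq, if_false, value, Multiset.map_cons, Multiset.sum_cons]
      ring
  · by_cases hp : (p : EReal) < L.bestBid
    · simp only [arrive, gain, hp, if_true, value]
      obtain h | ⟨a, ha, h⟩ := L.bestBid_eq_bot_or_mem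
      · simp [h] at hp
      · rw [h, EReal.toReal_coe, ← Multiset.sum_map_erase (f := wb) ha]
        ring
    · simp only [arrive, gain, hp, if_false, value, Multiset.map_cons, Multiset.sum_cons]
      ring

lemma value_bookAfter (wb wa : ℝ → ℝ) (o : ℕ → Arrival) (n : ℕ) :
    (bookAfter o n).value wb wa = ∑ i ∈ Finset.range n, (bookAfter o i).gain wb wa (o i) := by
  induction n with
  | zero => simp [bookAfter, value]
  | succ n ih => rw [Finset.sum_range_succ, ← ih, bookAfter, value_arrive]

lemma abs_gain_le {wb wa : ℝ → ℝ} {C : ℝ} (hb : ∀ x, |wb x| ≤ C) (ha : ∀ x, |wa x| ≤ C)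
    (L : Book) (o : Arrival) : |L.gain wb wa o| ≤ C := by
  rcases o with q | p <;> simp only [gain] <;> split_ifs <;> simp [hb, ha]

lemma value_mono {wb wa wb' wa' : ℝ → ℝ} (hb : ∀ x, wb x ≤ wb' x) (ha : ∀ x, wa x ≤ wa' x)
    (L : Book) : L.value wb wa ≤ L.value wb' wa' :=
  add_le_add (Multiset.sum_map_le_sum_map _ _ fun x _ => hb x)
    (Multiset.sum_map_le_sum_map _ _ fun x _ => ha x)

lemma value_add (wb wa wb' wa' : ℝ → ℝ) (L : Book) :
    L.value (fun x => wb x + wb' x) (fun x => wa x + wa' x) =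
      L.value wb wa + L.value wb' wa' := by
  simp only [value, Multiset.sum_map_add]
  ring

lemma value_mul (c : ℝ) (wb wa : ℝ → ℝ) (L : Book) :
    L.value (fun x => c * wb x) (fun x => c * wa x) = c * L.value wb wa := by
  simp only [value, Multiset.sum_map_mul_left]
  ring

lemma value_mirror (wb wa : ℝ → ℝ) (L : Book) :
    L.mirror.value wb wa = L.value (fun x => wa (-x)) (fun x => wb (-x)) := by
  simp only [value, mirror, Multiset.map_map, Function.comp_def]
  ring

/-- The number of bids in the book with price in `s`. -/
noncomputable def bidCount (s : Set ℝ) (L : Book) : ℝ := L.value (s.indicator 1) 0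

/-- The number of asks in the book with price in `s`. -/
noncomputable def askCount (s : Set ℝ) (L : Book) : ℝ := L.value 0 (s.indicator 1)

lemma value_nonneg {wb wa : ℝ → ℝ} (hb : ∀ x, 0 ≤ wb x) (ha : ∀ x, 0 ≤ wa x) (L : Book) :
    0 ≤ L.value wb wa := by
  have := value_mono (wb := 0) (wa := 0) hb ha L
  simpa [value] using this

lemma bidCount_nonneg (s : Set ℝ) (L : Book) : 0 ≤ L.bidCount s :=
  value_nonneg (fun _ => indicator_nonneg (fun _ _ => zero_le_one) _) (fun _ => le_rfl) L

lemma askCount_nonneg (s : Set ℝ) (L : Book) : 0 ≤ L.askCount s :=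
  value_nonneg (fun _ => le_rfl) (fun _ => indicator_nonneg (fun _ _ => zero_le_one) _) L

lemma bestBid_lt_iff_bidCount {L : Book} {x : ℝ} :
    L.bestBid < (x : EReal) ↔ L.bidCount (Ici x) = 0 := by
  rw [bestBid_lt_iff, bidCount, value]
  simp only [Pi.zero_apply, Multiset.map_const', Multiset.sum_replicate, smul_zero, add_zero]
  induction L.bids using Multiset.induction with
  | empty => simp
  | cons a m ih =>
    have hm : 0 ≤ (m.map ((Ici x).indicator (1 : ℝ → ℝ))).sum := by
      refine Multiset.sum_nonneg fun r hr => ?_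
      obtain ⟨b, -, rfl⟩ := Multiset.mem_map.1 hr
      exact indicator_nonneg (fun _ _ => zero_le_one) _
    rw [Multiset.map_cons, Multiset.sum_cons, Multiset.forall_mem_cons, ih]
    by_cases ha : a < x
    · simp [ha]
    · have h1 : (Ici x).indicator (1 : ℝ → ℝ) a = 1 := indicator_of_mem (not_lt.1 ha) _
      rw [h1]
      constructor
      · exact fun h => absurd h.1 ha
      · intro h; linarith

/-- An ask below `x` reduces the number of bids at or above `x`, if there are any. -/
lemma bidCount_arrive_ask_le {L : Book} {x p j : ℝ} (hp : p < x) (hj : 0 ≤ j)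
    (h : L.bidCount (Ici x) ≤ j + 1) : (L.arrive (Sum.inr p)).bidCount (Ici x) ≤ j := by
  rw [bidCount, value_arrive, ← bidCount]
  by_cases hx : L.bestBid < (x : EReal)
  · have h1 : L.gain ((Ici x).indicator 1) 0 (Sum.inr p) ≤ 0 := by
      simp only [gain]
      split_ifs
      · exact neg_nonpos.2 (indicator_nonneg (fun _ _ => zero_le_one) _)
      · exact le_rfl
    rw [bestBid_lt_iff_bidCount.1 hx]
    linarith
  · have h2 : (p : EReal) < L.bestBid := lt_of_lt_of_le (by exact_mod_cast hp) (not_lt.1 hx)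
    have h3 : L.gain ((Ici x).indicator 1) 0 (Sum.inr p) = -1 := by
      simp only [gain, h2, if_true]
      rcases L.bestBid_eq_bot_or_mem with h | ⟨b, -, h⟩
      · simp [h] at h2
      · rw [h] at hx ⊢
        rw [EReal.toReal_coe, indicator_of_mem]
        · rfl
        · exact_mod_cast not_lt.1 hx
    rw [h3]
    linarith

/-! ### Comparison of books that differ by one order -/

/-- `L'` arises from `L` by adding one bid or by removing one ask. -/
def Exceeds (L L' : Book) : Prop :=
  (∃ z, L' = ⟨z ::ₘ L.bids, L.asks⟩) ∨ ∃ z, L = ⟨L'.bids, z ::ₘ L'.asks⟩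

lemma Exceeds.mirror {L L' : Book} (h : Exceeds L L') : Exceeds L'.mirror L.mirror := by
  rcases h with ⟨z, rfl⟩ | ⟨z, rfl⟩
  · exact Or.inr ⟨-z, by simp [Book.mirror]⟩
  · exact Or.inl ⟨-z, by simp [Book.mirror]⟩

lemma exceeds_arrive_of_bid (L : Book) (z : ℝ) (o : Arrival) :
    Exceeds (L.arrive o) (Book.arrive ⟨z ::ₘ L.bids, L.asks⟩ o) := by
  have hask : Book.bestAsk ⟨z ::ₘ L.bids, L.asks⟩ = L.bestAsk := rfl
  have hbid : Book.bestBid ⟨z ::ₘ L.bids, L.asks⟩ = (z : EReal) ⊔ L.bestBid := by simp [bestBid]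
  rcases o with q | p
  · by_cases hq : L.bestAsk < (q : EReal)
    · exact Or.inl ⟨z, by simp [arrive, hask, hq]⟩
    · exact Or.inl ⟨z, by simp [arrive, hask, hq, Multiset.cons_swap]⟩
  · by_cases hp : (p : EReal) < L.bestBid
    · obtain h | ⟨b, hb, h⟩ := L.bestBid_eq_bot_or_mem
      · simp [h] at hp
      have hp' : (p : EReal) < (z : EReal) ⊔ L.bestBid := lt_sup_of_lt_right hp
      rcases lt_or_ge b z with hbz | hbz
      · -- the additional bid is executed instead of the bid at `b`
        have h1 : (z : EReal) ⊔ L.bestBid = z := by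
          rw [h]; exact sup_eq_left.2 (by exact_mod_cast hbz.le)
        refine Or.inl ⟨b, ?_⟩
        simp only [arrive, hbid, hp, hp', if_true]
        rw [h1, h]
        simp [Multiset.cons_erase hb]
      · have h1 : (z : EReal) ⊔ L.bestBid = b := by
          rw [h]; exact sup_eq_right.2 (by exact_mod_cast hbz)
        refine Or.inl ⟨z, ?_⟩
        simp only [arrive, hbid, hp, hp', if_true]
        rw [h1, h]
        simp [Multiset.erase_cons_tail_of_mem hb]
    · by_cases hz : (p : EReal) < z
      · have hp' : (p : EReal) < (z : EReal) ⊔ L.bestBid := lt_sup_of_lt_left hz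
        have h1 : (z : EReal) ⊔ L.bestBid = z := sup_eq_left.2 ((not_lt.1 hp).trans hz.le)
        refine Or.inr ⟨p, ?_⟩
        simp only [arrive, hbid, hp, hp', if_true, if_false]
        rw [h1]
        simp
      · have hp' : ¬ (p : EReal) < (z : EReal) ⊔ L.bestBid := by
          rw [lt_sup_iff]; tauto
        exact Or.inl ⟨z, by simp [arrive, hbid, hp, hp']⟩

lemma Exceeds.arrive {L L' : Book} (h : Exceeds L L') (o : Arrival) :
    Exceeds (L.arrive o) (L'.arrive o) := by
  rcases h with ⟨z, rfl⟩ | ⟨z, rfl⟩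
  · exact exceeds_arrive_of_bid L z o
  · have h1 := (exceeds_arrive_of_bid L'.mirror (-z) (mirrorArrival o)).mirror
    have h2 : (⟨-z ::ₘ L'.mirror.bids, L'.mirror.asks⟩ : Book) =
        Book.mirror ⟨L'.bids, z ::ₘ L'.asks⟩ := by simp [Book.mirror]
    rwa [h2, arrive_mirror, arrive_mirror, mirror_mirror, mirror_mirror] at h1

lemma Exceeds.abs_bidCount_sub_le {L L' : Book} (h : Exceeds L L') (s : Set ℝ) :
    |L.bidCount s - L'.bidCount s| ≤ 1 := by
  rcases h with ⟨z, rfl⟩ | ⟨z, rfl⟩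
  · simp only [bidCount, value, Multiset.map_cons, Multiset.sum_cons]
    by_cases hz : z ∈ s <;> simp [hz]
  · simp [bidCount, value]

/-- Ignoring the first order changes the number of bids in a set by at most one at all times. -/
lemma abs_bidCount_bookAfter_succ_sub_le (o : ℕ → Arrival) (s : Set ℝ) (n : ℕ) :
    |(bookAfter o (n + 1)).bidCount s - (bookAfter (fun i => o (i + 1)) n).bidCount s| ≤ 1 := by
  have h : Exceeds (bookAfter o (n + 1)) (bookAfter (fun i => o (i + 1)) n) ∨
      Exceeds (bookAfter (fun i => o (i + 1)) n) (bookAfter o (n + 1)) := by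
    induction n with
    | zero =>
      rcases h : o 0 with q | p
      · exact Or.inr (Or.inl ⟨q, by simp [bookAfter, h, Book.arrive, bestAsk]⟩)
      · exact Or.inl (Or.inr ⟨p, by simp [bookAfter, h, Book.arrive, bestBid]⟩)
    | succ n ih => exact ih.imp (fun h => h.arrive _) fun h => h.arrive _
  rcases h with h | h
  · exact h.abs_bidCount_sub_le s
  · rw [abs_sub_comm]; exact h.abs_bidCount_sub_le s

lemma tendsto_bidCount_shift (o : ℕ → Arrival) (s : Set ℝ) (m : ℕ) :
    Tendsto (fun n => (bookAfter o n).bidCount s) atTop atTop ↔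
      Tendsto (fun n => (bookAfter (fun i => o (i + m)) n).bidCount s) atTop atTop := by
  induction m with
  | zero => rfl
  | succ m ih =>
    rw [ih, ← tendsto_add_atTop_iff_nat 1]
    have h : ∀ n, |(bookAfter (fun i => o (i + m)) (n + 1)).bidCount s -
        (bookAfter (fun i => o (i + (m + 1))) n).bidCount s| ≤ 1 := fun n => by
      have := abs_bidCount_bookAfter_succ_sub_le (fun i => o (i + m)) s n
      simpa only [add_assoc, add_comm 1 m] using this
    constructor <;> intro hT
    · refine tendsto_atTop_mono (fun n => ?_) (tendsto_atTop_add_const_right _ (-1 : ℝ) hT)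
      linarith [abs_le.1 (h n)]
    · refine tendsto_atTop_mono (fun n => ?_) (tendsto_atTop_add_const_right _ (-1 : ℝ) hT)
      linarith [abs_le.1 (h n)]

end Book

/-! ### Measurability -/

/-- The σ-algebra on the set of books generated by the value functions, for all measurable weights. -/
noncomputable instance : MeasurableSpace Book :=
  ⨆ w : {w : (ℝ → ℝ) × (ℝ → ℝ) // Measurable w.1 ∧ Measurable w.2},
    MeasurableSpace.comap (Book.value w.1.1 w.1.2) inferInstance

namespace Book

lemma measurable_value {wb wa : ℝ → ℝ} (hb : Measurable wb) (ha : Measurable wa) :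
    Measurable (value wb wa) := by
  rw [measurable_iff_comap_le]
  exact le_iSup (fun w : {w : (ℝ → ℝ) × (ℝ → ℝ) // Measurable w.1 ∧ Measurable w.2} =>
    MeasurableSpace.comap (Book.value w.1.1 w.1.2) inferInstance) ⟨(wb, wa), hb, ha⟩

lemma measurable_of_value {α : Type*} {m : MeasurableSpace α} {f : α → Book}
    (h : ∀ wb wa : ℝ → ℝ, Measurable wb → Measurable wa →
      Measurable fun x => (f x).value wb wa) : Measurable f := by
  rw [measurable_iff_comap_le]
  change MeasurableSpace.comap f (⨆ w, _) ≤ _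
  rw [MeasurableSpace.comap_iSup]
  refine iSup_le fun w => ?_
  rw [MeasurableSpace.comap_comp]
  exact measurable_iff_comap_le.1 (h _ _ w.2.1 w.2.2)

lemma measurable_bidCount {s : Set ℝ} (hs : MeasurableSet s) : Measurable (bidCount s) :=
  measurable_value (measurable_one.indicator hs) measurable_zero

lemma measurable_mirror : Measurable mirror := by
  refine measurable_of_value fun wb wa hb ha => ?_
  simp only [value_mirror]
  exact measurable_value (ha.comp measurable_neg) (hb.comp measurable_neg)

lemma measurable_bestBid : Measurable bestBid := by
  refine measurable_of_Iio fun x => ?_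
  induction x with
  | bot => simp
  | top =>
    have : bestBid ⁻¹' Iio ⊤ = univ := by
      ext L
      simp only [mem_preimage, mem_Iio, mem_univ, iff_true]
      rcases L.bestBid_eq_bot_or_mem with h | ⟨b, -, h⟩ <;> rw [h]
      · exact bot_lt_top
      · exact EReal.coe_lt_top b
    rw [this]
    exact MeasurableSet.univ
  | coe x =>
    have : bestBid ⁻¹' Iio (x : EReal) = {L | L.bidCount (Ici x) = 0} := by
      ext L
      exact bestBid_lt_iff_bidCount
    rw [this]
    exact measurable_bidCount measurableSet_Ici (measurableSet_singleton 0)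

lemma measurable_bestAsk : Measurable bestAsk := by
  have : bestAsk = fun L : Book => -L.mirror.bestBid := by
    ext L
    rw [bestBid_mirror, neg_neg]
  rw [this]
  exact (measurable_bestBid.comp measurable_mirror).neg

lemma measurable_gain {wb wa : ℝ → ℝ} (hb : Measurable wb) (ha : Measurable wa) :
    Measurable fun p : Book × Arrival => p.1.gain wb wa p.2 := by
  rw [← (MeasurableEquiv.prodSumDistrib Book ℝ ℝ).symm.measurable_comp_iff]
  refine measurable_fun_sum ?_ ?_
  · change Measurable fun p : Book × ℝ => p.1.gain wb wa (Sum.inl p.2)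
    simp only [gain]
    refine Measurable.ite (measurableSet_lt (measurable_bestAsk.comp measurable_fst)
      (measurable_coe_real_ereal.comp measurable_snd)) ?_ (hb.comp measurable_snd)
    exact (ha.comp (measurable_bestAsk.comp measurable_fst).ereal_toReal).neg
  · change Measurable fun p : Book × ℝ => p.1.gain wb wa (Sum.inr p.2)
    simp only [gain]
    refine Measurable.ite (measurableSet_lt (measurable_coe_real_ereal.comp measurable_snd)
      (measurable_bestBid.comp measurable_fst)) ?_ (ha.comp measurable_snd)
    exact (hb.comp (measurable_bestBid.comp measurable_fst).ereal_toReal).neg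

lemma measurable_arrive : Measurable fun p : Book × Arrival => p.1.arrive p.2 := by
  refine measurable_of_value fun wb wa hb ha => ?_
  simp only [value_arrive]
  exact ((measurable_value hb ha).comp measurable_fst).add (measurable_gain hb ha)

lemma measurable_bookAfter {Ω : Type*} {m : MeasurableSpace Ω} {o : ℕ → Ω → Arrival} {n : ℕ}
    (h : ∀ i < n, Measurable (o i)) : Measurable fun ω => bookAfter (fun i => o i ω) n := by
  induction n with
  | zero => exact measurable_const
  | succ n ih =>
    exact measurable_arrive.comp
      ((ih fun i hi => h i (hi.trans n.lt_succ_self)).prodMk (h n n.lt_succ_self))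

end Book

/-! ### Laws of large numbers -/

/-- Sums of bounded variables, each orthogonal to the sum of the preceding ones, are `o(n)`. -/
theorem ae_tendsto_average_zero_of_orthogonal {Ω : Type*} [MeasurableSpace Ω] {μ : Measure Ω}
    [IsProbabilityMeasure μ] {X : ℕ → Ω → ℝ} {C : ℝ} (hX : ∀ n, Measurable (X n))
    (hC : ∀ n ω, |X n ω| ≤ C)
    (horth : ∀ n, ∫ ω, (∑ i ∈ Finset.range n, X i ω) * X n ω ∂μ = 0) :
    ∀ᵐ ω ∂μ, Tendsto (fun n : ℕ => (∑ i ∈ Finset.range n, X i ω) / n) atTop (𝓝 0) := by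
  set S : ℕ → Ω → ℝ := fun n ω => ∑ i ∈ Finset.range n, X i ω with hS
  have hC0 : 0 ≤ C := by
    obtain ⟨ω⟩ := nonempty_of_isProbabilityMeasure μ
    exact (abs_nonneg _).trans (hC 0 ω)
  have hSm : ∀ n, Measurable (S n) := fun n => Finset.measurable_fun_sum _ fun i _ => hX i
  have hSd : ∀ m n ω, m ≤ n → |S n ω - S m ω| ≤ C * (n - m) := by
    intro m n ω hmn
    induction n, hmn using Nat.le_induction with
    | base => simp
    | succ n hmn ih =>
      have h1 : S (n + 1) ω - S m ω = (S n ω - S m ω) + X n ω := by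
        simp only [hS, Finset.sum_range_succ]; ring
      rw [h1]
      push_cast
      calc _ ≤ |S n ω - S m ω| + |X n ω| := abs_add_le _ _
        _ ≤ C * (n - m) + C := add_le_add ih (hC n ω)
        _ = _ := by ring
  have hSb : ∀ n ω, |S n ω| ≤ C * n := fun n ω => by
    have := hSd 0 n ω (Nat.zero_le n)
    simpa [hS] using this
  have hint : ∀ {f : Ω → ℝ} (_ : Measurable f) {B : ℝ} (_ : ∀ ω, |f ω| ≤ B), Integrable f μ :=
    fun hf B hB => Integrable.of_bound hf.aestronglyMeasurable B (ae_of_all _ hB)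
  have hSX : ∀ n ω, |S n ω * X n ω| ≤ C * n * C := fun n ω => by
    rw [abs_mul]; exact mul_le_mul (hSb n ω) (hC n ω) (abs_nonneg _) (by positivity)
  have hX2 : ∀ n ω, |X n ω ^ 2| ≤ C ^ 2 := fun n ω => by
    rw [abs_pow]; exact pow_le_pow_left₀ (abs_nonneg _) (hC n ω) 2
  have hS2 : ∀ n ω, |S n ω ^ 2| ≤ (C * n) ^ 2 := fun n ω => by
    rw [abs_pow]; exact pow_le_pow_left₀ (abs_nonneg _) (hSb n ω) 2
  have hvar : ∀ n, ∫ ω, S n ω ^ 2 ∂μ ≤ C ^ 2 * n := by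
    intro n
    induction n with
    | zero => simp [hS]
    | succ n ih =>
      have h1 : ∀ ω, S (n + 1) ω ^ 2 = S n ω ^ 2 + 2 * (S n ω * X n ω) + X n ω ^ 2 := fun ω => by
        simp only [hS, Finset.sum_range_succ]; ring
      have i1 : Integrable (fun ω => S n ω ^ 2) μ := hint ((hSm n).pow_const 2) (hS2 n)
      have i2 : Integrable (fun ω => S n ω * X n ω) μ := hint ((hSm n).mul (hX n)) (hSX n)
      have i3 : Integrable (fun ω => X n ω ^ 2) μ := hint ((hX n).pow_const 2) (hX2 n)
      have i12 : Integrable (fun ω => S n ω ^ 2 + 2 * (S n ω * X n ω)) μ :=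
        i1.add (i2.const_mul 2)
      simp_rw [h1]
      rw [integral_add i12 i3, integral_add i1 (i2.const_mul 2),
        integral_const_mul]
      have h2 : ∫ ω, S n ω * X n ω ∂μ = 0 := horth n
      have h3 : ∫ ω, X n ω ^ 2 ∂μ ≤ C ^ 2 := by
        have := integral_mono i3 (integrable_const (C ^ 2)) fun ω => (le_abs_self _).trans (hX2 n ω)
        simpa using this
      rw [h2]
      push_cast
      linarith
  -- along the squares the second moments are summable
  have hsq : ∀ᵐ ω ∂μ, Tendsto (fun k : ℕ => (S (k ^ 2) ω / (k : ℝ) ^ 2) ^ 2) atTop (𝓝 0) := by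
    have h1 : ∀ k : ℕ, ∫⁻ ω, ENNReal.ofReal ((S (k ^ 2) ω / (k : ℝ) ^ 2) ^ 2) ∂μ ≤
        ENNReal.ofReal (C ^ 2 * (1 / (k : ℝ) ^ 2)) := by
      intro k
      have hb : ∀ ω, |(S (k ^ 2) ω / (k : ℝ) ^ 2) ^ 2| ≤
          (C * (k ^ 2 : ℕ)) ^ 2 / ((k : ℝ) ^ 2) ^ 2 := fun ω => by
        rw [div_pow, abs_div, abs_of_nonneg (sq_nonneg ((k : ℝ) ^ 2))]
        gcongr
        exact hS2 _ ω
      rw [← ofReal_integral_eq_lintegral_ofReal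
        (hint (((hSm _).div_const _).pow_const 2) hb) (ae_of_all _ fun ω => sq_nonneg _)]
      refine ENNReal.ofReal_le_ofReal ?_
      simp_rw [div_pow]
      rw [integral_div]
      rcases Nat.eq_zero_or_pos k with rfl | hk
      · simp
      · have hk' : (0 : ℝ) < k := by exact_mod_cast hk
        rw [div_le_iff₀ (by positivity)]
        refine (hvar (k ^ 2)).trans (le_of_eq ?_)
        push_cast
        field_simp
    have h2 : ∑' k : ℕ, ∫⁻ ω, ENNReal.ofReal ((S (k ^ 2) ω / (k : ℝ) ^ 2) ^ 2) ∂μ ≠ ⊤ := by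
      refine ne_top_of_le_ne_top ?_ (ENNReal.tsum_le_tsum h1)
      exact ((Real.summable_one_div_nat_pow.2 one_lt_two).mul_left (C ^ 2)).tsum_ofReal_ne_top
    rw [← lintegral_tsum fun k =>
      (((hSm _).div_const _).pow_const 2).ennreal_ofReal.aemeasurable] at h2
    have h3 := ae_lt_top' (AEMeasurable.tsum fun k =>
      (((hSm _).div_const _).pow_const 2).ennreal_ofReal.aemeasurable) h2
    filter_upwards [h3] with ω hω
    have h4 := ENNReal.tendsto_atTop_zero_of_tsum_ne_top hω.ne
    have h5 := (ENNReal.tendsto_toReal ENNReal.zero_ne_top).comp h4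
    refine h5.congr fun k => ?_
    exact ENNReal.toReal_ofReal (sq_nonneg _)
  -- between consecutive squares `S` changes by `O(√n)` only
  filter_upwards [hsq] with ω hω
  have hsqrt : Tendsto Nat.sqrt atTop atTop :=
    tendsto_atTop.2 fun b => eventually_atTop.2 ⟨b ^ 2, fun n hn => Nat.le_sqrt'.2 hn⟩
  have h1 : Tendsto (fun k : ℕ => |S (k ^ 2) ω / (k : ℝ) ^ 2|) atTop (𝓝 0) := by
    have := hω.sqrt
    simp_rw [Real.sqrt_sq_eq_abs, Real.sqrt_zero] at this
    exact this
  have h2 : Tendsto (fun k : ℕ => 2 * C / (k : ℝ)) atTop (𝓝 0) :=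
    tendsto_const_div_atTop_nhds_zero_nat _
  have h3 := (h1.add h2).comp hsqrt
  rw [add_zero] at h3
  refine squeeze_zero_norm' ?_ h3
  filter_upwards [eventually_ge_atTop 1] with n hn
  have hk : 0 < Nat.sqrt n := Nat.sqrt_pos.2 hn
  simp only [Function.comp]
  set k := Nat.sqrt n with hkdef
  have hk' : (0 : ℝ) < k := by exact_mod_cast hk
  have hkn : k ^ 2 ≤ n := Nat.sqrt_le' n
  have hnk : n ≤ k ^ 2 + 2 * k := by
    have := Nat.sqrt_le_add n
    rw [← hkdef] at this
    nlinarith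
  have hkn' : (k : ℝ) ^ 2 ≤ n := by exact_mod_cast hkn
  have hnk' : (n : ℝ) ≤ (k : ℝ) ^ 2 + 2 * k := by exact_mod_cast hnk
  have h4 := hSd _ _ ω hkn
  push_cast at h4
  have h5 : |S n ω| ≤ |S (k ^ 2) ω| + C * (2 * k) := by
    have h6 : C * ((n : ℝ) - (k : ℝ) ^ 2) ≤ C * (2 * k) :=
      mul_le_mul_of_nonneg_left (by linarith) hC0
    have h7 := abs_sub_abs_le_abs_sub (S n ω) (S (k ^ 2) ω)
    linarith
  rw [norm_div, Real.norm_eq_abs, Real.norm_natCast, abs_div, abs_of_pos (pow_pos hk' 2)]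
  have h8 : |S n ω| / n ≤ |S n ω| / (k : ℝ) ^ 2 :=
    div_le_div_of_nonneg_left (abs_nonneg _) (by positivity) hkn'
  refine h8.trans ?_
  rw [div_add_div _ _ (by positivity) hk'.ne', div_le_div_iff₀ (by positivity) (by positivity)]
  have h9 := mul_le_mul_of_nonneg_right h5 (by positivity : (0 : ℝ) ≤ (k : ℝ) ^ 2 * k)
  nlinarith

/-! ### Independence of the next order from the past -/

/-- The law of an arriving order. -/
noncomputable def orderLaw (fb fa : ℝ → ℝ) : Measure Arrival :=
  (2 : ENNReal)⁻¹ • (priceLaw fb).map Sum.inl + (2 : ENNReal)⁻¹ • (priceLaw fa).map Sum.inr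

section OrderLaw

variable {fb fa : ℝ → ℝ} (hfb : IsPriceDensity fb) (hfa : IsPriceDensity fa)
include hfb hfa

lemma integral_orderLaw {φ : Arrival → ℝ} (hφ : Measurable φ) {C : ℝ} (hC : ∀ a, |φ a| ≤ C) :
    ∫ a, φ a ∂(orderLaw fb fa) =
      2⁻¹ * ((∫ q, fb q * φ (Sum.inl q)) + ∫ p, fa p * φ (Sum.inr p)) := by
  have := hfb.isProbabilityMeasure
  have := hfa.isProbabilityMeasure
  have hb : IsFiniteMeasure ((priceLaw fb).map (Sum.inl : ℝ → Arrival)) :=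
    Measure.isFiniteMeasure_map _ _
  have ha : IsFiniteMeasure ((priceLaw fa).map (Sum.inr : ℝ → Arrival)) :=
    Measure.isFiniteMeasure_map _ _
  have i1 : Integrable φ ((priceLaw fb).map (Sum.inl : ℝ → Arrival)) :=
    Integrable.of_bound hφ.aestronglyMeasurable C (ae_of_all _ hC)
  have i2 : Integrable φ ((priceLaw fa).map (Sum.inr : ℝ → Arrival)) :=
    Integrable.of_bound hφ.aestronglyMeasurable C (ae_of_all _ hC)
  rw [orderLaw, integral_add_measure (i1.smul_measure (by simp)) (i2.smul_measure (by simp)),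
    integral_smul_measure, integral_smul_measure,
    integral_map measurable_inl.aemeasurable hφ.aestronglyMeasurable,
    integral_map measurable_inr.aemeasurable hφ.aestronglyMeasurable,
    hfb.integral_priceLaw, hfa.integral_priceLaw]
  simp only [ENNReal.toReal_inv, ENNReal.toReal_ofNat, smul_eq_mul]
  ring

end OrderLaw

variable {Ω : Type*} [MeasurableSpace Ω] {μ : Measure Ω} {fb fa : ℝ → ℝ} {τ : ℕ → Ω → ℝ}
  {o : ℕ → Ω → Arrival}

/-- The σ-algebras generated by the first `n` orders. -/
def pastFiltration (o : ℕ → Ω → Arrival) (ho : ∀ n, Measurable (o n)) :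
    Filtration ℕ (inferInstance : MeasurableSpace Ω) where
  seq n := ⨆ i ∈ Iio n, MeasurableSpace.comap (o i) inferInstance
  mono' _ _ hmn := biSup_mono fun _ hi => lt_of_lt_of_le hi hmn
  le' _ := iSup₂_le fun i _ => (ho i).comap_le

lemma measurable_past (ho : ∀ n, Measurable (o n)) {i n : ℕ} (hi : i < n) :
    Measurable[pastFiltration o ho n] (o i) := by
  rw [measurable_iff_comap_le]
  exact le_iSup₂ (f := fun (i : ℕ) (_ : i ∈ Iio n) =>
    MeasurableSpace.comap (o i) inferInstance) i hi

lemma measurable_bookAfter_past (ho : ∀ n, Measurable (o n)) (n : ℕ) :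
    Measurable[pastFiltration o ho n] fun ω => bookAfter (fun i => o i ω) n :=
  Book.measurable_bookAfter fun _ hi => measurable_past ho hi

namespace IsOrderFlow

variable (h : IsOrderFlow μ fb fa τ o)
include h

lemma map_order (n : ℕ) : μ.map (o n) = orderLaw fb fa := h.law n

lemma indep_past (n : ℕ) :
    Indep (pastFiltration o h.measurable_order n) (MeasurableSpace.comap (o n) inferInstance)
      μ := by
  have h1 := indep_iSup_of_disjoint (fun i => (h.measurable_order i).comap_le) h.indep.iIndep
    (S := Iio n) (T := {n}) (by simp)
  rw [iSup_singleton] at h1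
  exact h1

/-- Averaging over the next order, given what has happened before. -/
lemma integral_past [IsProbabilityMeasure μ] {E : Type*} [MeasurableSpace E] {n : ℕ} {Y : Ω → E}
    (hY : Measurable[pastFiltration o h.measurable_order n] Y) {ψ : E × Arrival → ℝ}
    (hψ : Measurable ψ) {C : ℝ} (hC : ∀ ω a, |ψ (Y ω, a)| ≤ C) :
    ∫ ω, ψ (Y ω, o n ω) ∂μ = ∫ ω, ∫ a, ψ (Y ω, a) ∂(orderLaw fb fa) ∂μ := by
  have hY' : Measurable Y := hY.mono ((pastFiltration o h.measurable_order).le n) le_rfl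
  have ho := h.measurable_order n
  have hind : IndepFun Y (o n) μ := by
    rw [IndepFun_iff_Indep]
    exact indep_of_indep_of_le_left (h.indep_past n) (measurable_iff_comap_le.1 hY)
  have hp := (indepFun_iff_map_prod_eq_prod_map_map hY'.aemeasurable ho.aemeasurable).1 hind
  have hi : Integrable (fun ω => ψ (Y ω, o n ω)) μ :=
    Integrable.of_bound (hψ.comp (hY'.prodMk ho)).aestronglyMeasurable C
      (ae_of_all _ fun ω => hC ω _)
  have : IsProbabilityMeasure (μ.map Y) := Measure.isProbabilityMeasure_map hY'.aemeasurable
  have : IsProbabilityMeasure (orderLaw fb fa) :=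
    h.map_order n ▸ Measure.isProbabilityMeasure_map ho.aemeasurable
  have hi2 : Integrable ψ ((μ.map Y).prod (orderLaw fb fa)) := by
    rw [← h.map_order n, ← hp]
    exact (integrable_map_measure hψ.aestronglyMeasurable (hY'.prodMk ho).aemeasurable).2 hi
  rw [← integral_map (f := ψ) (hY'.prodMk ho).aemeasurable hψ.aestronglyMeasurable, hp,
    h.map_order n, integral_prod _ hi2]
  exact integral_map hY'.aemeasurable
    (hψ.stronglyMeasurable.integral_prod_right').aestronglyMeasurable

/-- The law of large numbers for a bounded function of the book and the next order, centered by
its average over the next order. -/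
theorem ae_tendsto_average [IsProbabilityMeasure μ] {φ : Book × Arrival → ℝ} (hφ : Measurable φ)
    {C : ℝ} (hC : ∀ p, |φ p| ≤ C) :
    ∀ᵐ ω ∂μ, Tendsto (fun n : ℕ => (∑ i ∈ Finset.range n,
      (φ (bookAfter (fun j => o j ω) i, o i ω) -
        ∫ a, φ (bookAfter (fun j => o j ω) i, a) ∂(orderLaw fb fa))) / n) atTop (𝓝 0) := by
  have hprob : IsProbabilityMeasure (orderLaw fb fa) :=
    h.map_order 0 ▸ Measure.isProbabilityMeasure_map (h.measurable_order 0).aemeasurable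
  set L : ℕ → Ω → Book := fun n ω => bookAfter (fun j => o j ω) n with hL
  set φ' : Book → ℝ := fun l => ∫ a, φ (l, a) ∂(orderLaw fb fa) with hφ'
  have hφ'm : Measurable φ' := (hφ.stronglyMeasurable.integral_prod_right').measurable
  have hφ'b : ∀ l, |φ' l| ≤ C := fun l => by
    have := norm_integral_le_of_norm_le_const (μ := orderLaw fb fa) (f := fun a => φ (l, a))
      (ae_of_all _ fun a => hC (l, a))
    simpa using this
  have hLm : ∀ n, Measurable (L n) := fun n =>
    Book.measurable_bookAfter fun i _ => h.measurable_order i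
  have hψ : Measurable fun p : Book × Arrival => φ p - φ' p.1 := hφ.sub (hφ'm.comp measurable_fst)
  have hψb : ∀ p : Book × Arrival, |φ p - φ' p.1| ≤ C + C := fun p =>
    (abs_sub _ _).trans (add_le_add (hC p) (hφ'b p.1))
  refine ae_tendsto_average_zero_of_orthogonal
    (X := fun n ω => φ (L n ω, o n ω) - φ' (L n ω)) (C := C + C)
    (fun n => hψ.comp ((hLm n).prodMk (h.measurable_order n))) (fun n ω => hψb (L n ω, o n ω))
    fun n => ?_
  set D : Ω → ℝ := fun ω => ∑ i ∈ Finset.range n, (φ (L i ω, o i ω) - φ' (L i ω)) with hD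
  have hDm : Measurable[pastFiltration o h.measurable_order n] D := by
    refine Finset.measurable_fun_sum _ fun i hi => ?_
    have hi' := Finset.mem_range.1 hi
    refine hψ.comp (Measurable.prodMk ?_ (measurable_past h.measurable_order hi'))
    exact (measurable_bookAfter_past h.measurable_order i).mono
      ((pastFiltration o h.measurable_order).mono hi'.le) le_rfl
  have hDb : ∀ ω, |D ω| ≤ n * (C + C) := fun ω => by
    refine (Finset.abs_sum_le_sum_abs _ _).trans ?_
    refine (Finset.sum_le_card_nsmul _ _ (C + C) fun i _ => hψb (L i ω, o i ω)).trans ?_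
    rw [Finset.card_range, nsmul_eq_mul]
  have hC0 : 0 ≤ C := (abs_nonneg _).trans (hC (⟨0, 0⟩, Sum.inl 0))
  have key := h.integral_past (n := n) (Y := fun ω => (D ω, L n ω))
    (hDm.prodMk (measurable_bookAfter_past h.measurable_order n))
    (ψ := fun p => p.1.1 * (φ (p.1.2, p.2) - φ' p.1.2)) (C := n * (C + C) * (C + C))
    (by
      refine (measurable_fst.comp measurable_fst).mul ?_
      exact hψ.comp ((measurable_snd.comp measurable_fst).prodMk measurable_snd))
    (fun ω a => by
      rw [abs_mul]
      exact mul_le_mul (hDb ω) (hψb (L n ω, a)) (abs_nonneg _) (by positivity))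
  refine key.trans ?_
  have hz : ∀ ω, ∫ a, D ω * (φ (L n ω, a) - φ' (L n ω)) ∂(orderLaw fb fa) = 0 := fun ω => by
    have hi : Integrable (fun a => φ (L n ω, a)) (orderLaw fb fa) :=
      Integrable.of_bound (hφ.comp measurable_prodMk_left).aestronglyMeasurable C
        (ae_of_all _ fun a => hC _)
    rw [integral_const_mul, integral_sub hi (integrable_const _)]
    simp [hφ']
  simp [hz]

/-- If past events occur infinitely often, then infinitely often they are followed by an order in a
set of positive probability. -/
theorem ae_frequently_and [IsProbabilityMeasure μ] {A : ℕ → Set Ω}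
    (hA : ∀ n, MeasurableSet[pastFiltration o h.measurable_order n] (A n)) {B : Set Arrival}
    (hB : MeasurableSet B) (hpos : orderLaw fb fa B ≠ 0) :
    ∀ᵐ ω ∂μ, (∃ᶠ n in atTop, ω ∈ A n) → ∃ᶠ n in atTop, ω ∈ A n ∧ o n ω ∈ B := by
  set F := pastFiltration o h.measurable_order with hF
  -- the index is shifted, since the order `o n` is known only at step `n + 1`
  set s : ℕ → Set Ω := fun n => Nat.casesOn n ∅ fun k => A k ∩ o k ⁻¹' B with hs
  have hsm : ∀ n, MeasurableSet[F n] (s n) := by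
    intro n
    cases n with
    | zero => exact @MeasurableSet.empty _ (F 0)
    | succ n =>
      refine MeasurableSet.inter (F.mono n.le_succ _ (hA n)) ?_
      exact measurable_past h.measurable_order n.lt_succ_self hB
  have hle := fun n => F.le n
  have hcond : ∀ n, μ[(s (n + 1)).indicator (1 : Ω → ℝ) | F n] =ᵐ[μ]
      (A n).indicator fun _ => (orderLaw fb fa).real B := by
    intro n
    have hBm : MeasurableSet (o n ⁻¹' B) := h.measurable_order n hB
    have e : (s (n + 1)).indicator (1 : Ω → ℝ) =
        (A n).indicator ((o n ⁻¹' B).indicator (1 : Ω → ℝ)) := by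
      rw [indicator_indicator]
    rw [e]
    refine (condExp_indicator ((show Integrable (1 : Ω → ℝ) μ from
      integrable_const 1).indicator hBm) (hA n)).trans ?_
    have h2 := condExp_indep_eq (m₁ := MeasurableSpace.comap (o n) inferInstance) (m₂ := F n)
      (μ := μ) (f := (o n ⁻¹' B).indicator (1 : Ω → ℝ)) (h.measurable_order n).comap_le (hle n)
      ((stronglyMeasurable_one).indicator ⟨B, hB, rfl⟩) (h.indep_past n).symm
    filter_upwards [h2] with ω hω
    by_cases hω' : ω ∈ A n
    · rw [indicator_of_mem hω', indicator_of_mem hω', hω, integral_indicator_one hBm,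
        ← h.map_order n, map_measureReal_apply (h.measurable_order n) hB]
    · rw [indicator_of_notMem hω', indicator_of_notMem hω']
  have hr : 0 < (orderLaw fb fa).real B := by
    have : IsProbabilityMeasure (orderLaw fb fa) :=
      h.map_order 0 ▸ Measure.isProbabilityMeasure_map (h.measurable_order 0).aemeasurable
    exact ENNReal.toReal_pos hpos (measure_ne_top _ _)
  filter_upwards [ae_mem_limsup_atTop_iff μ hsm, ae_all_iff.2 hcond] with ω h1 h2 hfreq
  have h3 : ω ∈ limsup A atTop := by rwa [mem_limsup_iff_frequently_mem]
  rw [limsup_eq_tendsto_sum_indicator_atTop hr A] at h3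
  have h4 : ω ∈ limsup s atTop := by
    rw [h1]
    simp_rw [h2]
    exact h3
  rw [mem_limsup_iff_frequently_mem] at h4
  rw [frequently_atTop] at h4 ⊢
  intro N
  obtain ⟨n, hn, hmem⟩ := h4 (N + 1)
  obtain ⟨k, rfl⟩ : ∃ k, n = k + 1 := ⟨n - 1, by omega⟩
  exact ⟨k, by omega, hmem⟩

end IsOrderFlow

/-! ### Reflection of the price axis -/

namespace IsPriceDensity

variable {f : ℝ → ℝ} (hf : IsPriceDensity f)
include hf

lemma comp_neg : IsPriceDensity fun x => f (-x) where
  measurable := hf.measurable.comp measurable_neg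
  nonneg x := hf.nonneg (-x)
  integrable := hf.integrable.comp_neg
  integral_eq_one := by rw [integral_neg_eq_self f, hf.integral_eq_one]

lemma cdf_comp_neg (x : ℝ) : priceCDF (fun x => f (-x)) x = 1 - priceCDF f (-x) := by
  rw [priceCDF, integral_comp_neg_Iic, hf.integral_Ioi]

lemma priceLaw_comp_neg : priceLaw (fun x => f (-x)) = (priceLaw f).map Neg.neg := by
  ext s hs
  rw [Measure.map_apply measurable_neg hs, hf.comp_neg.priceLaw_apply hs,
    hf.priceLaw_apply (measurable_neg hs), ← integral_indicator hs,
    ← integral_indicator (measurable_neg hs), ← integral_neg_eq_self]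
  congr 2
  ext x
  by_cases hx : -x ∈ s
  · rw [indicator_of_mem hx, indicator_of_mem (s := Neg.neg ⁻¹' s) hx, neg_neg]
  · rw [indicator_of_notMem hx, indicator_of_notMem (s := Neg.neg ⁻¹' s) hx]

end IsPriceDensity

lemma measurable_mirrorArrival : Measurable mirrorArrival :=
  Measurable.sumElim (measurable_inr.comp measurable_neg) (measurable_inl.comp measurable_neg)

variable {Ω : Type*} [MeasurableSpace Ω] {μ : Measure Ω} {fb fa : ℝ → ℝ} {τ : ℕ → Ω → ℝ}
  {o : ℕ → Ω → Arrival}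

/-- Reflecting the price axis exchanges bids and asks, and turns an order flow into an order flow. -/
lemma IsOrderFlow.mirror (h : IsOrderFlow μ fb fa τ o) (hfb : IsPriceDensity fb)
    (hfa : IsPriceDensity fa) :
    IsOrderFlow μ (fun x => fa (-x)) (fun x => fb (-x)) τ
      (fun n ω => mirrorArrival (o n ω)) where
  measurable_time := h.measurable_time
  time_pos := h.time_pos
  time_strictMono := h.time_strictMono
  time_tendsto := h.time_tendsto
  measurable_order n := measurable_mirrorArrival.comp (h.measurable_order n)
  indep := h.indep.comp (fun _ => mirrorArrival) fun _ => measurable_mirrorArrival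
  law n := by
    have h1 : μ.map (fun ω => mirrorArrival (o n ω)) = (μ.map (o n)).map mirrorArrival :=
      (Measure.map_map measurable_mirrorArrival (h.measurable_order n)).symm
    have h2 : (mirrorArrival ∘ Sum.inl : ℝ → Arrival) = Sum.inr ∘ Neg.neg := rfl
    have h3 : (mirrorArrival ∘ Sum.inr : ℝ → Arrival) = Sum.inl ∘ Neg.neg := rfl
    rw [h1, h.law n, Measure.map_add _ _ measurable_mirrorArrival, Measure.map_smul,
      Measure.map_smul, Measure.map_map measurable_mirrorArrival measurable_inl,
      Measure.map_map measurable_mirrorArrival measurable_inr, h2, h3,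
      ← Measure.map_map measurable_inr measurable_neg,
      ← Measure.map_map measurable_inl measurable_neg, hfb.priceLaw_comp_neg,
      hfa.priceLaw_comp_neg, add_comm]

/-! ### Recurrence of prices -/

/-- Almost surely the highest bid is below `x` after infinitely many orders. -/
def BidRecurrent (μ : Measure Ω) (o : ℕ → Ω → Arrival) (x : ℝ) : Prop :=
  ∀ᵐ ω ∂μ, ∃ᶠ n in atTop, (bookAfter (fun i => o i ω) n).bestBid < (x : EReal)

/-- Almost surely the lowest ask is above `x` after infinitely many orders. -/
def AskRecurrent (μ : Measure Ω) (o : ℕ → Ω → Arrival) (x : ℝ) : Prop :=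
  ∀ᵐ ω ∂μ, ∃ᶠ n in atTop, (x : EReal) < (bookAfter (fun i => o i ω) n).bestAsk

/-- Almost surely the highest bid is eventually at least `x`. -/
def BidEscapes (μ : Measure Ω) (o : ℕ → Ω → Arrival) (x : ℝ) : Prop :=
  ∀ᵐ ω ∂μ, ∀ᶠ n in atTop, (x : EReal) ≤ (bookAfter (fun i => o i ω) n).bestBid

/-- Almost surely the lowest ask is eventually at most `x`. -/
def AskEscapes (μ : Measure Ω) (o : ℕ → Ω → Arrival) (x : ℝ) : Prop :=
  ∀ᵐ ω ∂μ, ∀ᶠ n in atTop, (bookAfter (fun i => o i ω) n).bestAsk ≤ (x : EReal)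

lemma bidRecurrent_mirror {x : ℝ} :
    BidRecurrent μ (fun n ω => mirrorArrival (o n ω)) x ↔ AskRecurrent μ o (-x) := by
  simp only [BidRecurrent, AskRecurrent, Book.bookAfter_mirror, Book.bestBid_mirror,
    EReal.coe_neg, EReal.neg_lt_comm]

lemma bidEscapes_mirror {x : ℝ} :
    BidEscapes μ (fun n ω => mirrorArrival (o n ω)) x ↔ AskEscapes μ o (-x) := by
  simp only [BidEscapes, AskEscapes, Book.bookAfter_mirror, Book.bestBid_mirror,
    EReal.coe_neg, EReal.le_neg]

lemma askEscapes_mirror {x : ℝ} :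
    AskEscapes μ (fun n ω => mirrorArrival (o n ω)) x ↔ BidEscapes μ o (-x) := by
  simp only [BidEscapes, AskEscapes, Book.bookAfter_mirror, Book.bestAsk_mirror,
    EReal.coe_neg, EReal.neg_le]

lemma BidRecurrent.mono {x y : ℝ} (h : BidRecurrent μ o x) (hxy : x ≤ y) :
    BidRecurrent μ o y := by
  filter_upwards [h] with ω hω
  exact hω.mono fun n hn => hn.trans_le (by exact_mod_cast hxy)

lemma AskRecurrent.mono {x y : ℝ} (h : AskRecurrent μ o y) (hxy : x ≤ y) :
    AskRecurrent μ o x := by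
  filter_upwards [h] with ω hω
  exact hω.mono fun n hn => lt_of_le_of_lt (by exact_mod_cast hxy) hn

lemma BidEscapes.not_bidRecurrent [IsProbabilityMeasure μ] {x : ℝ} (h : BidEscapes μ o x) :
    ¬ BidRecurrent μ o x := fun h' => by
  obtain ⟨ω, h1, h2⟩ := (h.and h').exists
  obtain ⟨n, h3, h4⟩ := (h2.and_eventually h1).exists
  exact h3.not_ge h4

/-- The threshold definitions do not depend on the arrival times: the book takes the same values
along continuous time as along the sequence of orders. -/
lemma frequently_bookAt_iff {τ : ℕ → ℝ} {o : ℕ → Arrival} (hm : StrictMono τ)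
    (ht : Tendsto τ atTop atTop) (P : Book → Prop) :
    (∃ᶠ t in atTop, P (bookAt τ o t)) ↔ ∃ᶠ n in atTop, P (bookAfter o n) := by
  have hfin : ∀ t, ∃ n, {k : ℕ | τ k ≤ t} = Iio n := by
    intro t
    obtain ⟨N, hN⟩ := (ht.eventually_gt_atTop t).exists
    classical
    have hex : ∃ n, t < τ n := ⟨N, hN⟩
    refine ⟨Nat.find hex, ?_⟩
    ext k
    simp only [mem_ofPred_eq, mem_Iio, Nat.lt_find_iff, not_lt]
    exact ⟨fun hk m hmk => (hm.monotone hmk).trans hk, fun hk => hk k le_rfl⟩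
  constructor
  · intro hf
    rw [frequently_atTop] at hf ⊢
    intro N
    obtain ⟨t, htN, hP⟩ := hf (τ N)
    obtain ⟨n, hn⟩ := hfin t
    rw [bookAt, hn, Set.ncard_Iio_nat] at hP
    have : N ∈ Iio n := hn ▸ (show τ N ≤ t from htN)
    exact ⟨n, (mem_Iio.1 this).le, hP⟩
  · intro hf
    rw [frequently_atTop] at hf ⊢
    intro T
    obtain ⟨N, hN⟩ := (ht.eventually_ge_atTop T).exists
    obtain ⟨n, hnN, hP⟩ := hf (N + 1)
    obtain ⟨k, rfl⟩ : ∃ k, n = k + 1 := ⟨n - 1, by omega⟩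
    refine ⟨τ k, hN.trans (hm.monotone (by omega)), ?_⟩
    have : {i : ℕ | τ i ≤ τ k} = Iio (k + 1) := by
      ext i
      simp [hm.le_iff_le]
    rwa [bookAt, this, Set.ncard_Iio_nat]

namespace IsOrderFlow

variable (h : IsOrderFlow μ fb fa τ o)
include h

lemma bidThreshold_eq :
    bidThreshold μ τ o = sInf ((fun x : ℝ => (x : EReal)) '' {x | BidRecurrent μ o x}) := by
  have : ∀ x : ℝ, (∀ᵐ ω ∂μ, ∃ᶠ t in atTop,
      (bookAt (fun n => τ n ω) (fun n => o n ω) t).bestBid < (x : EReal)) ↔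
      BidRecurrent μ o x := fun x => by
    refine eventually_congr ?_
    filter_upwards [h.time_strictMono, h.time_tendsto] with ω h1 h2
    exact frequently_bookAt_iff h1 h2 fun L => L.bestBid < (x : EReal)
  simp only [bidThreshold, this]

lemma askThreshold_eq :
    askThreshold μ τ o = sSup ((fun x : ℝ => (x : EReal)) '' {x | AskRecurrent μ o x}) := by
  have : ∀ x : ℝ, (∀ᵐ ω ∂μ, ∃ᶠ t in atTop,
      (x : EReal) < (bookAt (fun n => τ n ω) (fun n => o n ω) t).bestAsk) ↔
      AskRecurrent μ o x := fun x => by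
    refine eventually_congr ?_
    filter_upwards [h.time_strictMono, h.time_tendsto] with ω h1 h2
    exact frequently_bookAt_iff h1 h2 fun L => (x : EReal) < L.bestAsk
  simp only [askThreshold, this]

/-- The event that the number of bids at or above `x` tends to infinity is a tail event, because
ignoring finitely many orders changes this number by a bounded amount. -/
lemma measure_tendsto_bidCount_zero_or_one [IsProbabilityMeasure μ] (x : ℝ) :
    μ {ω | Tendsto (fun n => (bookAfter (fun i => o i ω) n).bidCount (Ici x)) atTop atTop} = 0 ∨
    μ {ω | Tendsto (fun n => (bookAfter (fun i => o i ω) n).bidCount (Ici x)) atTop atTop} = 1 := by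
  refine measure_zero_or_one_of_measurableSet_limsup_atTop
    (s := fun i => MeasurableSpace.comap (o i) inferInstance)
    (fun i => (h.measurable_order i).comap_le) h.indep.iIndep ?_
  rw [limsup_eq_iInf_iSup_of_nat, MeasurableSpace.measurableSet_iInf]
  intro m
  have e : {ω | Tendsto (fun n => (bookAfter (fun i => o i ω) n).bidCount (Ici x)) atTop atTop} =
      {ω | Tendsto (fun n => (bookAfter (fun i => o (i + m) ω) n).bidCount (Ici x))
        atTop atTop} := by
    ext ω
    exact Book.tendsto_bidCount_shift (fun i => o i ω) (Ici x) m
  rw [e]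
  refine measurableSet_tendsto _ fun n => ?_
  refine (Book.measurable_bidCount measurableSet_Ici).comp
    (Book.measurable_bookAfter (o := fun i => o (i + m)) fun i _ => ?_)
  rw [measurable_iff_comap_le]
  exact le_iSup₂ (f := fun (i : ℕ) (_ : i ≥ m) =>
    MeasurableSpace.comap (o i) inferInstance) (i + m) (Nat.le_add_left m i)

/-- Either `x` is recurrent for the highest bid, or the highest bid is eventually at least `x`. In the
zero-one law for the number of bids at or above `x`, the case of a number that does not tend to
infinity leads to recurrence: some finite level is visited infinitely often, and then so is every
lower level, down to zero. -/
theorem bidEscapes_or_bidRecurrent [IsProbabilityMeasure μ] (hfa : IsPriceDensity fa) {x : ℝ}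
    (hx : 0 < priceCDF fa x) : BidEscapes μ o x ∨ BidRecurrent μ o x := by
  rcases h.measure_tendsto_bidCount_zero_or_one x with h0 | h1
  · right
    set B : Set Arrival := Sum.inr '' Iio x with hBdef
    have hB : MeasurableSet B := measurableSet_Iio.inr_image
    have hpos : orderLaw fb fa B ≠ 0 := by
      have h2 : priceLaw fa (Iio x) ≠ 0 := by
        rw [Ne, hfa.priceLaw_eq_zero_iff measurableSet_Iio, ← integral_Iic_eq_integral_Iio]
        exact hx.ne'
      rw [orderLaw, Measure.add_apply, Measure.smul_apply, Measure.smul_apply,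
        Measure.map_apply measurable_inr hB, preimage_image_eq _ Sum.inr_injective]
      simp [h2]
    -- from any level, an ask below `x` leads to the next lower level
    have step : ∀ j : ℕ, ∀ᵐ ω ∂μ,
        (∃ᶠ n in atTop, (bookAfter (fun i => o i ω) n).bidCount (Ici x) ≤ j + 1) →
        ∃ᶠ n in atTop, (bookAfter (fun i => o i ω) n).bidCount (Ici x) ≤ j := by
      intro j
      have hA : ∀ n, MeasurableSet[pastFiltration o h.measurable_order n]
          {ω | (bookAfter (fun i => o i ω) n).bidCount (Ici x) ≤ j + 1} := fun n =>
        measurableSet_le ((Book.measurable_bidCount measurableSet_Ici).comp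
          (measurable_bookAfter_past h.measurable_order n)) measurable_const
      filter_upwards [h.ae_frequently_and hA hB hpos] with ω hω hf
      have h2 := hω hf
      rw [frequently_atTop] at h2 ⊢
      intro N
      obtain ⟨n, hn, h3, p, hp, h4⟩ := h2 N
      refine ⟨n + 1, by omega, ?_⟩
      rw [bookAfter, ← h4]
      exact Book.bidCount_arrive_ask_le hp j.cast_nonneg h3
    have h2 : ∀ᵐ ω ∂μ,
        ¬ Tendsto (fun n => (bookAfter (fun i => o i ω) n).bidCount (Ici x)) atTop atTop := by
      rw [ae_iff]
      simpa using h0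
    filter_upwards [h2, ae_all_iff.2 step] with ω h3 h4
    have h5 : ∃ K : ℕ, ∃ᶠ n in atTop, (bookAfter (fun i => o i ω) n).bidCount (Ici x) ≤ K := by
      rw [tendsto_atTop] at h3
      push Not at h3
      obtain ⟨b, hb⟩ := h3
      obtain ⟨K, hK⟩ := exists_nat_ge b
      exact ⟨K, hb.mono fun n hn => hn.le.trans hK⟩
    have h6 : ∃ᶠ n in atTop, (bookAfter (fun i => o i ω) n).bidCount (Ici x) ≤ (0 : ℕ) := by
      obtain ⟨K, hK⟩ := h5
      induction K with
      | zero => exact hK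
      | succ K ih => exact ih (h4 K (by exact_mod_cast hK))
    refine h6.mono fun n hn => ?_
    rw [Book.bestBid_lt_iff_bidCount]
    exact le_antisymm (by simpa using hn) (Book.bidCount_nonneg _ _)
  · left
    have h2 : ∀ᵐ ω ∂μ,
        Tendsto (fun n => (bookAfter (fun i => o i ω) n).bidCount (Ici x)) atTop atTop := by
      rw [ae_iff, ← compl_ofPred, prob_compl_eq_zero_iff₀]
      · exact h1
      · refine (measurableSet_tendsto _ fun n => ?_).nullMeasurableSet
        exact (Book.measurable_bidCount measurableSet_Ici).comp
          (Book.measurable_bookAfter fun i _ => h.measurable_order i)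
    filter_upwards [h2] with ω hω
    filter_upwards [hω.eventually_gt_atTop 0] with n hn
    by_contra hcon
    exact hn.ne' (Book.bestBid_lt_iff_bidCount.1 (not_le.1 hcon))

theorem askEscapes_or_askRecurrent [IsProbabilityMeasure μ] (hfb : IsPriceDensity fb)
    (hfa : IsPriceDensity fa) {x : ℝ} (hx : priceCDF fb x < 1) :
    AskEscapes μ o x ∨ AskRecurrent μ o x := by
  have h1 := (h.mirror hfb hfa).bidEscapes_or_bidRecurrent hfb.comp_neg (x := -x)
    (by rw [hfb.cdf_comp_neg, neg_neg]; linarith)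
  rwa [bidEscapes_mirror, bidRecurrent_mirror, neg_neg] at h1

end IsOrderFlow

/-! ### Drift of the value of the book -/

open Classical in
/-- Twice the expected gain from an arriving bid of density `fb` when the lowest ask is at `α`.
Reflected arguments give the expected gain from an arriving ask. -/
noncomputable def bidDrift (fb wb wa : ℝ → ℝ) (α : EReal) : ℝ :=
  ∫ q, fb q * (if α < (q : EReal) then -wa α.toReal else wb q)

section Drift

variable {fb wb wa : ℝ → ℝ}

lemma bidDrift_top : bidDrift fb wb wa ⊤ = ∫ q, fb q * wb q := by
  simp [bidDrift]

lemma IsPriceDensity.integrable_mul {w : ℝ → ℝ} (hfb : IsPriceDensity fb) (hw : Measurable w)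
    {C : ℝ} (hC : ∀ x, |w x| ≤ C) : Integrable fun x => fb x * w x :=
  hfb.integrable.mul_bdd hw.aestronglyMeasurable (ae_of_all _ hC)

lemma bidDrift_coe (hfb : IsPriceDensity fb) (hw : Measurable wb) {C : ℝ}
    (hC : ∀ x, |wb x| ≤ C) (α : ℝ) :
    bidDrift fb wb wa α = (∫ q in Iic α, fb q * wb q) - wa α * (1 - priceCDF fb α) := by
  have h : ∀ q, fb q * (if (α : EReal) < (q : EReal) then -wa (α : EReal).toReal else wb q) =
      (Iic α).indicator (fun q => fb q * wb q) q + (Ioi α).indicator (fun q => fb q * -wa α) q := by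
    intro q
    rcases le_or_gt q α with hq | hq
    · simp [hq, not_lt.2 hq]
    · simp [hq, not_le.2 hq]
  unfold bidDrift
  simp_rw [h]
  rw [integral_add ((hfb.integrable_mul hw hC).indicator measurableSet_Iic)
    ((hfb.integrable.mul_const _).indicator measurableSet_Ioi), integral_indicator measurableSet_Iic,
    integral_indicator measurableSet_Ioi, integral_mul_const, hfb.integral_Ioi]
  ring

end Drift

variable {Ω : Type*} [MeasurableSpace Ω] {μ : Measure Ω} {fb fa : ℝ → ℝ} {τ : ℕ → Ω → ℝ}
  {o : ℕ → Ω → Arrival}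

/-- The expected gain splits into the contributions of bids and asks; the latter is expressed by
`bidDrift` through reflection. -/
lemma integral_gain (hfb : IsPriceDensity fb) (hfa : IsPriceDensity fa) {wb wa : ℝ → ℝ}
    (hb : Measurable wb) (ha : Measurable wa) {C : ℝ} (hbC : ∀ x, |wb x| ≤ C)
    (haC : ∀ x, |wa x| ≤ C) (L : Book) :
    ∫ a, L.gain wb wa a ∂(orderLaw fb fa) = 2⁻¹ * (bidDrift fb wb wa L.bestAsk +
      bidDrift (fun x => fa (-x)) (fun x => wa (-x)) (fun x => wb (-x)) (-L.bestBid)) := by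
  have hm : Measurable fun a => L.gain wb wa a :=
    (Book.measurable_gain hb ha).comp measurable_prodMk_left
  rw [integral_orderLaw hfb hfa hm fun a => Book.abs_gain_le hbC haC L a]
  congr 2
  rw [bidDrift, ← integral_neg_eq_self]
  refine integral_congr_ae (ae_of_all _ fun p => ?_)
  simp only [Book.gain, EReal.toReal_neg_eq, neg_neg, EReal.coe_neg]
  have : -(p : EReal) < L.bestBid ↔ -L.bestBid < (p : EReal) := EReal.neg_lt_comm
  simp only [this]

/-! ### Frequencies -/

namespace IsOrderFlow

variable (h : IsOrderFlow μ fb fa τ o)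

include h in
/-- Up to `o(n)`, the value of the book is the sum of its expected increments. -/
lemma ae_tendsto_value_sub [IsProbabilityMeasure μ] {wb wa : ℝ → ℝ} (hb : Measurable wb)
    (ha : Measurable wa) {C : ℝ} (hbC : ∀ x, |wb x| ≤ C) (haC : ∀ x, |wa x| ≤ C) :
    ∀ᵐ ω ∂μ, Tendsto (fun n : ℕ => ((bookAfter (fun i => o i ω) n).value wb wa -
      ∑ i ∈ Finset.range n, ∫ a, (bookAfter (fun j => o j ω) i).gain wb wa a ∂(orderLaw fb fa)) / n)
      atTop (𝓝 0) := by
  filter_upwards [h.ae_tendsto_average (Book.measurable_gain hb ha) (C := C)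
    fun p => Book.abs_gain_le hbC haC p.1 p.2] with ω hω
  simpa only [Book.value_bookAfter, Finset.sum_sub_distrib] using hω

end IsOrderFlow

/-- The total worth of the first `n` arriving orders, when a bid at `x` is worth `wb x` and an ask
at `x` is worth `wa x`. -/
noncomputable def arrivalSum (wb wa : ℝ → ℝ) (o : ℕ → Arrival) (n : ℕ) : ℝ :=
  ∑ i ∈ Finset.range n, Sum.elim wb wa (o i)

lemma IsOrderFlow.ae_tendsto_arrivalSum [IsProbabilityMeasure μ] (h : IsOrderFlow μ fb fa τ o)
    (hfb : IsPriceDensity fb) (hfa : IsPriceDensity fa) {wb wa : ℝ → ℝ} (hb : Measurable wb)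
    (ha : Measurable wa) {C : ℝ} (hbC : ∀ x, |wb x| ≤ C) (haC : ∀ x, |wa x| ≤ C) :
    ∀ᵐ ω ∂μ, Tendsto (fun n : ℕ => arrivalSum wb wa (fun i => o i ω) n / n) atTop
      (𝓝 (2⁻¹ * ((∫ x, fb x * wb x) + ∫ x, fa x * wa x))) := by
  have hm : Measurable (Sum.elim wb wa : Arrival → ℝ) := Measurable.sumElim hb ha
  have hC : ∀ a, |(Sum.elim wb wa : Arrival → ℝ) a| ≤ C := by
    rintro (q | p)
    · exact hbC q
    · exact haC p
  filter_upwards [h.ae_tendsto_average (φ := fun p => Sum.elim wb wa p.2)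
    (hm.comp measurable_snd) (fun p => hC p.2)] with ω hω
  rw [integral_orderLaw hfb hfa hm hC] at hω
  have h2 := hω.add_const (2⁻¹ * ((∫ x, fb x * wb x) + ∫ x, fa x * wa x))
  rw [zero_add] at h2
  refine h2.congr' ?_
  filter_upwards [eventually_ne_atTop 0] with n hn
  simp only [Finset.sum_sub_distrib, Finset.sum_const, Finset.card_range, Sum.elim_inl,
    Sum.elim_inr, arrivalSum, nsmul_eq_mul]
  field_simp
  ring

lemma abs_indicator_one_le (s : Set ℝ) (x : ℝ) : |s.indicator (1 : ℝ → ℝ) x| ≤ 1 := by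
  by_cases hx : x ∈ s <;> simp [hx]

lemma integral_mul_indicator_one (f : ℝ → ℝ) {s : Set ℝ} (hs : MeasurableSet s) :
    ∫ x, f x * s.indicator (1 : ℝ → ℝ) x = ∫ x in s, f x := by
  rw [← integral_indicator hs]
  congr 1 with x
  by_cases hx : x ∈ s <;> simp [hx]

namespace Book

lemma bidCount_le_arrivalSum (s : Set ℝ) (o : ℕ → Arrival) (n : ℕ) :
    (bookAfter o n).bidCount s ≤ arrivalSum (s.indicator 1) 0 o n := by
  rw [bidCount, value_bookAfter, arrivalSum]
  refine Finset.sum_le_sum fun i _ => ?_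
  have h0 : ∀ x, 0 ≤ s.indicator (1 : ℝ → ℝ) x := fun x =>
    indicator_nonneg (fun _ _ => zero_le_one) _
  rcases o i with q | p <;> simp only [gain, Sum.elim_inl, Sum.elim_inr] <;> split_ifs <;>
    simp [h0]

lemma bidCount_sub_askCount (o : ℕ → Arrival) (n : ℕ) :
    (bookAfter o n).bidCount univ - (bookAfter o n).askCount univ =
      arrivalSum 1 (-1) o n := by
  have h1 : (bookAfter o n).bidCount univ - (bookAfter o n).askCount univ =
      (bookAfter o n).value 1 (-1) := by
    simp [bidCount, askCount, value, Multiset.map_const', sub_eq_add_neg]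
  rw [h1, value_bookAfter, arrivalSum]
  refine Finset.sum_congr rfl fun i _ => ?_
  rcases o i with q | p <;> simp only [gain, Sum.elim_inl, Sum.elim_inr] <;> split_ifs <;> simp

lemma bidCount_union {s t : Set ℝ} (hst : Disjoint s t) (L : Book) :
    L.bidCount (s ∪ t) = L.bidCount s + L.bidCount t := by
  rw [bidCount, bidCount, bidCount, ← value_add, indicator_union_of_disjoint hst]
  congr 1
  ext x
  simp

lemma askCount_union {s t : Set ℝ} (hst : Disjoint s t) (L : Book) :
    L.askCount (s ∪ t) = L.askCount s + L.askCount t := by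
  rw [askCount, askCount, askCount, ← value_add, indicator_union_of_disjoint hst]
  congr 1
  ext x
  simp

/-- Asks above `y` are permanent as long as the lowest ask is at most `y`. -/
lemma gain_asks_above {L : Book} {y : ℝ} (hy : L.bestAsk ≤ (y : EReal))
    (hL : L.bestBid ≤ L.bestAsk) (a : Arrival) :
    L.gain 0 ((Ioi y).indicator 1) a = Sum.elim (0 : ℝ → ℝ) ((Ioi y).indicator 1) a := by
  rcases a with q | p
  · simp only [gain, Sum.elim_inl]
    split_ifs
    · rw [indicator_of_notMem]
      · simp
      · rcases L.bestAsk_eq_top_or_mem with h | ⟨b, -, h⟩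
        · simp [h] at hy
        · rw [h] at hy ⊢
          simpa using hy
    · rfl
  · simp only [gain, Sum.elim_inr]
    split_ifs with hp
    · rw [indicator_of_notMem]
      · simp
      · have : p < y := by exact_mod_cast hp.trans_le (hL.trans hy)
        simp [this.le]
    · rfl

end Book

namespace IsOrderFlow

variable [IsProbabilityMeasure μ] (h : IsOrderFlow μ fb fa τ o) (hfb : IsPriceDensity fb)
  (hfa : IsPriceDensity fa)
include h hfb hfa

lemma ae_tendsto_bid_arrivals {s : Set ℝ} (hs : MeasurableSet s) :
    ∀ᵐ ω ∂μ, Tendsto (fun n : ℕ => arrivalSum (s.indicator 1) 0 (fun i => o i ω) n / n) atTop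
      (𝓝 (2⁻¹ * ∫ x in s, fb x)) := by
  have := h.ae_tendsto_arrivalSum hfb hfa (measurable_one.indicator hs) measurable_zero
    (abs_indicator_one_le s) (wa := 0) (by simp)
  simpa only [integral_mul_indicator_one _ hs, Pi.zero_apply, mul_zero, integral_zero, add_zero]
    using this

/-- The difference between the numbers of bids and asks in the book is that between the numbers of
arrived bids and asks, because every execution removes one of each; hence it is `o(n)`. -/
lemma ae_tendsto_imbalance :
    ∀ᵐ ω ∂μ, Tendsto (fun n : ℕ => ((bookAfter (fun i => o i ω) n).bidCount univ -
      (bookAfter (fun i => o i ω) n).askCount univ) / n) atTop (𝓝 0) := by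
  have := h.ae_tendsto_arrivalSum hfb hfa (wb := 1) (wa := -1) measurable_one
    measurable_one.neg (C := 1) (by simp) (by simp)
  simpa [Book.bidCount_sub_askCount, integral_neg, hfb.integral_eq_one, hfa.integral_eq_one]
    using this

/-- If the lowest ask is eventually at most `y`, then all but finitely many arriving asks above `y`
stay in the book. -/
lemma ae_tendsto_asks_above {y : ℝ} (hy : AskEscapes μ o y) :
    ∀ᵐ ω ∂μ, Tendsto (fun n : ℕ => (bookAfter (fun i => o i ω) n).askCount (Ioi y) / n) atTop
      (𝓝 (2⁻¹ * (1 - priceCDF fa y))) := by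
  have h1 := h.ae_tendsto_arrivalSum hfb hfa (wb := 0) (wa := (Ioi y).indicator 1)
    measurable_zero (measurable_one.indicator measurableSet_Ioi) (by simp) (abs_indicator_one_le _)
  simp only [integral_mul_indicator_one _ measurableSet_Ioi, hfa.integral_Ioi, Pi.zero_apply,
    mul_zero, integral_zero, zero_add] at h1
  filter_upwards [h1, hy] with ω h2 h3
  obtain ⟨N, hN⟩ := eventually_atTop.1 h3
  set D : ℕ → ℝ := fun n => (bookAfter (fun i => o i ω) n).askCount (Ioi y) -
    arrivalSum 0 ((Ioi y).indicator 1) (fun i => o i ω) n with hD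
  have hc : ∀ n ≥ N, D n = D N := by
    intro n hn
    induction n, hn using Nat.le_induction with
    | base => rfl
    | succ n hn ih =>
      rw [← ih, hD]
      simp only [bookAfter, Book.askCount, Book.value_arrive, arrivalSum, Finset.sum_range_succ]
      rw [Book.gain_asks_above (hN n hn) (Book.bestBid_le_bestAsk_bookAfter _ n)]
      ring
  have h4 : Tendsto (fun n : ℕ => D N / n) atTop (𝓝 0) := tendsto_const_div_atTop_nhds_zero_nat _
  have h5 := h2.add h4
  rw [add_zero] at h5
  refine h5.congr' ?_
  filter_upwards [eventually_ge_atTop N] with n hn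
  rw [← hc n hn, ← add_div]
  simp [hD]

/-- If all bids at or above `x` disappear infinitely often, then there is room only for asks that
balance the bids below `x`. -/
lemma one_sub_cdf_le {x y : ℝ} (hx : BidRecurrent μ o x) (hy : AskEscapes μ o y) :
    1 - priceCDF fa y ≤ priceCDF fb x := by
  have h1 := h.ae_tendsto_bid_arrivals hfb hfa (s := Iio x) measurableSet_Iio
  rw [← integral_Iic_eq_integral_Iio] at h1
  obtain ⟨ω, ⟨h2, h3⟩, h4, h5⟩ := ((h1.and (h.ae_tendsto_imbalance hfb hfa)).and
    ((h.ae_tendsto_asks_above hfb hfa hy).and hx)).exists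
  have h6 := h2.sub h3
  rw [sub_zero] at h6
  have h7 := le_of_tendsto_of_tendsto_of_frequently h4 h6 (h5.mono fun n hn => ?_)
  · change _ ≤ 2⁻¹ * priceCDF fb x at h7
    linarith
  · rw [← sub_div]
    refine div_le_div_of_nonneg_right ?_ n.cast_nonneg
    have e1 := Book.bidCount_union (disjoint_left.2 fun z (hz : z < x) hz' => not_le.2 hz hz')
      (bookAfter (fun i => o i ω) n) (s := Iio x) (t := Ici x)
    have e2 := Book.askCount_union (disjoint_left.2 fun z (hz : z ≤ y) hz' => not_lt.2 hz hz')
      (bookAfter (fun i => o i ω) n) (s := Iic y) (t := Ioi y)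
    rw [Iio_union_Ici, Book.bestBid_lt_iff_bidCount.1 hn] at e1
    rw [Iic_union_Ioi] at e2
    linarith [Book.bidCount_le_arrivalSum (Iio x) (fun i => o i ω) n,
      Book.askCount_nonneg (Iic y) (bookAfter (fun i => o i ω) n)]

lemma cdf_le_one_sub {x y : ℝ} (hx : BidEscapes μ o x) (hy : AskRecurrent μ o y) :
    priceCDF fb x ≤ 1 - priceCDF fa y := by
  have h1 := (h.mirror hfb hfa).one_sub_cdf_le hfa.comp_neg hfb.comp_neg (x := -y) (y := -x)
    (by rwa [bidRecurrent_mirror, neg_neg]) (by rwa [askEscapes_mirror, neg_neg])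
  rwa [hfb.cdf_comp_neg, hfa.cdf_comp_neg, neg_neg, neg_neg, sub_sub_cancel] at h1

end IsOrderFlow

/-! ### Finite thresholds form a vanishing pair -/

lemma Book.abs_value_le {wb wa : ℝ → ℝ} {s t : Set ℝ} {C : ℝ}
    (hb : ∀ x, |wb x| ≤ C * s.indicator 1 x) (ha : ∀ x, |wa x| ≤ C * t.indicator 1 x)
    (L : Book) : |L.value wb wa| ≤ C * (L.bidCount s + L.askCount t) := by
  have e : C * (L.bidCount s + L.askCount t) =
      L.value (fun x => C * s.indicator 1 x) (fun x => C * t.indicator 1 x) := by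
    rw [value_mul, bidCount, askCount, ← value_add]
    simp
  have e' : -(C * (L.bidCount s + L.askCount t)) =
      L.value (fun x => -1 * (C * s.indicator 1 x)) (fun x => -1 * (C * t.indicator 1 x)) := by
    rw [e, ← neg_one_mul, ← value_mul]
  rw [abs_le]
  constructor
  · rw [e']
    exact value_mono (fun x => by linarith [abs_le.1 (hb x)]) (fun x => by
      linarith [abs_le.1 (ha x)]) L
  · rw [e]
    exact value_mono (fun x => (abs_le.1 (hb x)).2) (fun x => (abs_le.1 (ha x)).2) L

section

variable {Ω : Type*} [MeasurableSpace Ω] {μ : Measure Ω} {fb fa : ℝ → ℝ} {τ : ℕ → Ω → ℝ}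
  {o : ℕ → Ω → Arrival}

/-- If the value of the book has a constant drift `m` while the best prices stay between `x` and
`y`, then `m` is small: the value is of order `m n`, but infinitely often there are few bids and
asks between `x` and `y`. -/
lemma IsOrderFlow.abs_drift_le [IsProbabilityMeasure μ] (h : IsOrderFlow μ fb fa τ o)
    (hfb : IsPriceDensity fb) (hfa : IsPriceDensity fa) {x x' y : ℝ} (hx : BidEscapes μ o x)
    (hy : AskEscapes μ o y) (hx' : BidRecurrent μ o x') (hxx' : x ≤ x') {wb wa : ℝ → ℝ}
    (hbm : Measurable wb) (ham : Measurable wa) {C : ℝ}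
    (hb : ∀ z, |wb z| ≤ C * (Ici x).indicator 1 z) (ha : ∀ z, |wa z| ≤ C * (Iic y).indicator 1 z)
    {m : ℝ} (hm : ∀ L : Book, (x : EReal) ≤ L.bestBid → L.bestBid ≤ L.bestAsk →
      L.bestAsk ≤ (y : EReal) → ∫ a, L.gain wb wa a ∂(orderLaw fb fa) = m) :
    |m| ≤ C * (2⁻¹ * (priceCDF fb x' - priceCDF fb x) +
      2⁻¹ * (priceCDF fb x' - (1 - priceCDF fa y))) := by
  have hC : 0 ≤ C := by
    have := (abs_nonneg _).trans (hb x)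
    simpa using this
  have hbC : ∀ z, |wb z| ≤ C := fun z => (hb z).trans (mul_le_of_le_one_right hC
    ((le_abs_self _).trans (abs_indicator_one_le _ _)))
  have haC : ∀ z, |wa z| ≤ C := fun z => (ha z).trans (mul_le_of_le_one_right hC
    ((le_abs_self _).trans (abs_indicator_one_le _ _)))
  have h1 := h.ae_tendsto_bid_arrivals hfb hfa (s := Iio x') measurableSet_Iio
  have h2 := h.ae_tendsto_bid_arrivals hfb hfa (s := Ico x x') measurableSet_Ico
  rw [← integral_Iic_eq_integral_Iio] at h1
  rw [integral_Ico_eq_integral_Ioc, ← intervalIntegral.integral_of_le hxx', ← hfb.cdf_sub] at h2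
  obtain ⟨ω, ⟨⟨g1, g2⟩, g3, g4⟩, ⟨g5, g6⟩, g7, g8⟩ :=
    (((h1.and h2).and ((h.ae_tendsto_imbalance hfb hfa).and
      (h.ae_tendsto_asks_above hfb hfa hy))).and ((hx.and hy).and
      (hx'.and (h.ae_tendsto_value_sub hbm ham hbC haC)))).exists
  set L : ℕ → Book := fun n => bookAfter (fun i => o i ω) n
  have g9 : Tendsto (fun n : ℕ => (n : ℝ)⁻¹ * ∑ i ∈ Finset.range n,
      ∫ a, (L i).gain wb wa a ∂(orderLaw fb fa)) atTop (𝓝 m) := by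
    refine Filter.Tendsto.cesaro (tendsto_const_nhds.congr' ?_)
    filter_upwards [g5, g6] with n hn1 hn2
    exact (hm _ hn1 (Book.bestBid_le_bestAsk_bookAfter _ n) hn2).symm
  have g10 : Tendsto (fun n : ℕ => |(L n).value wb wa / n|) atTop (𝓝 |m|) := by
    have := (g8.add g9).abs
    rw [zero_add] at this
    refine this.congr fun n => ?_
    congr 1
    ring
  have g11 := ((g2.add (g1.sub (g3.add g4))).const_mul C)
  have key := le_of_tendsto_of_tendsto_of_frequently g10 g11 (g7.mono fun n hn => ?_)
  · refine key.trans (le_of_eq ?_)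
    rw [priceCDF]
    ring
  · have e1 := Book.bidCount_union (s := Ico x x') (t := Ici x')
      (disjoint_left.2 fun z hz hz' => not_le.2 hz.2 hz') (L n)
    have e2 := Book.bidCount_union (s := Iio x') (t := Ici x')
      (disjoint_left.2 fun z (hz : z < x') hz' => not_le.2 hz hz') (L n)
    have e3 := Book.askCount_union (s := Iic y) (t := Ioi y)
      (disjoint_left.2 fun z (hz : z ≤ y) hz' => not_lt.2 hz hz') (L n)
    rw [Book.bestBid_lt_iff_bidCount.1 hn] at e1 e2
    rw [Ico_union_Ici_eq_Ici hxx'] at e1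
    rw [Iio_union_Ici] at e2
    rw [Iic_union_Ioi] at e3
    have e4 := Book.bidCount_le_arrivalSum (Iio x') (fun i => o i ω) n
    have e5 := Book.bidCount_le_arrivalSum (Ico x x') (fun i => o i ω) n
    rw [abs_div, Nat.abs_cast, ← add_div, ← sub_div, ← add_div, ← mul_div_assoc]
    refine div_le_div_of_nonneg_right ?_ n.cast_nonneg
    refine (Book.abs_value_le hb ha (L n)).trans (mul_le_mul_of_nonneg_left ?_ hC)
    simp only [L] at *
    linarith

/-- With the weights `ϖ = u / F_a` for bids and `q / (1 - F_b)` for asks between `x` and `y`, the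
drift of the value of the book is constant while the best prices stay between `x` and `y`. -/
lemma SolvesAt.integral_gain_eq {c : ℝ} {u q : ℝ → ℝ} (hs : SolvesAt fb fa c u q)
    (hfb : IsPriceDensity fb) (hfa : IsPriceDensity fa) {x y C : ℝ} (hx : x ∈ priceRange fb fa)
    (hy : y ∈ priceRange fb fa)
    {wb wa : ℝ → ℝ} (hbm : Measurable wb) (ham : Measurable wa)
    (hwb : wb = (Icc x y).indicator fun z => u z / priceCDF fa z)
    (hwa : wa = (Icc x y).indicator fun z => q z / (1 - priceCDF fb z))
    (hb : ∀ z, |wb z| ≤ C) (ha : ∀ z, |wa z| ≤ C) {L : Book} (hL1 : (x : EReal) ≤ L.bestBid)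
    (hL2 : L.bestBid ≤ L.bestAsk) (hL3 : L.bestAsk ≤ (y : EReal)) :
    ∫ a, L.gain wb wa a ∂(orderLaw fb fa) = -(2⁻¹ * (q x + u y)) := by
  have ho := ordConnected_priceRange hfb hfa
  obtain ⟨β, hβ⟩ : ∃ β : ℝ, L.bestBid = β := by
    rcases L.bestBid_eq_bot_or_mem with h | ⟨b, -, h⟩
    · simp [h] at hL1
    · exact ⟨b, h⟩
  obtain ⟨α, hα⟩ : ∃ α : ℝ, L.bestAsk = α := by
    rcases L.bestAsk_eq_top_or_mem with h | ⟨b, -, h⟩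
    · simp [h] at hL3
    · exact ⟨b, h⟩
  rw [hβ] at hL1 hL2
  rw [hα] at hL2 hL3
  rw [EReal.coe_le_coe_iff] at hL1 hL2 hL3
  have hαI : α ∈ priceRange fb fa := ho.out hx hy ⟨hL1.trans hL2, hL3⟩
  have hβI : β ∈ priceRange fb fa := ho.out hx hy ⟨hL1, hL2.trans hL3⟩
  have e1 : bidDrift fb wb wa L.bestAsk = -q x := by
    rw [hα, bidDrift_coe hfb hbm hb, hwa, indicator_of_mem (mem_Icc.2 ⟨hL1.trans hL2, hL3⟩),
      div_mul_cancel₀ _ (sub_pos.2 hαI.2).ne']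
    have : ∫ z in Iic α, fb z * wb z = q α - q x := by
      rw [← hs.system.2.integral_eq_sub ho hx hαI,
        intervalIntegral.integral_of_le (hL1.trans hL2), ← integral_Icc_eq_integral_Ioc,
        ← integral_indicator measurableSet_Iic, ← integral_indicator measurableSet_Icc]
      congr 1 with z
      rw [hwb]
      by_cases hz : z ≤ α
      · by_cases hz' : x ≤ z
        · simp [indicator, hz, hz', hz.trans hL3]
          ring
        · simp [indicator, hz']
      · simp [indicator, hz]
    rw [this]
    ring
  have e2 : bidDrift (fun z => fa (-z)) (fun z => wa (-z)) (fun z => wb (-z)) (-L.bestBid) =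
      -u y := by
    rw [hβ, ← EReal.coe_neg, bidDrift_coe hfa.comp_neg (wb := fun z => wa (-z))
      (ham.comp measurable_neg) (fun z => ha (-z)), hfa.cdf_comp_neg,
      integral_comp_neg_Iic (-β) fun z => fa z * wa z]
    simp only [neg_neg]
    rw [hwb, indicator_of_mem (mem_Icc.2 ⟨hL1, hL2.trans hL3⟩), sub_sub_cancel,
      div_mul_cancel₀ _ hβI.1.ne']
    have : ∫ z in Ioi β, fa z * wa z = u β - u y := by
      rw [← neg_sub, ← hs.system.1.integral_eq_sub ho hβI hy,
        ← intervalIntegral.integral_neg, intervalIntegral.integral_of_le (hL2.trans hL3),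
        ← integral_indicator measurableSet_Ioi, ← integral_indicator measurableSet_Ioc]
      congr 1 with z
      rw [hwa]
      by_cases hz : β < z
      · by_cases hz' : z ≤ y
        · simp [indicator, hz, hz', hL1.trans hz.le]
          ring
        · simp [indicator, hz']
      · simp [indicator, hz]
    rw [this]
    ring
  rw [integral_gain hfb hfa hbm ham hb ha, e1, e2]
  ring

namespace IsFiniteThresholds

variable {κb κa : ℝ} (hκ : IsFiniteThresholds μ fb fa τ o κb κa) (h : IsOrderFlow μ fb fa τ o)
include hκ h

lemma bidRecurrent {x : ℝ} (hx : κb < x) : BidRecurrent μ o x := by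
  have h1 := hκ.bid_eq
  rw [h.bidThreshold_eq] at h1
  have h2 : sInf ((fun x : ℝ => (x : EReal)) '' {x | BidRecurrent μ o x}) < (x : EReal) := by
    rw [h1]; exact_mod_cast hx
  obtain ⟨_, ⟨z, hz, rfl⟩, hzx⟩ := sInf_lt_iff.1 h2
  exact BidRecurrent.mono hz (EReal.coe_le_coe_iff.1 hzx.le)

lemma askRecurrent {x : ℝ} (hx : x < κa) : AskRecurrent μ o x := by
  have h1 := hκ.ask_eq
  rw [h.askThreshold_eq] at h1
  have h2 : (x : EReal) < sSup ((fun x : ℝ => (x : EReal)) '' {x | AskRecurrent μ o x}) := by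
    rw [h1]; exact_mod_cast hx
  obtain ⟨_, ⟨z, hz, rfl⟩, hzx⟩ := lt_sSup_iff.1 h2
  exact AskRecurrent.mono hz (EReal.coe_le_coe_iff.1 hzx.le)

lemma bidEscapes [IsProbabilityMeasure μ] (hfa : IsPriceDensity fa) {x : ℝ} (hx : x < κb)
    (hFx : 0 < priceCDF fa x) : BidEscapes μ o x := by
  refine (h.bidEscapes_or_bidRecurrent hfa hFx).resolve_right fun hr => ?_
  have h1 := hκ.bid_eq
  rw [h.bidThreshold_eq] at h1
  have h2 : (κb : EReal) ≤ x := h1 ▸ sInf_le ⟨x, hr, rfl⟩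
  exact hx.not_ge (by exact_mod_cast h2)

lemma askEscapes [IsProbabilityMeasure μ] (hfb : IsPriceDensity fb) (hfa : IsPriceDensity fa)
    {x : ℝ} (hx : κa < x) (hFx : priceCDF fb x < 1) : AskEscapes μ o x := by
  refine (h.askEscapes_or_askRecurrent hfb hfa hFx).resolve_right fun hr => ?_
  have h1 := hκ.ask_eq
  rw [h.askThreshold_eq] at h1
  have h2 : (x : EReal) ≤ κa := h1 ▸ le_sSup ⟨x, hr, rfl⟩
  exact hx.not_ge (by exact_mod_cast h2)

end IsFiniteThresholds

lemma le_of_bidEscapes_of_askEscapes [IsProbabilityMeasure μ] {x y : ℝ} (hx : BidEscapes μ o x)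
    (hy : AskEscapes μ o y) : x ≤ y := by
  obtain ⟨ω, h1, h2⟩ := (hx.and hy).exists
  obtain ⟨n, h3, h4⟩ := (h1.and h2).exists
  have := (h3.trans (Book.bestBid_le_bestAsk_bookAfter _ n)).trans h4
  exact_mod_cast this

lemma measurable_indicator_Icc_of_continuousOn {f : ℝ → ℝ} {x y : ℝ}
    (hf : ContinuousOn f (Icc x y)) : Measurable ((Icc x y).indicator f) := by
  classical
  rw [← piecewise_eq_indicator]
  exact hf.measurable_piecewise continuousOn_const measurableSet_Icc

/-- Finite thresholds form a vanishing pair. The frequencies of bids and asks give the balance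
`F_b(κ_b) = 1 - F_a(κ_a)`. The weights of `SolvesAt.integral_gain_eq` on
`[κ_b - δ, κ_a + δ]` give the drift `-(q(κ_b - δ) + u(κ_a + δ)) / 2`, which is small by
`IsOrderFlow.abs_drift_le`; as `δ` tends to `0`, this yields `u(κ_a) = -q(κ_b) = 0`. -/
theorem IsFiniteThresholds.lt_and_isVanishingPair [IsProbabilityMeasure μ] {κb κa : ℝ}
    (hκ : IsFiniteThresholds μ fb fa τ o κb κa) (h : IsOrderFlow μ fb fa τ o)
    (hfb : IsPriceDensity fb) (hfa : IsPriceDensity fa) (hba : priceLaw fb ≪ priceLaw fa)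
    (hab : priceLaw fa ≪ priceLaw fb) : κb < κa ∧ IsVanishingPair fb fa κb κa := by
  have hFab : 0 < priceCDF fa κb := cdf_pos_of_ac hfb hfa hba hκ.bid_pos
  have hFba : priceCDF fb κa < 1 := cdf_lt_one_of_ac hfa hfb hab hκ.ask_lt_one
  -- all levels `κb - δ`, `κb + δ`, `κa - δ`, `κa + δ` for small positive `δ`
  have hsub0 : ∀ a : ℝ, Tendsto (fun δ : ℝ => a - δ) (𝓝[>] 0) (𝓝 a) := fun a => by
    have : Tendsto (fun δ : ℝ => a - δ) (𝓝 0) (𝓝 (a - 0)) :=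
      (continuous_const.sub continuous_id).tendsto 0
    rw [sub_zero] at this
    exact this.mono_left nhdsWithin_le_nhds
  have hadd0 : ∀ a : ℝ, Tendsto (fun δ : ℝ => a + δ) (𝓝[>] 0) (𝓝 a) := fun a => by
    have : Tendsto (fun δ : ℝ => a + δ) (𝓝 0) (𝓝 (a + 0)) :=
      (continuous_const.add continuous_id).tendsto 0
    rw [add_zero] at this
    exact this.mono_left nhdsWithin_le_nhds
  have c1 := hsub0 κb
  have c2 := hadd0 κb
  have c3 := hsub0 κa
  have c4 := hadd0 κa
  have d1 := (hfa.continuous_cdf.tendsto κb).comp c1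
  have d1' := (hfb.continuous_cdf.tendsto κb).comp c1
  have d2 := (hfb.continuous_cdf.tendsto κb).comp c2
  have d3 := (hfa.continuous_cdf.tendsto κa).comp c3
  have d4 := (hfb.continuous_cdf.tendsto κa).comp c4
  have d4' := (hfa.continuous_cdf.tendsto κa).comp c4
  have hpos : ∀ᶠ δ : ℝ in 𝓝[>] 0, 0 < δ := eventually_mem_nhdsWithin
  have b1 : ∀ᶠ δ in 𝓝[>] 0, BidEscapes μ o (κb - δ) := by
    filter_upwards [hpos, d1.eventually_const_lt hFab] with δ h0 h1
    exact hκ.bidEscapes h hfa (by linarith) h1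
  have b2 : ∀ᶠ δ in 𝓝[>] 0, BidRecurrent μ o (κb + δ) := by
    filter_upwards [hpos] with δ h0
    exact hκ.bidRecurrent h (by linarith)
  have b3 : ∀ᶠ δ in 𝓝[>] 0, AskRecurrent μ o (κa - δ) := by
    filter_upwards [hpos] with δ h0
    exact hκ.askRecurrent h (by linarith)
  have b4 : ∀ᶠ δ in 𝓝[>] 0, AskEscapes μ o (κa + δ) := by
    filter_upwards [hpos, d4.eventually_lt_const hFba] with δ h0 h1
    exact hκ.askEscapes h hfb hfa (by linarith) h1
  have hle : κb ≤ κa := le_of_tendsto_of_tendsto c1 c4 (by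
    filter_upwards [b1, b4] with δ h1 h4 using le_of_bidEscapes_of_askEscapes h1 h4)
  have hbal : priceCDF fb κb = 1 - priceCDF fa κa := by
    refine le_antisymm ?_ ?_
    · refine le_of_tendsto_of_tendsto d1' (d3.const_sub 1) ?_
      filter_upwards [b1, b3] with δ h1 h3 using h.cdf_le_one_sub hfb hfa h1 h3
    · refine le_of_tendsto_of_tendsto (d4'.const_sub 1) d2 ?_
      filter_upwards [b2, b4] with δ h2 h4 using h.one_sub_cdf_le hfb hfa h2 h4
  have hκbI : κb ∈ priceRange fb fa := ⟨hFab, (hfb.monotone_cdf hle).trans_lt hFba⟩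
  have hκaI : κa ∈ priceRange fb fa := ⟨hFab.trans_le (hfa.monotone_cdf hle), hFba⟩
  have ho := isOpen_priceRange hfb hfa
  have hoc := ordConnected_priceRange hfb hfa
  obtain ⟨u, q, hs⟩ := exists_solvesAt hfb hfa hκbI
  have hqc : ContinuousOn q (priceRange fb fa) := hs.system.2.continuousOn ho
  have huc : ContinuousOn u (priceRange fb fa) := hs.system.1.continuousOn ho
  have hwb : ContinuousOn (fun z => u z / priceCDF fa z) (priceRange fb fa) :=
    huc.div hfa.continuous_cdf.continuousOn fun z hz => hz.1.ne'
  have hwa : ContinuousOn (fun z => q z / (1 - priceCDF fb z)) (priceRange fb fa) :=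
    hqc.div (continuous_const.sub hfb.continuous_cdf).continuousOn
      fun z hz => (sub_pos.2 hz.2).ne'
  have r1 := c1.eventually (ho.mem_nhds hκbI)
  have r4 := c4.eventually (ho.mem_nhds hκaI)
  obtain ⟨δ₀, ⟨hδ₀, hδ₁⟩, hδ₂⟩ := ((hpos.and r1).and r4).exists
  have hsub : Icc (κb - δ₀) (κa + δ₀) ⊆ priceRange fb fa := hoc.out hδ₁ hδ₂
  obtain ⟨C₁, hC₁⟩ := isCompact_Icc.exists_bound_of_continuousOn (hwb.mono hsub)
  obtain ⟨C₂, hC₂⟩ := isCompact_Icc.exists_bound_of_continuousOn (hwa.mono hsub)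
  set C := max (max C₁ C₂) 0
  have hvanish : u κa = 0 := by
    have t1 : Tendsto (fun δ : ℝ => |-(2⁻¹ * (q (κb - δ) + u (κa + δ)))|) (𝓝[>] 0)
        (𝓝 |-(2⁻¹ * (q κb + u κa))|) :=
      (((((hqc.continuousAt (ho.mem_nhds hκbI)).tendsto.comp c1).add
        ((huc.continuousAt (ho.mem_nhds hκaI)).tendsto.comp c4)).const_mul _).neg).abs
    have t2 := (((d2.sub d1').const_mul 2⁻¹).add
      ((d2.sub (d4'.const_sub 1)).const_mul 2⁻¹)).const_mul C
    have key := le_of_tendsto_of_tendsto t1 t2 (by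
      filter_upwards [b1, b2, b4, r1, r4, hpos, nhdsWithin_le_nhds (Iio_mem_nhds hδ₀)]
        with δ e1 e2 e4 e5 e6 e7 e8
      have hsub' : Icc (κb - δ) (κa + δ) ⊆ Icc (κb - δ₀) (κa + δ₀) :=
        Icc_subset_Icc (by linarith [mem_Iio.1 e8]) (by linarith [mem_Iio.1 e8])
      set wb := (Icc (κb - δ) (κa + δ)).indicator fun z => u z / priceCDF fa z with hwbd
      set wa := (Icc (κb - δ) (κa + δ)).indicator fun z => q z / (1 - priceCDF fb z) with hwad
      have hbm : Measurable wb :=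
        measurable_indicator_Icc_of_continuousOn (hwb.mono (hsub'.trans hsub))
      have ham : Measurable wa :=
        measurable_indicator_Icc_of_continuousOn (hwa.mono (hsub'.trans hsub))
      have hb : ∀ z, |wb z| ≤ C * (Ici (κb - δ)).indicator 1 z := by
        intro z
        by_cases hz : z ∈ Icc (κb - δ) (κa + δ)
        · rw [hwbd, indicator_of_mem hz, indicator_of_mem (mem_Ici.2 hz.1), Pi.one_apply, mul_one]
          exact (hC₁ z (hsub' hz)).trans ((le_max_left _ _).trans (le_max_left _ _))
        · rw [hwbd, indicator_of_notMem hz, abs_zero]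
          exact mul_nonneg (le_max_right _ _) (indicator_nonneg (fun _ _ => zero_le_one) _)
      have ha : ∀ z, |wa z| ≤ C * (Iic (κa + δ)).indicator 1 z := by
        intro z
        by_cases hz : z ∈ Icc (κb - δ) (κa + δ)
        · rw [hwad, indicator_of_mem hz, indicator_of_mem (mem_Iic.2 hz.2), Pi.one_apply, mul_one]
          exact (hC₂ z (hsub' hz)).trans ((le_max_right _ _).trans (le_max_left _ _))
        · rw [hwad, indicator_of_notMem hz, abs_zero]
          exact mul_nonneg (le_max_right _ _) (indicator_nonneg (fun _ _ => zero_le_one) _)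
      have hbC : ∀ z, |wb z| ≤ C := fun z => (hb z).trans (mul_le_of_le_one_right
        (le_max_right _ _) ((le_abs_self _).trans (abs_indicator_one_le _ _)))
      have haC : ∀ z, |wa z| ≤ C := fun z => (ha z).trans (mul_le_of_le_one_right
        (le_max_right _ _) ((le_abs_self _).trans (abs_indicator_one_le _ _)))
      exact h.abs_drift_le hfb hfa e1 e4 e2 (by linarith) hbm ham hb ha fun L l1 l2 l3 =>
        hs.integral_gain_eq hfb hfa e5 e6 hbm ham hwbd hwad hbC haC l1 l2 l3)
    rw [hbal, sub_self, mul_zero, add_zero, mul_zero, hs.q_eq, zero_add] at key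
    have := abs_nonpos_iff.1 key
    linarith
  refine ⟨hle.lt_of_ne fun heq => ?_, hκbI, hbal, _, hs.isSolution hfb hfa, ?_⟩
  · rw [← heq, hs.u_eq] at hvanish
    exact one_ne_zero hvanish
  · have h1 := (hwb.continuousAt (ho.mem_nhds hκaI)).tendsto
    rw [hvanish, zero_div] at h1
    exact h1.mono_left nhdsWithin_le_nhds

end

/-! ### A sufficient condition for finite thresholds -/

/-- The step function with value `1` up to `x`, value `w` between `x` and `y`, and `0` above `y`. -/
noncomputable def bidWeight (x y w : ℝ) (z : ℝ) : ℝ :=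
  (1 - w) * (Iic x).indicator 1 z + w * (Iic y).indicator 1 z

/-- The mirror image of `bidWeight`: value `0` below `x`, `w` between `x` and `y`, `1` above `y`. -/
noncomputable def askWeight (x y w : ℝ) (z : ℝ) : ℝ :=
  (1 - w) * (Ici y).indicator 1 z + w * (Ici x).indicator 1 z

lemma bidWeight_neg (x y w z : ℝ) : bidWeight x y w (-z) = askWeight (-y) (-x) w z := by
  have : ∀ a : ℝ, (Iic a).indicator (1 : ℝ → ℝ) (-z) = (Ici (-a)).indicator 1 z := fun a => by
    simp only [indicator, mem_Iic, mem_Ici, neg_le, Pi.one_apply]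
  rw [bidWeight, askWeight, this, this]

lemma askWeight_neg (x y w z : ℝ) : askWeight x y w (-z) = bidWeight (-y) (-x) w z := by
  have h := bidWeight_neg (-y) (-x) w (-z)
  rw [neg_neg, neg_neg, neg_neg] at h
  exact h.symm

lemma measurable_bidWeight (x y w : ℝ) : Measurable (bidWeight x y w) :=
  ((measurable_one.indicator measurableSet_Iic).const_mul _).add
    ((measurable_one.indicator measurableSet_Iic).const_mul _)

lemma measurable_askWeight (x y w : ℝ) : Measurable (askWeight x y w) :=
  ((measurable_one.indicator measurableSet_Ici).const_mul _).add
    ((measurable_one.indicator measurableSet_Ici).const_mul _)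

lemma bidWeight_nonneg {x y w : ℝ} (hxy : x ≤ y) (hw : 0 ≤ w) (z : ℝ) : 0 ≤ bidWeight x y w z := by
  unfold bidWeight
  by_cases h1 : z ≤ x
  · simp [h1, h1.trans hxy]
  · by_cases h2 : z ≤ y <;> simp [h1, h2, hw]

lemma bidWeight_le {x y w : ℝ} (hxy : x ≤ y) (hw : 0 ≤ w) (z : ℝ) :
    bidWeight x y w z ≤ 1 + w := by
  unfold bidWeight
  by_cases h1 : z ≤ x
  · simp [h1, h1.trans hxy, hw]
  · by_cases h2 : z ≤ y
    · simp [h1, h2]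
    · simp only [h1, h2, indicator, mem_Iic, if_false]
      linarith

lemma abs_bidWeight_le {x y w : ℝ} (hxy : x ≤ y) (hw : 0 ≤ w) (z : ℝ) :
    |bidWeight x y w z| ≤ 1 + w := by
  rw [abs_of_nonneg (bidWeight_nonneg hxy hw z)]
  exact bidWeight_le hxy hw z

lemma abs_askWeight_le {x y w : ℝ} (hxy : x ≤ y) (hw : 0 ≤ w) (z : ℝ) :
    |askWeight x y w z| ≤ 1 + w := by
  have h := askWeight_neg x y w (-z)
  rw [neg_neg] at h
  rw [h]
  exact abs_bidWeight_le (neg_le_neg hxy) hw _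

section

variable {f : ℝ → ℝ} (hf : IsPriceDensity f)
include hf

lemma setIntegral_mul_bidWeight (x y w α : ℝ) :
    ∫ z in Iic α, f z * bidWeight x y w z =
      (1 - w) * priceCDF f (min α x) + w * priceCDF f (min α y) := by
  have e : ∀ z, f z * bidWeight x y w z =
      (1 - w) * (Iic x).indicator f z + w * (Iic y).indicator f z := fun z => by
    unfold bidWeight
    by_cases h1 : z ≤ x <;> by_cases h2 : z ≤ y <;> simp [h1, h2] <;> ring
  simp_rw [e]
  rw [integral_add, integral_const_mul, integral_const_mul, setIntegral_indicator measurableSet_Iic,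
    setIntegral_indicator measurableSet_Iic, Iic_inter_Iic, Iic_inter_Iic]
  · rfl
  · exact ((hf.integrable.indicator measurableSet_Iic).const_mul _).integrableOn
  · exact ((hf.integrable.indicator measurableSet_Iic).const_mul _).integrableOn

lemma integral_mul_bidWeight (x y w : ℝ) :
    ∫ z, f z * bidWeight x y w z = (1 - w) * priceCDF f x + w * priceCDF f y := by
  have e : ∀ z, f z * bidWeight x y w z =
      (1 - w) * (Iic x).indicator f z + w * (Iic y).indicator f z := fun z => by
    unfold bidWeight
    by_cases h1 : z ≤ x <;> by_cases h2 : z ≤ y <;> simp [h1, h2] <;> ring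
  simp_rw [e]
  rw [integral_add, integral_const_mul, integral_const_mul, integral_indicator measurableSet_Iic,
    integral_indicator measurableSet_Iic]
  · rfl
  · exact (hf.integrable.indicator measurableSet_Iic).const_mul _
  · exact (hf.integrable.indicator measurableSet_Iic).const_mul _

/-- The drift caused by bids is never negative, and it is bounded below by a positive constant
unless the lowest ask is below `x`. -/
lemma bidDrift_weights {x y w δ : ℝ} (hxy : x < y) (hw : 0 ≤ w) (hδ : 0 ≤ δ)
    (h1 : δ ≤ priceCDF f x - w * (1 - priceCDF f x))
    (h2 : δ ≤ priceCDF f x - (1 - priceCDF f y) + w * (priceCDF f y - priceCDF f x))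
    {α : EReal} (hα : α ≠ ⊥) :
    0 ≤ bidDrift f (bidWeight x y w) (askWeight x y w) α ∧
      ((x : EReal) ≤ α → δ ≤ bidDrift f (bidWeight x y w) (askWeight x y w) α) := by
  induction α with
  | bot => exact absurd rfl hα
  | top =>
    rw [bidDrift_top, integral_mul_bidWeight hf]
    have h3 : δ ≤ (1 - w) * priceCDF f x + w * priceCDF f y := by
      linarith [hf.cdf_le_one y]
    exact ⟨hδ.trans h3, fun _ => h3⟩
  | coe α =>
    rw [bidDrift_coe hf (measurable_bidWeight x y w) (abs_bidWeight_le hxy.le hw),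
      setIntegral_mul_bidWeight hf, EReal.coe_le_coe_iff]
    rcases lt_or_ge α x with hαx | hαx
    · have e : askWeight x y w α = 0 := by
        simp [askWeight, not_le.2 hαx, not_le.2 (hαx.trans hxy)]
      rw [e, min_eq_left hαx.le, min_eq_left (hαx.trans hxy).le]
      refine ⟨?_, fun hcon => absurd hαx (not_lt.2 hcon)⟩
      linarith [hf.cdf_nonneg α]
    · rcases lt_or_ge α y with hαy | hαy
      · have e : askWeight x y w α = w := by
          simp [askWeight, hαx, not_le.2 hαy]
        rw [e, min_eq_right hαx, min_eq_left hαy.le]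
        have h3 : δ ≤ (1 - w) * priceCDF f x + w * priceCDF f α - w * (1 - priceCDF f α) := by
          have := mul_le_mul_of_nonneg_left (hf.monotone_cdf hαx) hw
          linarith
        exact ⟨hδ.trans h3, fun _ => h3⟩
      · have e : askWeight x y w α = 1 := by
          simp [askWeight, hαx, hαy]
        rw [e, min_eq_right hαx, min_eq_right hαy]
        have h3 : δ ≤ (1 - w) * priceCDF f x + w * priceCDF f y - 1 * (1 - priceCDF f α) := by
          linarith [hf.monotone_cdf hαy]
        exact ⟨hδ.trans h3, fun _ => h3⟩

end

/-- The weight in the middle bin that makes the drift of the value of the book positive. -/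
lemma exists_middle_weight {p r : ℝ} (hp0 : 0 ≤ p) (hp1 : p ≤ 1) (hpr : p ≤ r) (hr1 : r ≤ 1)
    (h : 1 - 2 * p * (1 - p) < r) :
    ∃ w δ : ℝ, 0 ≤ w ∧ 0 < δ ∧ δ ≤ p - w * (1 - p) ∧ δ ≤ p - (1 - r) + w * (r - p) := by
  set E := 2 * p * (1 - p) - (1 - r) with hE
  have hE0 : 0 < E := by linarith
  have hpp : 0 < p * (1 - p) := by nlinarith
  have hp : 0 < p := pos_of_mul_pos_left hpp (by linarith)
  have hq : 0 < 1 - p := pos_of_mul_pos_right hpp hp0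
  have hE1 : E ≤ 1 := by nlinarith [sq_nonneg (2 * p - 1)]
  -- `E / 2` is a margin below the critical weight `p / (1 - p)`
  set w := (1 - E / 2) * p / (1 - p) with hw
  have hwp : w * (1 - p) = (1 - E / 2) * p := div_mul_cancel₀ _ hq.ne'
  have h1 : 0 < p - w * (1 - p) := by
    rw [hwp]
    nlinarith
  have h2 : 0 < p - (1 - r) + w * (r - p) := by
    have h3 : (p - (1 - r) + w * (r - p)) * (1 - p) = E - E / 2 * (p * (r - p)) := by
      linear_combination (r - p) * hwp
    have h4 : p * (r - p) ≤ 1 := by nlinarith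
    have h5 : 0 < E - E / 2 * (p * (r - p)) := by nlinarith
    rw [← h3] at h5
    exact pos_of_mul_pos_left h5 hq.le
  exact ⟨w, min _ _, div_nonneg (mul_nonneg (by linarith) hp0) hq.le, lt_min h1 h2,
    min_le_left _ _, min_le_right _ _⟩

section

variable {Ω : Type*} [MeasurableSpace Ω] {μ : Measure Ω} [IsProbabilityMeasure μ] {fb fa : ℝ → ℝ}
  {τ : ℕ → Ω → ℝ} {o : ℕ → Ω → Arrival} (h : IsOrderFlow μ fb fa τ o) (hfb : IsPriceDensity fb)
  (hfa : IsPriceDensity fa)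
include h hfb hfa

/-- Under the condition on the two levels the number of orders in the book grows linearly, which
excludes that all bids above a very low level disappear infinitely often. -/
lemma IsOrderFlow.exists_pos_le_cdf {x y : ℝ} (hxy : x < y)
    (h1 : priceCDF fb x = 1 - priceCDF fa y) (h2 : priceCDF fb y = 1 - priceCDF fa x)
    (h3 : 1 - 2 * priceCDF fb x * (1 - priceCDF fb x) < priceCDF fb y) :
    ∃ ε > 0, ∀ z, BidRecurrent μ o z → ε ≤ priceCDF fb z := by
  obtain ⟨w, δ, hw, hδ, hd1, hd2⟩ := exists_middle_weight (hfb.cdf_nonneg x) (hfb.cdf_le_one x)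
    (hfb.monotone_cdf hxy.le) (hfb.cdf_le_one y) h3
  set wb := bidWeight x y w
  set wa := askWeight x y w
  have hbm : Measurable wb := measurable_bidWeight x y w
  have ham : Measurable wa := measurable_askWeight x y w
  have hbC : ∀ z, |wb z| ≤ 1 + w := abs_bidWeight_le hxy.le hw
  have haC : ∀ z, |wa z| ≤ 1 + w := abs_askWeight_le hxy.le hw
  have hdrift : ∀ L : Book, L.bestBid ≤ L.bestAsk →
      2⁻¹ * δ ≤ ∫ a, L.gain wb wa a ∂(orderLaw fb fa) := by
    intro L hL
    rw [integral_gain hfb hfa hbm ham hbC haC]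
    have ea : (fun z => wa (-z)) = bidWeight (-y) (-x) w := funext fun z => askWeight_neg x y w z
    have eb : (fun z => wb (-z)) = askWeight (-y) (-x) w := funext fun z => bidWeight_neg x y w z
    rw [ea, eb]
    have hα : L.bestAsk ≠ ⊥ := by
      rcases L.bestAsk_eq_top_or_mem with h | ⟨a, -, h⟩ <;> simp [h]
    have hβ : -L.bestBid ≠ ⊥ := by
      rcases L.bestBid_eq_bot_or_mem with h | ⟨b, -, h⟩
      · simp [h]
      · rw [h, ← EReal.coe_neg]; exact EReal.coe_ne_bot _
    have k1 := bidDrift_weights hfb hxy hw hδ.le hd1 hd2 hα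
    have k2 := bidDrift_weights hfa.comp_neg (neg_lt_neg hxy) hw hδ.le (δ := δ)
      (by rwa [hfa.cdf_comp_neg, neg_neg, ← h1])
      (by rwa [hfa.cdf_comp_neg, hfa.cdf_comp_neg, neg_neg, neg_neg, ← h1, ← h2]) hβ
    refine mul_le_mul_of_nonneg_left ?_ (by norm_num)
    rcases le_or_gt (x : EReal) L.bestAsk with hx | hx
    · linarith [k1.2 hx, k2.1]
    · have hy : ((-y : ℝ) : EReal) ≤ -L.bestBid := by
        rw [EReal.coe_neg, EReal.neg_le_neg_iff]
        exact (hL.trans hx.le).trans (by exact_mod_cast hxy.le)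
      linarith [k1.1, k2.2 hy]
  refine ⟨2⁻¹ * δ / (1 + w), by positivity, fun z hz => ?_⟩
  have g1 := h.ae_tendsto_bid_arrivals hfb hfa (s := Iio z) measurableSet_Iio
  rw [← integral_Iic_eq_integral_Iio] at g1
  obtain ⟨ω, ⟨g2, g3⟩, g4, g5⟩ := ((g1.and (h.ae_tendsto_imbalance hfb hfa)).and
    ((h.ae_tendsto_value_sub hbm ham hbC haC).and hz)).exists
  set L : ℕ → Book := fun n => bookAfter (fun i => o i ω) n
  have g6 := ((g2.const_mul 2).sub g3).const_mul (1 + w)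
  have key := le_of_tendsto_of_tendsto_of_frequently (g4.add_const (2⁻¹ * δ)) g6
    ((g5.and_eventually (eventually_gt_atTop 0)).mono fun n hn => ?_)
  · rw [zero_add, sub_zero] at key
    change _ ≤ (1 + w) * (2 * (2⁻¹ * priceCDF fb z)) at key
    rw [div_le_iff₀ (by positivity)]
    linarith
  · obtain ⟨hn, hn0⟩ := hn
    have hn0' : (0 : ℝ) < n := by exact_mod_cast hn0
    have e1 := Book.bidCount_union (s := Iio z) (t := Ici z)
      (disjoint_left.2 fun t (ht : t < z) ht' => not_le.2 ht ht') (L n)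
    rw [Book.bestBid_lt_iff_bidCount.1 hn, Iio_union_Ici, add_zero] at e1
    have e2 := Book.bidCount_le_arrivalSum (Iio z) (fun i => o i ω) n
    have e3 := (abs_le.1 (Book.abs_value_le (s := univ) (t := univ) (C := 1 + w)
      (fun z => by simpa using hbC z) (fun z => by simpa using haC z) (L n))).2
    have e4 : n * (2⁻¹ * δ) ≤
        ∑ i ∈ Finset.range n, ∫ a, (L i).gain wb wa a ∂(orderLaw fb fa) := by
      have := Finset.card_nsmul_le_sum (Finset.range n)
        (fun i => ∫ a, (L i).gain wb wa a ∂(orderLaw fb fa)) (2⁻¹ * δ)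
        fun i _ => hdrift _ (Book.bestBid_le_bestAsk_bookAfter _ i)
      simpa using this
    rw [← mul_div_assoc 2, ← sub_div, ← mul_div_assoc, ← le_sub_iff_add_le, ← sub_nonneg]
    have e5 : (1 + w) * ((L n).bidCount univ + (L n).askCount univ) ≤
        (1 + w) * (2 * arrivalSum ((Iio z).indicator 1) 0 (fun i => o i ω) n -
          ((L n).bidCount univ - (L n).askCount univ)) :=
      mul_le_mul_of_nonneg_left (by simp only [L] at *; linarith) (by linarith)
    have e6 : 0 ≤ ((1 + w) * (2 * arrivalSum ((Iio z).indicator 1) 0 (fun i => o i ω) n -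
        ((L n).bidCount univ - (L n).askCount univ)) - n * (2⁻¹ * δ) - ((L n).value wb wa -
        ∑ i ∈ Finset.range n, ∫ a, (L i).gain wb wa a ∂(orderLaw fb fa))) / n :=
      div_nonneg (by linarith) hn0'.le
    refine e6.trans (le_of_eq ?_)
    simp only [L]
    field_simp

lemma IsOrderFlow.exists_pos_le_one_sub_cdf {x y : ℝ} (hxy : x < y)
    (h1 : priceCDF fb x = 1 - priceCDF fa y) (h2 : priceCDF fb y = 1 - priceCDF fa x)
    (h3 : 1 - 2 * priceCDF fb x * (1 - priceCDF fb x) < priceCDF fb y) :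
    ∃ ε > 0, ∀ z, AskRecurrent μ o z → ε ≤ 1 - priceCDF fa z := by
  obtain ⟨ε, hε, H⟩ := (h.mirror hfb hfa).exists_pos_le_cdf hfa.comp_neg hfb.comp_neg
    (neg_lt_neg hxy) (by simp only [hfa.cdf_comp_neg, hfb.cdf_comp_neg, neg_neg]; linarith)
    (by simp only [hfa.cdf_comp_neg, hfb.cdf_comp_neg, neg_neg]; linarith)
    (by simp only [hfa.cdf_comp_neg, neg_neg, ← h1, ← h2]; exact h3)
  refine ⟨ε, hε, fun z hz => ?_⟩
  have := H (-z) (by rwa [bidRecurrent_mirror, neg_neg])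
  rwa [hfa.cdf_comp_neg, neg_neg] at this

lemma IsOrderFlow.exists_isFiniteThresholds_of_escapes {x y : ℝ} (hx : 0 < priceCDF fb x)
    (hy : priceCDF fa y < 1) (hbx : BidEscapes μ o x) (hay : AskEscapes μ o y) :
    ∃ κb κa : ℝ, IsFiniteThresholds μ fb fa τ o κb κa := by
  have hb1 : (x : EReal) ≤ bidThreshold μ τ o := by
    rw [h.bidThreshold_eq]
    refine le_sInf ?_
    rintro _ ⟨z, hz, rfl⟩
    by_contra hcon
    exact hbx.not_bidRecurrent (BidRecurrent.mono hz (EReal.coe_le_coe_iff.1 (not_le.1 hcon).le))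
  have hb2 : bidThreshold μ τ o ≤ ((y + 1 : ℝ) : EReal) := by
    rw [h.bidThreshold_eq]
    refine sInf_le ⟨y + 1, ?_, rfl⟩
    filter_upwards [hay] with ω hω
    refine (hω.mono fun n hn => ?_).frequently
    exact ((Book.bestBid_le_bestAsk_bookAfter _ n).trans hn).trans_lt
      (EReal.coe_lt_coe_iff.2 (by linarith))
  have ha1 : askThreshold μ τ o ≤ (y : EReal) := by
    rw [h.askThreshold_eq]
    refine sSup_le ?_
    rintro _ ⟨z, hz, rfl⟩
    by_contra hcon
    have hr : AskRecurrent μ o y := AskRecurrent.mono hz (EReal.coe_le_coe_iff.1 (not_le.1 hcon).le)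
    obtain ⟨ω, h1, h2⟩ := (hay.and hr).exists
    obtain ⟨n, h3, h4⟩ := (h2.and_eventually h1).exists
    exact h3.not_ge h4
  have ha2 : ((x - 1 : ℝ) : EReal) ≤ askThreshold μ τ o := by
    rw [h.askThreshold_eq]
    refine le_sSup ⟨x - 1, ?_, rfl⟩
    filter_upwards [hbx] with ω hω
    refine (hω.mono fun n hn => ?_).frequently
    exact (EReal.coe_lt_coe_iff.2 (by linarith)).trans_le
      (hn.trans (Book.bestBid_le_bestAsk_bookAfter _ n))
  have eb : ((bidThreshold μ τ o).toReal : EReal) = bidThreshold μ τ o :=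
    EReal.coe_toReal (ne_top_of_le_ne_top (EReal.coe_ne_top _) hb2)
      (ne_bot_of_le_ne_bot (EReal.coe_ne_bot _) hb1)
  have ea : ((askThreshold μ τ o).toReal : EReal) = askThreshold μ τ o :=
    EReal.coe_toReal (ne_top_of_le_ne_top (EReal.coe_ne_top _) ha1)
      (ne_bot_of_le_ne_bot (EReal.coe_ne_bot _) ha2)
  refine ⟨_, _, eb.symm, ea.symm, ?_, ?_⟩
  · rw [← eb, EReal.coe_le_coe_iff] at hb1
    exact hx.trans_le (hfb.monotone_cdf hb1)
  · rw [← ea, EReal.coe_le_coe_iff] at ha1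
    exact (hfa.monotone_cdf ha1).trans_lt hy

/-- Levels so low that `F_b` is below the bound of `exists_pos_le_cdf` are not recurrent, so by the
dichotomy the highest bid is eventually above them; likewise for the lowest ask. -/
theorem IsOrderFlow.exists_isFiniteThresholds (hba : priceLaw fb ≪ priceLaw fa)
    (hab : priceLaw fa ≪ priceLaw fb) {x y : ℝ} (hxy : x < y)
    (h1 : priceCDF fb x = 1 - priceCDF fa y) (h2 : priceCDF fb y = 1 - priceCDF fa x)
    (h3 : 1 - 2 * priceCDF fb x * (1 - priceCDF fb x) < priceCDF fb y) :
    ∃ κb κa : ℝ, IsFiniteThresholds μ fb fa τ o κb κa := by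
  obtain ⟨ε, hε, Hε⟩ := h.exists_pos_le_cdf hfb hfa hxy h1 h2 h3
  obtain ⟨η, hη, Hη⟩ := h.exists_pos_le_one_sub_cdf hfb hfa hxy h1 h2 h3
  obtain ⟨r, hr0, hr⟩ := exists_between (lt_min hε one_pos)
  obtain ⟨s, hs0, hs⟩ := exists_between (lt_min hη one_pos)
  obtain ⟨a, ha⟩ := hfb.exists_cdf_eq hr0 (hr.trans_le (min_le_right _ _))
  obtain ⟨b, hb⟩ := hfa.exists_cdf_eq (r := 1 - s)
    (by linarith [hs.trans_le (min_le_right η 1)]) (by linarith)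
  refine h.exists_isFiniteThresholds_of_escapes hfb hfa (x := a) (y := b) (by linarith)
    (by linarith) ?_ ?_
  · refine (h.bidEscapes_or_bidRecurrent hfa ?_).resolve_right fun hrec => ?_
    · exact cdf_pos_of_ac hfb hfa hba (by linarith)
    · linarith [Hε a hrec, hr.trans_le (min_le_left ε 1)]
  · refine (h.askEscapes_or_askRecurrent hfb hfa ?_).resolve_right fun hrec => ?_
    · exact cdf_lt_one_of_ac hfa hfb hab (by linarith)
    · linarith [Hη b hrec, hs.trans_le (min_le_left η 1)]

end

/-! ### Uniform arrivals -/

lemma priceCDF_unif {x : ℝ} (hx : x ∈ Icc (0 : ℝ) 1) : priceCDF unif x = x := by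
  have : Iic x ∩ Icc 0 1 = Icc 0 x := by
    ext t
    simp only [mem_inter_iff, mem_Iic, mem_Icc]
    exact ⟨fun h => ⟨h.2.1, h.1⟩, fun h => ⟨h.2, h.1, h.2.trans hx.2⟩⟩
  rw [priceCDF, unif, setIntegral_indicator measurableSet_Icc, this]
  simp [hx.1]

lemma priceRange_unif (hf : IsPriceDensity unif) : priceRange unif unif = Ioo 0 1 := by
  ext x
  constructor
  · rintro ⟨h1, h2⟩
    by_contra hx
    rw [mem_Ioo, not_and_or, not_lt, not_lt] at hx
    rcases hx with hx | hx
    · have := hf.monotone_cdf hx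
      rw [priceCDF_unif ⟨le_rfl, zero_le_one⟩] at this
      exact h1.not_ge this
    · have := hf.monotone_cdf hx
      rw [priceCDF_unif ⟨zero_le_one, le_rfl⟩] at this
      exact h2.not_ge this
  · intro hx
    rw [priceRange, mem_ofPred_eq, priceCDF_unif (Ioo_subset_Icc_self hx)]
    exact hx

lemma unif_eq_one {x : ℝ} (hx : x ∈ Ioo (0 : ℝ) 1) : unif x = 1 :=
  indicator_of_mem (Ioo_subset_Icc_self hx) _

/-- The equation `w eʷ = e⁻¹` has exactly one real root, and the root satisfies
`0.217 / 0.783 < w < 0.218 / 0.782`. -/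
lemma exists_root_mul_exp : ∃ w : ℝ, 0.217 / 0.783 < w ∧ w < 0.218 / 0.782 ∧
    ∀ w' : ℝ, w' * Real.exp w' = Real.exp (-1) ↔ w' = w := by
  have hmono : StrictMonoOn (fun x : ℝ => x * Real.exp x) (Ici 0) := fun x hx y _ hxy =>
    mul_lt_mul'' hxy (Real.exp_lt_exp.2 hxy) hx (Real.exp_pos x).le
  have hlo : (0.217 / 0.783 : ℝ) * Real.exp (0.217 / 0.783) < Real.exp (-1) := by
    -- equivalently `exp 1 < (a exp a)⁻¹` for `a = 0.217 / 0.783`; three Taylor terms suffice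
    have h1 := Real.exp_bound' (x := 0.217 / 0.783) (by norm_num) (by norm_num) (n := 3)
      (by norm_num)
    norm_num [Finset.sum_range_succ, Nat.factorial] at h1 ⊢
    rw [Real.exp_neg, lt_inv_comm₀ (by positivity) (Real.exp_pos 1)]
    refine Real.exp_one_lt_d9.trans_le ((le_inv_comm₀ (by norm_num) (by positivity)).2 ?_)
    nlinarith
  have hhi : Real.exp (-1) < (0.218 / 0.782 : ℝ) * Real.exp (0.218 / 0.782) := by
    have h1 := Real.sum_le_exp_of_nonneg (x := 0.218 / 0.782) (by norm_num) 4
    norm_num [Finset.sum_range_succ, Nat.factorial] at h1 ⊢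
    rw [Real.exp_neg, inv_lt_comm₀ (Real.exp_pos 1) (by positivity)]
    refine lt_of_le_of_lt ?_ Real.exp_one_gt_d9
    refine (inv_le_comm₀ (by norm_num) (by positivity)).1 ?_
    nlinarith
  obtain ⟨w, hw, hwe⟩ := intermediate_value_Ioo (by norm_num)
    (f := fun x : ℝ => x * Real.exp x) (by fun_prop) ⟨hlo, hhi⟩
  have hw0 : 0 < w := lt_trans (by norm_num) hw.1
  refine ⟨w, hw.1, hw.2, fun w' => ⟨fun h => ?_, fun h => h ▸ hwe⟩⟩
  have hw' : 0 < w' := pos_of_mul_pos_left (h ▸ Real.exp_pos _) (Real.exp_pos w').le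
  exact hmono.injOn hw'.le hw0.le (h.trans hwe.symm)

lemma hasDerivAt_log_ratio {x : ℝ} (hx : x ∈ Ioo (0 : ℝ) 1) :
    HasDerivAt (fun t => Real.log ((1 - t) / t)) (-(1 / (1 - x)) - 1 / x) x := by
  have h0 := hx.1.ne'
  have h1 := (sub_pos.2 hx.2).ne'
  refine (((hasDerivAt_id' x).const_sub 1).div (hasDerivAt_id' x) h0).log
    (div_ne_zero h1 h0) |>.congr_deriv ?_
  rw [Pi.div_apply]
  field_simp

/-- For uniform arrivals the problem is solved by an explicit pair, provided that
`log ((1 - κ) / κ) = 1 / (1 - κ)`; this condition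
gives both the initial values at `κ` and the zero at `1 - κ`. -/
lemma solvesAt_unif (hf : IsPriceDensity unif) {κ : ℝ} (hκ : κ ∈ Ioo (0 : ℝ) 1)
    (hlog : (1 - κ) * Real.log ((1 - κ) / κ) = 1) :
    SolvesAt unif unif κ (fun x => (1 - κ) * (1 + x * Real.log ((1 - x) / x)))
      (fun x => (1 - κ) * (1 - (1 - x) * Real.log ((1 - x) / x))) := by
  have hI := priceRange_unif hf
  have hlc : ContinuousOn (fun t => Real.log ((1 - t) / t)) (Ioo 0 1) := fun t ht =>
    (hasDerivAt_log_ratio ht).continuousAt.continuousWithinAt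
  refine ⟨hI ▸ hκ, ?_, ?_, ?_⟩
  · have hu : IsPrimitiveOn (Ioo 0 1) (fun x => (1 - κ) * (1 + x * Real.log ((1 - x) / x)))
        (fun x => -(1 / (1 - x)) * ((1 - κ) * (1 - (1 - x) * Real.log ((1 - x) / x)))) := by
      refine .of_hasDerivAt ordConnected_Ioo ?_ fun x hx => ?_
      · have : ContinuousOn (fun x : ℝ => -(1 / (1 - x))) (Ioo 0 1) :=
          (continuousOn_const.div (by fun_prop) fun x hx => (sub_pos.2 hx.2).ne').neg
        fun_prop
      · have h0 := hx.1.ne'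
        have h1 := (sub_pos.2 hx.2).ne'
        refine ((((hasDerivAt_id' x).mul (hasDerivAt_log_ratio hx)).const_add 1).const_mul
          (1 - κ)).congr_deriv ?_
        field_simp
        ring
    have hq : IsPrimitiveOn (Ioo 0 1) (fun x => (1 - κ) * (1 - (1 - x) * Real.log ((1 - x) / x)))
        (fun x => 1 / x * ((1 - κ) * (1 + x * Real.log ((1 - x) / x)))) := by
      refine .of_hasDerivAt ordConnected_Ioo ?_ fun x hx => ?_
      · have : ContinuousOn (fun x : ℝ => 1 / x) (Ioo 0 1) :=
          continuousOn_const.div (by fun_prop) fun x hx => hx.1.ne'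
        fun_prop
      · have h0 := hx.1.ne'
        have h1 := (sub_pos.2 hx.2).ne'
        refine (((((hasDerivAt_id' x).const_sub 1).mul (hasDerivAt_log_ratio hx)).const_sub
          1).const_mul (1 - κ)).congr_deriv ?_
        field_simp
        ring
    have hF : ∀ x ∈ Ioo (0 : ℝ) 1, priceCDF unif x = x := fun x hx =>
      priceCDF_unif (Ioo_subset_Icc_self hx)
    rw [hI]
    exact ⟨hu.congr_deriv fun x hx => by simp only [hF x hx, unif_eq_one hx],
      hq.congr_deriv fun x hx => by simp only [hF x hx, unif_eq_one hx]⟩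
  · linear_combination κ * hlog
  · linear_combination -(1 - κ) * hlog

/-- The point `1 - κ` is the zero of the explicit solution. -/
theorem isVanishingPair_unif (hf : IsPriceDensity unif) {κ : ℝ} (hκ : κ ∈ Ioo (0 : ℝ) 1)
    (hlog : (1 - κ) * Real.log ((1 - κ) / κ) = 1) : IsVanishingPair unif unif κ (1 - κ) := by
  have hs := solvesAt_unif hf hκ hlog
  have hκ' : 1 - κ ∈ Ioo (0 : ℝ) 1 := ⟨sub_pos.2 hκ.2, by linarith [hκ.1]⟩
  refine ⟨hs.mem, ?_, _, hs.isSolution hf hf, ?_⟩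
  · rw [priceCDF_unif (Ioo_subset_Icc_self hκ), priceCDF_unif (Ioo_subset_Icc_self hκ')]
    ring
  · have hI : 1 - κ ∈ priceRange unif unif := (priceRange_unif hf).symm ▸ hκ'
    have hlim := (((hs.continuousOn_u hf hf).continuousAt
      ((isOpen_priceRange hf hf).mem_nhds hI)).div hf.continuous_cdf.continuousAt hI.1.ne').tendsto
    have h0 : (1 - κ) * (1 + (1 - κ) * Real.log ((1 - (1 - κ)) / (1 - κ))) = 0 := by
      rw [sub_sub_cancel, ← inv_div, Real.log_inv]
      linear_combination -(1 - κ) * hlog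
    simp only [Pi.div_apply, h0, zero_div] at hlim
    exact hlim.mono_left nhdsWithin_le_nhds

lemma IsSolution.eq_of_unif (hf : IsPriceDensity unif) {κ : ℝ} (hκ : κ ∈ Ioo (0 : ℝ) 1)
    (hlog : (1 - κ) * Real.log ((1 - κ) / κ) = 1) {ϖ : ℝ → ℝ} (h : IsSolution unif unif κ ϖ)
    {x : ℝ} (hx : x ∈ Ioo (0 : ℝ) 1) :
    ϖ x = (1 - κ) * (1 / x + Real.log ((1 - x) / x)) := by
  have hs := solvesAt_unif hf hκ hlog
  obtain ⟨ϖ₀, -, huniq⟩ := exists_isSolution_unique hf hf hs.mem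
  have hxI : x ∈ priceRange unif unif := (priceRange_unif hf).symm ▸ hx
  rw [huniq _ h hxI, ← huniq _ (hs.isSolution hf hf) hxI]
  simp only [priceCDF_unif (Ioo_subset_Icc_self hx)]
  have := hx.1.ne'
  field_simp

/-- Uniform arrivals: the thresholds are finite by the criterion at `x = 1/4`, `y = 3/4`, and the
uniqueness of the vanishing pair identifies them. -/
theorem IsOrderFlow.uniform {Ω : Type*} [MeasurableSpace Ω] {μ : Measure Ω}
    [IsProbabilityMeasure μ] {τ : ℕ → Ω → ℝ} {o : ℕ → Ω → Arrival}
    (h : IsOrderFlow μ unif unif τ o) (hf : IsPriceDensity unif) :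
    ∃ w κ : ℝ, (∀ w' : ℝ, w' * Real.exp w' = Real.exp (-1) ↔ w' = w) ∧
      κ = w / (w + 1) ∧ 0.217 < κ ∧ κ < 0.218 ∧
      IsFiniteThresholds μ unif unif τ o κ (1 - κ) ∧
      ∀ ϖ : ℝ → ℝ, IsSolution unif unif κ ϖ → ∀ x ∈ Ioo κ (1 - κ),
        ϖ x = (1 - κ) * (1 / x + Real.log ((1 - x) / x)) := by
  obtain ⟨w, hw1, hw2, hw⟩ := exists_root_mul_exp
  have hw0 : 0 < w := lt_trans (by norm_num) hw1
  have hκ1 : 0.217 < w / (w + 1) := by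
    rw [lt_div_iff₀ (by positivity)]; norm_num at hw1 ⊢; linarith
  have hκ2 : w / (w + 1) < 0.218 := by
    rw [div_lt_iff₀ (by positivity)]; norm_num at hw2 ⊢; linarith
  have hlog : (1 - w / (w + 1)) * Real.log ((1 - w / (w + 1)) / (w / (w + 1))) = 1 := by
    have h1 : (1 - w / (w + 1)) / (w / (w + 1)) = w⁻¹ := by field_simp; ring
    have h2 : Real.log w + w = -1 := by
      have := congrArg Real.log ((hw w).2 rfl)
      rwa [Real.log_mul hw0.ne' (Real.exp_pos _).ne', Real.log_exp, Real.log_exp] at this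
    rw [h1, Real.log_inv, show -Real.log w = w + 1 by linarith]
    field_simp
    ring
  set κ := w / (w + 1)
  norm_num at hκ1 hκ2
  have hκ : κ ∈ Ioo (0 : ℝ) 1 := ⟨by linarith, by linarith⟩
  have hac : priceLaw unif ≪ priceLaw unif := Measure.AbsolutelyContinuous.rfl
  have hF : ∀ x ∈ Icc (0 : ℝ) 1, priceCDF unif x = x := fun x => priceCDF_unif
  refine ⟨w, κ, hw, rfl, by norm_num; exact hκ1, by norm_num; exact hκ2, ?_, fun ϖ hϖ x hx =>
    hϖ.eq_of_unif hf hκ hlog ⟨hκ.1.trans hx.1, hx.2.trans (by linarith [hκ.1])⟩⟩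
  obtain ⟨κb, κa, hfin⟩ := h.exists_isFiniteThresholds hf hf hac hac (x := 1 / 4) (y := 3 / 4)
    (by norm_num) (by rw [hF _ (by norm_num), hF _ (by norm_num)]; norm_num)
    (by rw [hF _ (by norm_num), hF _ (by norm_num)]; norm_num)
    (by rw [hF _ (by norm_num), hF _ (by norm_num)]; norm_num)
  have hmono : StrictMonoOn (priceCDF unif) (priceRange unif unif) := by
    rw [priceRange_unif hf]
    intro x hx y hy hxy
    rwa [hF x (Ioo_subset_Icc_self hx), hF y (Ioo_subset_Icc_self hy)]
  obtain ⟨rfl, e⟩ := (isVanishingPair_unif hf hκ hlog).eq_of_strictMonoOn hf hf hac hac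
    (hfin.lt_and_isVanishingPair h hf hf hac hac).2 hmono
  exact e ▸ hfin

end LimitOrderBook

theorem mainTheorem3 {Ω : Type*} [MeasurableSpace Ω] (μ : Measure Ω) [IsProbabilityMeasure μ]
    (fb fa : ℝ → ℝ) (hfb : IsPriceDensity fb) (hfa : IsPriceDensity fa)
    (hba : priceLaw fb ≪ priceLaw fa) (hab : priceLaw fa ≪ priceLaw fb)
    (τ : ℕ → Ω → ℝ) (o : ℕ → Ω → Arrival) (hflow : IsOrderFlow μ fb fa τ o) :
    -- the initial value problem has exactly one solution on the price range
    (∀ c ∈ priceRange fb fa, ∃ ϖ : ℝ → ℝ, IsSolution fb fa c ϖ ∧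
      ∀ ϖ' : ℝ → ℝ, IsSolution fb fa c ϖ' → EqOn ϖ' ϖ (priceRange fb fa)) ∧
    -- for continuous positive densities it is the classical one
    (ContinuousOn fb (priceRange fb fa) → ContinuousOn fa (priceRange fb fa) →
      (∀ x ∈ priceRange fb fa, 0 < fb x ∧ 0 < fa x) →
      ∀ c ∈ priceRange fb fa, ∀ ϖ : ℝ → ℝ,
        IsSolution fb fa c ϖ ↔ IsClassicalSolution fb fa c ϖ) ∧
    -- characterization of finite thresholds
    (∀ κb κa : ℝ, IsFiniteThresholds μ fb fa τ o κb κa →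
      κb < κa ∧
      IsVanishingPair fb fa κb κa ∧
      (∀ c d : ℝ, IsVanishingPair fb fa c d → priceCDF fb c = priceCDF fb κb ∧ priceCDF fa d = priceCDF fa κa) ∧
      (StrictMonoOn (priceCDF fb) (priceRange fb fa) →
        ∀ c d : ℝ, IsVanishingPair fb fa c d → c = κb ∧ d = κa)) ∧
    -- a sufficient condition for finite thresholds
    ((∃ x y : ℝ, x < y ∧ priceCDF fb x = 1 - priceCDF fa y ∧ priceCDF fb y = 1 - priceCDF fa x ∧
        1 - 2 * priceCDF fb x * (1 - priceCDF fb x) < priceCDF fb y) →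
      ∃ κb κa : ℝ, IsFiniteThresholds μ fb fa τ o κb κa) ∧
    -- uniform arrivals
    (fb = unif → fa = unif →
      ∃ w κ : ℝ, (∀ w' : ℝ, w' * Real.exp w' = Real.exp (-1) ↔ w' = w) ∧
        κ = w / (w + 1) ∧ 0.217 < κ ∧ κ < 0.218 ∧
        IsFiniteThresholds μ fb fa τ o κ (1 - κ) ∧
        ∀ ϖ : ℝ → ℝ, IsSolution fb fa κ ϖ → ∀ x ∈ Ioo κ (1 - κ),
          ϖ x = (1 - κ) * (1 / x + Real.log ((1 - x) / x))) := by
  refine ⟨fun c hc => exists_isSolution_unique hfb hfa hc,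
    fun hcb hca hpos c hc ϖ => isSolution_iff_isClassicalSolution hfb hfa hcb hca hpos hc ϖ,
    fun κb κa hκ => ?_, ?_, ?_⟩
  · obtain ⟨hlt, hvp⟩ := hκ.lt_and_isVanishingPair hflow hfb hfa hba hab
    exact ⟨hlt, hvp, fun c d h => h.cdf_eq hfb hfa hab hvp,
      fun hm c d h => h.eq_of_strictMonoOn hfb hfa hab hba hvp hm⟩
  · rintro ⟨x, y, hxy, h1, h2, h3⟩
    exact hflow.exists_isFiniteThresholds hfb hfa hba hab hxy h1 h2 h3
  · rintro rfl rfl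
    exact hflow.uniform hfb
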